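/- Conventions. For a complex matrix $M$, $M^T$ is its transpose and $M^*$ its conjugate transpose. A $q\times q$ matrix $S$ of complex rational functions is a \emph{Schur function} if it is holomorphic in $\{\mathrm{Re}\,s>0\}$ and $S(s)S(s)^*\le I_q$ there; it is \emph{inner} if moreover $S(i\omega)S(i\omega)^*=I_q$ for all $\omega\in\mathbb R$. It is \emph{symmetric} if $S^T=S$, and \emph{strictly contractive at infinity} if $\|S(\infty)\|<1$ (Euclidean operator norm). A \emph{realization} of size $n$ of a rational matrix $S$ is a quadruple of complex matrices $(A,B,C,D)$, with $A$ of size $n\times n$, such that $S(s)=C(sI_n-A)^{-1}B+D$; it is \emph{minimal} if $n$ is as small as possible, and this smallest $n$ is the \emph{McMillan degree} of $S$; it is \emph{symmetric} if $A=A^T$, $B^T=C$, $D=D^T$. A $2p\times 2p$ \emph{extension} of a $p\times p$ matrix $S$ is a $2p\times 2p$ rational matrix whose lower right $p\times p$ block is $S$. Statement. Let $S$ be a $p\times p$ symmetric rational Schur function that is strictly contractive at infinity. Then $S$ has a minimal symmetric realization. Let $(A,B,C,D)$ be any minimal symmetric realization of $S$, let $n$ be its size, and put $$\hat A=A+BD^*(I_p-DD^*)^{-1}C,\quad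 \hat B=B(I_p-D^*D)^{-1/2},\quad \hat C=(I_p-DD^*)^{-1/2}C,$$ $$H=\begin{pmatrix}-\hat A^*&-\hat C^*\hat C\\ \hat B\hat B^*&\hat A\end{pmatrix}.$$ Then the following are equivalent: (i) $S$ has a $2p\times 2p$ symmetric inner extension of the same McMillan degree as $S$; (ii) there is a Hermitian $n\times n$ matrix $P$ with $PP^T=I_n$ that solves the Riccati equation $$P\hat C^*\hat C P+\hat A P+P\hat A^*+\hat B\hat B^*=0;$$ (iii) the characteristic polynomial of $H$ is $\chi_H(s)=\pi(s)^2$ for some polynomial $\pi\in\mathbb C[s]$. Moreover, the extensions in (i) are exactly the functions $$\mathcal S=\begin{pmatrix}U_2&0\\0&I_p\end{pmatrix}\mathcal S_P\begin{pmatrix}U_1&0\\0&I_p\end{pmatrix},$$ where $U_1,U_2$ are unitary $p\times p$ matrices with $U_1=U_2^T$, where $P$ is as in (ii), and where $$\mathcal S_P(s)=\begin{pmatrix}C_1\\ C\end{pmatrix}(sI_n-A)^{-1}\begin{pmatrix}B_1&B\end{pmatrix}+\begin{pmatrix}-D^*&(I_p-D^*D)^{1/2}\\ (I_p-DD^*)^{1/2}&D\end{pmatrix},$$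 $$C_1=-(I_p-D^*D)^{-1/2}(B^*P^{-1}+D^*C),\qquad B_1=-(PC^*+BD^*)(I_p-DD^*)^{-1/2}.$$ -/

import Mathlib

open scoped Matrix

namespace SymDarlington

section Rational

variable {ι κ : Type*}

/-- The value at the point `s` of a matrix of complex rational functions (meaningful where no entry
has a pole; each entry is evaluated as its reduced fraction). -/
noncomputable def evalAt (S : Matrix ι κ (RatFunc ℂ)) (s : ℂ) : Matrix ι κ ℂ :=
  S.map (RatFunc.eval (RingHom.id ℂ) s)

/-- No entry of `S` has a pole at `s`. -/
def FiniteAt (S : Matrix ι κ (RatFunc ℂ)) (s : ℂ) : Prop :=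
  ∀ i j, (S i j).denom.eval s ≠ 0

/-- `S` is proper and `D` is its value at infinity: `S(s) → D` as `|s| → ∞`. -/
def HasValueAtInfinity (S : Matrix ι κ (RatFunc ℂ)) (D : Matrix ι κ ℂ) : Prop :=
  ∀ i j, Filter.Tendsto (fun s : ℂ => evalAt S s i j) (Bornology.cobounded ℂ) (nhds (D i j))

section
open scoped ComplexOrder

/-- A rational Schur function: holomorphic in the open right half-plane, with
`S(s) S(s)* ≤ I` there. -/
def IsSchur [Fintype ι] [DecidableEq ι] (S : Matrix ι ι (RatFunc ℂ)) : Prop :=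
  ∀ s : ℂ, 0 < s.re → FiniteAt S s ∧ (1 - evalAt S s * (evalAt S s)ᴴ).PosSemidef

end

/-- A rational inner (lossless) function: a Schur function with `S(iω) S(iω)* = I` for real `ω`. -/
def IsInner [Fintype ι] [DecidableEq ι] (S : Matrix ι ι (RatFunc ℂ)) : Prop :=
  IsSchur S ∧ ∀ ω : ℝ, evalAt S (Complex.I * ω) * (evalAt S (Complex.I * ω))ᴴ = 1

section
open scoped Matrix.Norms.L2Operator

/-- `‖S(∞)‖ < 1`, in the operator norm induced by the Euclidean norm. -/
def StrictlyContractiveAtInfinity [Fintype ι] [DecidableEq ι]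
    (S : Matrix ι ι (RatFunc ℂ)) : Prop :=
  ∃ D : Matrix ι ι ℂ, HasValueAtInfinity S D ∧ ‖D‖ < 1

end

/-- The transfer function `C (s I - A)⁻¹ B + D`. -/
noncomputable def transfer {n : ℕ} (A : Matrix (Fin n) (Fin n) ℂ) (B : Matrix (Fin n) κ ℂ)
    (C : Matrix ι (Fin n) ℂ) (D : Matrix ι κ ℂ) : Matrix ι κ (RatFunc ℂ) :=
  C.map RatFunc.C * (Matrix.scalar (Fin n) RatFunc.X - A.map RatFunc.C)⁻¹ * B.map RatFunc.C
    + D.map RatFunc.C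

/-- `S` has a realization with state space of dimension `n`. -/
def HasRealizationOfSize (S : Matrix ι κ (RatFunc ℂ)) (n : ℕ) : Prop :=
  ∃ (A : Matrix (Fin n) (Fin n) ℂ) (B : Matrix (Fin n) κ ℂ) (C : Matrix ι (Fin n) ℂ)
    (D : Matrix ι κ ℂ), S = transfer A B C D

/-- `S` has McMillan degree `n`: `n` is the smallest size of a realization of `S`. -/
def HasMcMillanDegree (S : Matrix ι κ (RatFunc ℂ)) (n : ℕ) : Prop :=
  IsLeast {m : ℕ | HasRealizationOfSize S m} n

/-- `S` and `T` have the same McMillan degree. -/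
def SameMcMillanDegree {ι' κ' : Type*} (S : Matrix ι κ (RatFunc ℂ))
    (T : Matrix ι' κ' (RatFunc ℂ)) : Prop :=
  ∃ n : ℕ, HasMcMillanDegree S n ∧ HasMcMillanDegree T n

/-- `(A, B, C, D)` is a minimal realization of `S`. -/
def IsMinimalRealization {n : ℕ} (S : Matrix ι κ (RatFunc ℂ)) (A : Matrix (Fin n) (Fin n) ℂ)
    (B : Matrix (Fin n) κ ℂ) (C : Matrix ι (Fin n) ℂ) (D : Matrix ι κ ℂ) : Prop :=
  S = transfer A B C D ∧ HasMcMillanDegree S n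

/-- `(A, B, C, D)` is a minimal realization of `S` which is symmetric:
`A = Aᵀ`, `Bᵀ = C`, `D = Dᵀ`. -/
def IsMinimalSymmetricRealization {n : ℕ} (S : Matrix ι ι (RatFunc ℂ))
    (A : Matrix (Fin n) (Fin n) ℂ) (B : Matrix (Fin n) ι ℂ) (C : Matrix ι (Fin n) ℂ)
    (D : Matrix ι ι ℂ) : Prop :=
  IsMinimalRealization S A B C D ∧ A = Aᵀ ∧ Bᵀ = C ∧ D = Dᵀ

/-- `T` is a symmetric inner extension (of twice the size) of `S`, of the same McMillan degree;
`S` is the lower right block of `T`. -/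
def IsSymmetricInnerExtension [Fintype ι] [DecidableEq ι] (S : Matrix ι ι (RatFunc ℂ))
    (T : Matrix (ι ⊕ ι) (ι ⊕ ι) (RatFunc ℂ)) : Prop :=
  T.toBlocks₂₂ = S ∧ Tᵀ = T ∧ IsInner T ∧ SameMcMillanDegree T S

end Rational

section Riccati

variable {n : ℕ} {ι : Type*} [Fintype ι] [DecidableEq ι]

/-- `(I - D* D)^{1/2}` -/
noncomputable def sqrtR (D : Matrix ι ι ℂ) : Matrix ι ι ℂ :=
  open scoped MatrixOrder in CFC.sqrt (1 - Dᴴ * D)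

/-- `(I - D D*)^{1/2}` -/
noncomputable def sqrtL (D : Matrix ι ι ℂ) : Matrix ι ι ℂ :=
  open scoped MatrixOrder in CFC.sqrt (1 - D * Dᴴ)

/-- `Â = A + B D* (I - D D*)⁻¹ C` -/
noncomputable def hatA (A : Matrix (Fin n) (Fin n) ℂ) (B : Matrix (Fin n) ι ℂ)
    (C : Matrix ι (Fin n) ℂ) (D : Matrix ι ι ℂ) : Matrix (Fin n) (Fin n) ℂ :=
  A + B * Dᴴ * (1 - D * Dᴴ)⁻¹ * C

/-- `B̂ = B (I - D* D)^{-1/2}` -/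
noncomputable def hatB (B : Matrix (Fin n) ι ℂ) (D : Matrix ι ι ℂ) : Matrix (Fin n) ι ℂ :=
  B * (sqrtR D)⁻¹

/-- `Ĉ = (I - D D*)^{-1/2} C` -/
noncomputable def hatC (C : Matrix ι (Fin n) ℂ) (D : Matrix ι ι ℂ) : Matrix ι (Fin n) ℂ :=
  (sqrtL D)⁻¹ * C

/-- The Hamiltonian matrix `H`, with rows `(-Â*, -Ĉ* Ĉ)` and `(B̂ B̂*, Â)`. -/
noncomputable def hamiltonian (A : Matrix (Fin n) (Fin n) ℂ) (B : Matrix (Fin n) ι ℂ)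
    (C : Matrix ι (Fin n) ℂ) (D : Matrix ι ι ℂ) :
    Matrix (Fin n ⊕ Fin n) (Fin n ⊕ Fin n) ℂ :=
  Matrix.fromBlocks (-(hatA A B C D)ᴴ) (-((hatC C D)ᴴ * hatC C D))
    (hatB B D * (hatB B D)ᴴ) (hatA A B C D)

/-- `P` is a Hermitian solution of the Riccati equation
`P Ĉ* Ĉ P + Â P + P Â* + B̂ B̂* = 0`. -/
def IsHermitianRiccatiSolution (A : Matrix (Fin n) (Fin n) ℂ) (B : Matrix (Fin n) ι ℂ)
    (C : Matrix ι (Fin n) ℂ) (D : Matrix ι ι ℂ) (P : Matrix (Fin n) (Fin n) ℂ) : Prop :=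
  P.IsHermitian ∧
    P * ((hatC C D)ᴴ * hatC C D) * P + hatA A B C D * P + P * (hatA A B C D)ᴴ
      + hatB B D * (hatB B D)ᴴ = 0

/-- `C₁ = -(I - D* D)^{-1/2} (B* P⁻¹ + D* C)` -/
noncomputable def outC (B : Matrix (Fin n) ι ℂ) (C : Matrix ι (Fin n) ℂ) (D : Matrix ι ι ℂ)
    (P : Matrix (Fin n) (Fin n) ℂ) : Matrix ι (Fin n) ℂ :=
  -((sqrtR D)⁻¹ * (Bᴴ * P⁻¹ + Dᴴ * C))

/-- `B₁ = -(P C* + B D*) (I - D D*)^{-1/2}` -/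
noncomputable def inB (B : Matrix (Fin n) ι ℂ) (C : Matrix ι (Fin n) ℂ) (D : Matrix ι ι ℂ)
    (P : Matrix (Fin n) (Fin n) ℂ) : Matrix (Fin n) ι ℂ :=
  -((P * Cᴴ + B * Dᴴ) * (sqrtL D)⁻¹)

/-- The extension `𝒮_P`: dynamics matrix `A`, input matrix `(B₁ B)`, output matrix `(C₁ ; C)` and
value at infinity with rows `(-D*, (I - D* D)^{1/2})` and `((I - D D*)^{1/2}, D)`. -/
noncomputable def extensionOf (A : Matrix (Fin n) (Fin n) ℂ) (B : Matrix (Fin n) ι ℂ)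
    (C : Matrix ι (Fin n) ℂ) (D : Matrix ι ι ℂ) (P : Matrix (Fin n) (Fin n) ℂ) :
    Matrix (ι ⊕ ι) (ι ⊕ ι) (RatFunc ℂ) :=
  transfer A (Matrix.fromCols (inB B C D P) B) (Matrix.fromRows (outC B C D P) C)
    (Matrix.fromBlocks (-Dᴴ) (sqrtR D) (sqrtL D) D)

/-- The constant rational matrix `diag(U, I)`. -/
noncomputable def diagOne (U : Matrix ι ι ℂ) : Matrix (ι ⊕ ι) (ι ⊕ ι) (RatFunc ℂ) :=
  (Matrix.fromBlocks U 0 0 1 : Matrix (ι ⊕ ι) (ι ⊕ ι) ℂ).map RatFunc.C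

end Riccati

end SymDarlington

open SymDarlington

/-!
Symmetric Darlington extensions of a rational Schur function, described by the solutions `P` with
`P Pᵀ = 1` of a Riccati equation.

*Symmetric realizations.* A minimal realization `(A, B, C, D)` of `S = Sᵀ` and its transpose are
isomorphic through a matrix `X`, which uniqueness of the isomorphism forces to be symmetric. Over
`ℂ` one can write `X = Rᵀ R`, and changing the basis by `R` makes the realization symmetric
(`exists_minimal_symmetric_realization`).

*Extensions and Riccati solutions.* For the system of `𝒮_P` the Lyapunov equation
`A P + P A* + B B* = 0` is the Riccati equation (`IsStrictContraction.lyapunov_eq_riccati`), so `𝒮_P`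
has a losslessness certificate `P`; since `A` is stable, `P ≥ 0` and `𝒮_P` is inner
(`posSemidef_of_lyapunov`, `IsLosslessSystem.isInner`). Conversely an inner function with a minimal
realization is the inverse of its para-Hermitian conjugate, and the isomorphism between the two
resulting realizations is a certificate `P` (`exists_isLosslessSystem`). If the realization is
symmetric, `(Pᵀ)⁻¹` is another certificate, so `P Pᵀ = 1`
(`IsLosslessSystem.mul_transpose_eq_one`). An extension is then determined by `P` and by its value
at infinity, a unitary completion of `D`, which leaves the freedom of the factors `U₁` and `U₂`
(`exists_solution_of_isSymmetricInnerExtension`).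

*The Hamiltonian.* Write the state vectors as pairs `(x, y)`. The Hamiltonian `H` of a symmetric
realization is self-adjoint for the complex bilinear form `xᵀ x' - yᵀ y'` and anticommutes with the
antilinear involution `τ (x, y) = (ȳ, x̄)`. The graphs of Hermitian solutions `P` are exactly the
invariant subspaces that are Lagrangian for the skew-Hermitian form obtained by pairing with `τ`,
observability being what makes such subspaces graphs (`exists_riccati_of_lagrangian`), and
`P Pᵀ = 1` says that the graph is `τ`-invariant, hence Lagrangian for the bilinear form too.

If such a `P` exists, then `H` is similar to a block triangular matrix whose diagonal blocks have the
same characteristic polynomial, so `χ_H` is a square (`charpoly_hamBlock_eq_sq`). Conversely, let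
`χ_H` be a square. A generalized eigenspace of even dimension contains an invariant subspace that
is its own orthogonal complement there (`exists_lagrangian_maxGenEigenspace`). Take such halves for
the eigenvalues with `Re > 0` and their images under `τ` for those with `Re < 0`. For imaginary
eigenvalues take the part of the graph of any Hermitian solution; it is the same for all of them
(`riccati_eq_on_imaginary`) and therefore `τ`-invariant. The sum is the graph of the wanted `P`
(`exists_symmetric_riccati`).

*Existence of a Hermitian solution.* For `t < 1` the function `t² S` is a strict contraction on the
imaginary axis, so its Hamiltonian has no imaginary eigenvalue and its stable subspace is the graph
of a solution (`exists_riccati_smul`). By observability these solutions stay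
bounded as `t → 1`, and a limit point solves the equation for `S`
(`exists_riccati_of_tendsto`, `exists_hermitian_riccati`).
-/

namespace SymDarlington

/-! ### Evaluation of rational matrices -/

/-- The rational functions without a pole at `s`, as a subring. -/
noncomputable def regularAt (s : ℂ) : Subring (RatFunc ℂ) where
  carrier := {f | f.denom.eval s ≠ 0}
  mul_mem' {f g} hf hg := fun h => by
    obtain ⟨q, hq⟩ := RatFunc.denom_mul_dvd f g
    have : (f.denom * g.denom).eval s = 0 := by rw [hq, Polynomial.eval_mul, h, zero_mul]
    rw [Polynomial.eval_mul] at this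
    exact (mul_ne_zero hf hg) this
  add_mem' {f g} hf hg := fun h => by
    obtain ⟨q, hq⟩ := RatFunc.denom_add_dvd f g
    have : (f.denom * g.denom).eval s = 0 := by rw [hq, Polynomial.eval_mul, h, zero_mul]
    rw [Polynomial.eval_mul] at this
    exact (mul_ne_zero hf hg) this
  one_mem' := by simp
  zero_mem' := by simp
  neg_mem' {f} hf := fun h => by
    obtain ⟨q, hq⟩ := RatFunc.denom_mul_dvd (-1) f
    have h1 : (-1 : RatFunc ℂ) = RatFunc.C (-1) := by simp
    have : (f.denom).eval s = 0 := by
      have h2 : ((RatFunc.denom (-1 : RatFunc ℂ)) * f.denom).eval s = 0 := by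
        rw [hq, Polynomial.eval_mul, neg_one_mul, h, zero_mul]
      rw [h1, RatFunc.denom_C] at h2
      simpa using h2
    exact hf this

lemma mem_regularAt {s : ℂ} {f : RatFunc ℂ} : f ∈ regularAt s ↔ f.denom.eval s ≠ 0 := Iff.rfl

lemma algebraMap_mem_regularAt (s : ℂ) (q : Polynomial ℂ) :
    algebraMap (Polynomial ℂ) (RatFunc ℂ) q ∈ regularAt s := by
  simp [mem_regularAt]

lemma C_mem_regularAt (s : ℂ) (c : ℂ) : RatFunc.C c ∈ regularAt s := by
  simp [mem_regularAt]

lemma X_mem_regularAt (s : ℂ) : RatFunc.X ∈ regularAt s := by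
  simp [mem_regularAt]

lemma inv_mem_regularAt {s : ℂ} {q : Polynomial ℂ} (hq : q.eval s ≠ 0) :
    (algebraMap (Polynomial ℂ) (RatFunc ℂ) q)⁻¹ ∈ regularAt s := by
  intro h
  have h0 : (algebraMap (Polynomial ℂ) (RatFunc ℂ) q)⁻¹
      = algebraMap _ _ (1 : Polynomial ℂ) / algebraMap _ _ q := by simp
  obtain ⟨r, hr⟩ := RatFunc.denom_div_dvd (1 : Polynomial ℂ) q
  rw [h0] at h
  apply hq
  rw [hr, Polynomial.eval_mul, h, zero_mul]

lemma eval_add_of_regular {s : ℂ} {f g : RatFunc ℂ} (hf : f ∈ regularAt s) (hg : g ∈ regularAt s) :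
    (f + g).eval (RingHom.id ℂ) s = f.eval (RingHom.id ℂ) s + g.eval (RingHom.id ℂ) s :=
  RatFunc.eval_add _ _ (by rw [Polynomial.eval₂_id]; exact hf)
    (by rw [Polynomial.eval₂_id]; exact hg)

lemma eval_mul_of_regular {s : ℂ} {f g : RatFunc ℂ} (hf : f ∈ regularAt s) (hg : g ∈ regularAt s) :
    (f * g).eval (RingHom.id ℂ) s = f.eval (RingHom.id ℂ) s * g.eval (RingHom.id ℂ) s :=
  RatFunc.eval_mul _ _ (by rw [Polynomial.eval₂_id]; exact hf)
    (by rw [Polynomial.eval₂_id]; exact hg)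

lemma eval_algebraMap_polynomial (q : Polynomial ℂ) (s : ℂ) :
    (algebraMap (Polynomial ℂ) (RatFunc ℂ) q).eval (RingHom.id ℂ) s = q.eval s := by
  simp [RatFunc.eval, Polynomial.eval₂_id]

/-- Evaluation at `s` as a ring homomorphism on the functions without a pole there. -/
noncomputable def evalHom (s : ℂ) : regularAt s →+* ℂ where
  toFun f := f.1.eval (RingHom.id ℂ) s
  map_one' := by simp
  map_zero' := by simp
  map_add' f g := eval_add_of_regular f.2 g.2
  map_mul' f g := eval_mul_of_regular f.2 g.2

section Matrices

variable {ι κ μ : Type*}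

lemma FiniteAt.mul [Fintype κ] {S : Matrix ι κ (RatFunc ℂ)} {T : Matrix κ μ (RatFunc ℂ)} {s : ℂ}
    (hS : FiniteAt S s) (hT : FiniteAt T s) : FiniteAt (S * T) s := fun i j =>
  Subring.sum_mem (regularAt s) fun k _ => Subring.mul_mem _ (hS i k) (hT k j)

lemma FiniteAt.add {S T : Matrix ι κ (RatFunc ℂ)} {s : ℂ}
    (hS : FiniteAt S s) (hT : FiniteAt T s) : FiniteAt (S + T) s := fun i j =>
  (regularAt s).add_mem (hS i j) (hT i j)

lemma finiteAt_const (M : Matrix ι κ ℂ) (s : ℂ) : FiniteAt (M.map RatFunc.C) s := fun i j =>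
  C_mem_regularAt s (M i j)

lemma evalAt_const (M : Matrix ι κ ℂ) (s : ℂ) : evalAt (M.map RatFunc.C) s = M := by
  ext i j
  simp [evalAt]

lemma evalAt_add {S T : Matrix ι κ (RatFunc ℂ)} {s : ℂ}
    (hS : FiniteAt S s) (hT : FiniteAt T s) : evalAt (S + T) s = evalAt S s + evalAt T s := by
  ext i j
  exact eval_add_of_regular (hS i j) (hT i j)

lemma evalAt_mul [Fintype κ] {S : Matrix ι κ (RatFunc ℂ)} {T : Matrix κ μ (RatFunc ℂ)} {s : ℂ}
    (hS : FiniteAt S s) (hT : FiniteAt T s) : evalAt (S * T) s = evalAt S s * evalAt T s := by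
  ext i j
  have h : (S * T) i j = ((∑ k, (⟨S i k, hS i k⟩ * ⟨T k j, hT k j⟩ : regularAt s) :
      regularAt s) : RatFunc ℂ) := by
    simp [Matrix.mul_apply]
  have h2 : evalAt (S * T) s i j
      = evalHom s (∑ k, (⟨S i k, hS i k⟩ * ⟨T k j, hT k j⟩ : regularAt s)) := by
    simp only [evalAt, Matrix.map_apply, h]; rfl
  rw [h2, map_sum, Matrix.mul_apply]
  refine Finset.sum_congr rfl fun k _ => ?_
  rw [map_mul]; rfl

/-- Rational matrices agree if their values agree on an infinite set of regular points. -/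
lemma eq_of_evalAt_eq {S T : Matrix ι κ (RatFunc ℂ)} {Z : Set ℂ} (hZ : Z.Infinite)
    (hS : ∀ s ∈ Z, FiniteAt S s) (hT : ∀ s ∈ Z, FiniteAt T s)
    (h : ∀ s ∈ Z, evalAt S s = evalAt T s) : S = T := by
  ext i j
  have h1 : (S i j).num * (T i j).denom = (T i j).num * (S i j).denom := by
    refine Polynomial.eq_of_infinite_eval_eq _ _ (hZ.mono fun s hs => ?_)
    have h2 := congrFun (congrFun (h s hs) i) j
    simp only [evalAt, Matrix.map_apply, RatFunc.eval, Polynomial.eval₂_id] at h2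
    rw [div_eq_div_iff (hS s hs i j) (hT s hs i j)] at h2
    simpa using h2
  rw [← RatFunc.num_div_denom (S i j), ← RatFunc.num_div_denom (T i j), div_eq_div_iff]
  · rw [← map_mul, ← map_mul, h1]
  · simpa using RatFunc.denom_ne_zero (S i j)
  · simpa using RatFunc.denom_ne_zero (T i j)

end Matrices

/-! ### Transfer functions -/

section Transfer

variable {σ : Type*} [Fintype σ] [DecidableEq σ]

/-- The rational matrix `s I - A`. -/
noncomputable def sMinus (A : Matrix σ σ ℂ) : Matrix σ σ (RatFunc ℂ) :=
  Matrix.scalar σ RatFunc.X - A.map RatFunc.C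

lemma sMinus_eq_map (A : Matrix σ σ ℂ) :
    sMinus A = A.charmatrix.map (algebraMap (Polynomial ℂ) (RatFunc ℂ)) := by
  ext i j
  by_cases h : i = j
  · subst h; simp [sMinus, Matrix.charmatrix]
  · simp [sMinus, Matrix.charmatrix, h]

lemma det_sMinus (A : Matrix σ σ ℂ) :
    (sMinus A).det = algebraMap (Polynomial ℂ) (RatFunc ℂ) A.charpoly := by
  rw [sMinus_eq_map, ← RingHom.mapMatrix_apply, ← RingHom.map_det]; rfl

lemma isUnit_det_sMinus (A : Matrix σ σ ℂ) : IsUnit (sMinus A).det := by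
  rw [det_sMinus, isUnit_iff_ne_zero]
  simpa using (Matrix.charpoly_monic A).ne_zero

lemma sMinus_mul_inv (A : Matrix σ σ ℂ) : sMinus A * (sMinus A)⁻¹ = 1 :=
  Matrix.mul_nonsing_inv _ (isUnit_det_sMinus A)

lemma inv_mul_sMinus (A : Matrix σ σ ℂ) : (sMinus A)⁻¹ * sMinus A = 1 :=
  Matrix.nonsing_inv_mul _ (isUnit_det_sMinus A)

lemma finiteAt_sMinus (A : Matrix σ σ ℂ) (s : ℂ) : FiniteAt (sMinus A) s := fun i j => by
  rw [sMinus_eq_map]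
  exact algebraMap_mem_regularAt s _

lemma evalAt_sMinus (A : Matrix σ σ ℂ) (s : ℂ) :
    evalAt (sMinus A) s = Matrix.scalar σ s - A := by
  ext i j
  rw [sMinus_eq_map, evalAt, Matrix.map_apply, Matrix.map_apply, eval_algebraMap_polynomial]
  by_cases h : i = j
  · subst h; simp [Matrix.charmatrix]
  · simp [Matrix.charmatrix, h]

lemma charpoly_eval (A : Matrix σ σ ℂ) (s : ℂ) :
    A.charpoly.eval s = (Matrix.scalar σ s - A).det :=
  Matrix.eval_charpoly A s

lemma finiteAt_inv_sMinus {A : Matrix σ σ ℂ} {s : ℂ} (hs : A.charpoly.eval s ≠ 0) :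
    FiniteAt (sMinus A)⁻¹ s := fun i j => by
  change _ ∈ regularAt s
  rw [Matrix.inv_def, Matrix.smul_apply, smul_eq_mul, det_sMinus, Ring.inverse_eq_inv']
  refine Subring.mul_mem _ (inv_mem_regularAt hs) ?_
  rw [sMinus_eq_map, ← RingHom.mapMatrix_apply, ← RingHom.map_adjugate]
  exact algebraMap_mem_regularAt s _

lemma charpoly_eval_ne_zero_of_finiteAt {A : Matrix σ σ ℂ} {s : ℂ}
    (h : FiniteAt (sMinus A)⁻¹ s) : A.charpoly.eval s ≠ 0 := by
  have h1 := evalAt_mul (finiteAt_sMinus A s) h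
  have h2 : evalAt (1 : Matrix σ σ (RatFunc ℂ)) s = 1 := by
    simpa using evalAt_const (1 : Matrix σ σ ℂ) s
  rw [sMinus_mul_inv, h2, evalAt_sMinus] at h1
  rw [charpoly_eval]
  intro h3
  have := congrArg Matrix.det h1
  rw [Matrix.det_mul, h3, zero_mul, Matrix.det_one] at this
  exact one_ne_zero this

lemma isUnit_scalar_sub {A : Matrix σ σ ℂ} {s : ℂ} (hs : A.charpoly.eval s ≠ 0) :
    IsUnit (Matrix.scalar σ s - A).det := by
  rw [← charpoly_eval]; exact isUnit_iff_ne_zero.2 hs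

lemma evalAt_inv_sMinus {A : Matrix σ σ ℂ} {s : ℂ} (hs : A.charpoly.eval s ≠ 0) :
    evalAt (sMinus A)⁻¹ s = (Matrix.scalar σ s - A)⁻¹ := by
  have h1 := evalAt_mul (finiteAt_sMinus A s) (finiteAt_inv_sMinus hs)
  have h2 : evalAt (1 : Matrix σ σ (RatFunc ℂ)) s = 1 := by
    simpa using evalAt_const (1 : Matrix σ σ ℂ) s
  rw [sMinus_mul_inv, h2, evalAt_sMinus] at h1
  exact (Matrix.inv_eq_right_inv h1.symm).symm

variable {n : ℕ} {ι κ : Type*}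

lemma transfer_def (A : Matrix (Fin n) (Fin n) ℂ) (B : Matrix (Fin n) κ ℂ)
    (C : Matrix ι (Fin n) ℂ) (D : Matrix ι κ ℂ) :
    transfer A B C D
      = C.map RatFunc.C * (sMinus A)⁻¹ * B.map RatFunc.C + D.map RatFunc.C := rfl

/-- A solution `Y` of `(s I - A) Y = B` gives the transfer function without inverting `s I - A`. -/
lemma transfer_eq_of_mul_eq {A : Matrix (Fin n) (Fin n) ℂ} {B : Matrix (Fin n) κ ℂ}
    (C : Matrix ι (Fin n) ℂ) (D : Matrix ι κ ℂ) {Y : Matrix (Fin n) κ (RatFunc ℂ)}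
    (hY : sMinus A * Y = B.map RatFunc.C) :
    transfer A B C D = C.map RatFunc.C * Y + D.map RatFunc.C := by
  rw [transfer_def, ← hY, Matrix.mul_assoc, ← Matrix.mul_assoc _ _ Y, inv_mul_sMinus,
    Matrix.one_mul]

lemma finiteAt_transfer {A : Matrix (Fin n) (Fin n) ℂ} (B : Matrix (Fin n) κ ℂ)
    (C : Matrix ι (Fin n) ℂ) (D : Matrix ι κ ℂ) {s : ℂ} (hs : A.charpoly.eval s ≠ 0) :
    FiniteAt (transfer A B C D) s :=
  (((finiteAt_const C s).mul (finiteAt_inv_sMinus hs)).mul (finiteAt_const B s)).add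
    (finiteAt_const D s)

lemma evalAt_transfer {A : Matrix (Fin n) (Fin n) ℂ} (B : Matrix (Fin n) κ ℂ)
    (C : Matrix ι (Fin n) ℂ) (D : Matrix ι κ ℂ) {s : ℂ} (hs : A.charpoly.eval s ≠ 0) :
    evalAt (transfer A B C D) s = C * (Matrix.scalar (Fin n) s - A)⁻¹ * B + D := by
  have hR := finiteAt_inv_sMinus hs
  rw [transfer_def, evalAt_add (((finiteAt_const C s).mul hR).mul (finiteAt_const B s))
    (finiteAt_const D s), evalAt_mul ((finiteAt_const C s).mul hR) (finiteAt_const B s),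
    evalAt_mul (finiteAt_const C s) hR, evalAt_const, evalAt_const, evalAt_const,
    evalAt_inv_sMinus hs]

lemma transfer_transpose (A : Matrix (Fin n) (Fin n) ℂ) (B : Matrix (Fin n) κ ℂ)
    (C : Matrix ι (Fin n) ℂ) (D : Matrix ι κ ℂ) :
    (transfer A B C D)ᵀ = transfer Aᵀ Cᵀ Bᵀ Dᵀ := by
  have h : (sMinus A)ᵀ = sMinus Aᵀ := by
    ext i j
    by_cases h : i = j
    · subst h; simp [sMinus]
    · simp [sMinus, h, Ne.symm h]
  rw [transfer_def, transfer_def, ← h, Matrix.transpose_add, Matrix.transpose_mul,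
    Matrix.transpose_mul, Matrix.transpose_nonsing_inv, Matrix.transpose_map,
    Matrix.transpose_map, Matrix.transpose_map, Matrix.mul_assoc]

lemma map_C_mul {α β γ : Type*} [Fintype β] (M : Matrix α β ℂ) (N : Matrix β γ ℂ) :
    (M * N).map (RatFunc.C : ℂ →+* RatFunc ℂ) = M.map RatFunc.C * N.map RatFunc.C :=
  Matrix.map_mul

/-- Rectangular intertwining of state spaces: `A J = J A'` and `B = J B'` leave the transfer
function unchanged. -/
lemma transfer_eq_of_intertwine {m : ℕ} {A : Matrix (Fin n) (Fin n) ℂ} {B : Matrix (Fin n) κ ℂ}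
    (C : Matrix ι (Fin n) ℂ) (D : Matrix ι κ ℂ) {A' : Matrix (Fin m) (Fin m) ℂ}
    {B' : Matrix (Fin m) κ ℂ} {J : Matrix (Fin n) (Fin m) ℂ} (hA : A * J = J * A')
    (hB : B = J * B') : transfer A B C D = transfer A' B' (C * J) D := by
  have h : sMinus A * J.map RatFunc.C = J.map RatFunc.C * sMinus A' := by
    rw [sMinus, sMinus, Matrix.sub_mul, Matrix.mul_sub, ← map_C_mul, ← map_C_mul, hA]
    congr 1
    ext i j
    simp [mul_comm]
  rw [transfer_eq_of_mul_eq C D (Y := J.map RatFunc.C * ((sMinus A')⁻¹ * B'.map RatFunc.C)),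
    transfer_def, map_C_mul]
  · simp only [Matrix.mul_assoc]
  · rw [← Matrix.mul_assoc, h, Matrix.mul_assoc, ← Matrix.mul_assoc _ _ (B'.map _),
      sMinus_mul_inv, Matrix.one_mul, hB, map_C_mul]

lemma transfer_mul_const {κ' : Type*} [Fintype κ] (A : Matrix (Fin n) (Fin n) ℂ)
    (B : Matrix (Fin n) κ ℂ) (C : Matrix ι (Fin n) ℂ) (D : Matrix ι κ ℂ) (V : Matrix κ κ' ℂ) :
    transfer A B C D * V.map RatFunc.C = transfer A (B * V) C (D * V) := by
  simp only [transfer_def, map_C_mul, Matrix.add_mul, Matrix.mul_assoc]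

lemma const_mul_transfer {ι' : Type*} [Fintype ι] (A : Matrix (Fin n) (Fin n) ℂ)
    (B : Matrix (Fin n) κ ℂ) (C : Matrix ι (Fin n) ℂ) (D : Matrix ι κ ℂ) (V : Matrix ι' ι ℂ) :
    V.map RatFunc.C * transfer A B C D = transfer A B (V * C) (V * D) := by
  simp only [transfer_def, map_C_mul, Matrix.mul_add, Matrix.mul_assoc]

end Transfer

section AtInfinity

open Filter Bornology

variable {n : ℕ} {ι κ : Type*}

lemma eventually_charpoly_ne_zero (A : Matrix (Fin n) (Fin n) ℂ) :
    ∀ᶠ s in cobounded ℂ, A.charpoly.eval s ≠ 0 := by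
  have h : {s : ℂ | A.charpoly.eval s = 0}.Finite := by
    refine (A.charpoly.roots.toFinset.finite_toSet).subset fun s hs => ?_
    simpa [Polynomial.mem_roots (Matrix.charpoly_monic A).ne_zero] using hs
  have := h.isBounded
  rw [Bornology.isBounded_def] at this
  filter_upwards [this] with s hs using hs

lemma tendsto_inv_scalar_sub (A : Matrix (Fin n) (Fin n) ℂ) :
    Tendsto (fun s : ℂ => (Matrix.scalar (Fin n) s - A)⁻¹) (cobounded ℂ) (nhds 0) := by
  open scoped Matrix.Norms.L2Operator in
  have h := spectrum.resolvent_tendsto_cobounded (𝕜 := ℂ) A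
  refine h.congr fun s => ?_
  rw [resolvent, Matrix.nonsing_inv_eq_ringInverse]; rfl

lemma hasValueAtInfinity_transfer (A : Matrix (Fin n) (Fin n) ℂ) (B : Matrix (Fin n) κ ℂ)
    (C : Matrix ι (Fin n) ℂ) (D : Matrix ι κ ℂ) :
    HasValueAtInfinity (transfer A B C D) D := by
  intro i j
  have h1 : Tendsto (fun s : ℂ => (C * (Matrix.scalar (Fin n) s - A)⁻¹ * B + D) i j)
      (cobounded ℂ) (nhds ((C * (0 : Matrix (Fin n) (Fin n) ℂ) * B + D) i j)) := by
    have h0 := tendsto_inv_scalar_sub A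
    have hc : Continuous fun M : Matrix (Fin n) (Fin n) ℂ => (C * M * B + D) i j := by
      have : Continuous fun M : Matrix (Fin n) (Fin n) ℂ => C * M * B + D := by fun_prop
      exact this.matrix_elem i j
    exact (hc.tendsto 0).comp h0
  have h2 : (C * (0 : Matrix (Fin n) (Fin n) ℂ) * B + D) i j = D i j := by simp
  rw [h2] at h1
  refine h1.congr' ?_
  filter_upwards [eventually_charpoly_ne_zero A] with s hs
  rw [evalAt_transfer B C D hs]

lemma HasValueAtInfinity.unique {S : Matrix ι κ (RatFunc ℂ)} {D D' : Matrix ι κ ℂ}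
    (h : HasValueAtInfinity S D) (h' : HasValueAtInfinity S D') : D = D' := by
  ext i j
  exact tendsto_nhds_unique (h i j) (h' i j)

end AtInfinity

/-! ### Controllability, observability and the state space isomorphism -/

section Controllability

variable {n m : ℕ} {ι κ : Type*}

/-- Controllability of the pair `(A, B)`: the only `A`-invariant subspace containing the range of
`B` is the whole state space. -/
def Controllable [Fintype κ] (A : Matrix (Fin n) (Fin n) ℂ) (B : Matrix (Fin n) κ ℂ) : Prop :=
  ∀ V : Submodule ℂ (Fin n → ℂ), (∀ v ∈ V, A *ᵥ v ∈ V) → (∀ u, B *ᵥ u ∈ V) → V = ⊤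

/-- Observability of the pair `(C, A)`: controllability of the transposed pair. -/
def Observable [Fintype ι] (A : Matrix (Fin n) (Fin n) ℂ) (C : Matrix ι (Fin n) ℂ) : Prop :=
  Controllable Aᵀ Cᵀ

lemma Observable.eq_bot [Fintype ι] {A : Matrix (Fin n) (Fin n) ℂ} {C : Matrix ι (Fin n) ℂ}
    (h : Observable A C) {V : Submodule ℂ (Fin n → ℂ)} (hA : ∀ v ∈ V, A *ᵥ v ∈ V)
    (hC : ∀ v ∈ V, C *ᵥ v = 0) : V = ⊥ := by
  let W : Submodule ℂ (Fin n → ℂ) :=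
    { carrier := {w | ∀ v ∈ V, w ⬝ᵥ v = 0}
      add_mem' := fun {a b} ha hb v hv => by rw [add_dotProduct, ha v hv, hb v hv, add_zero]
      zero_mem' := fun v _ => zero_dotProduct v
      smul_mem' := fun c a ha v hv => by rw [smul_dotProduct, ha v hv, smul_zero] }
  have hW : W = ⊤ := by
    refine h W (fun w hw v hv => ?_) (fun u v hv => ?_)
    · rw [Matrix.mulVec_transpose, ← Matrix.dotProduct_mulVec]
      exact hw _ (hA v hv)
    · rw [Matrix.mulVec_transpose, ← Matrix.dotProduct_mulVec, hC v hv, dotProduct_zero]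
  refine (Submodule.eq_bot_iff _).2 fun v hv => ?_
  have h1 : star v ∈ W := hW ▸ Submodule.mem_top
  open scoped ComplexOrder in
  exact dotProduct_star_self_eq_zero.1 (h1 v hv)

/-- Two intertwiners out of a controllable system coincide. -/
lemma Controllable.intertwiner_unique [Fintype κ] {A : Matrix (Fin n) (Fin n) ℂ}
    {B : Matrix (Fin n) κ ℂ} (h : Controllable A B) {A' : Matrix (Fin m) (Fin m) ℂ}
    {X Y : Matrix (Fin m) (Fin n) ℂ} (hX : X * A = A' * X) (hY : Y * A = A' * Y)
    (hB : X * B = Y * B) : X = Y := by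
  have h1 : LinearMap.eqLocus (Matrix.toLin' X) (Matrix.toLin' Y) = ⊤ := by
    refine h _ (fun v hv => ?_) (fun u => ?_)
    · simp only [LinearMap.mem_eqLocus, Matrix.toLin'_apply] at hv ⊢
      rw [Matrix.mulVec_mulVec, Matrix.mulVec_mulVec, hX, hY, ← Matrix.mulVec_mulVec, hv,
        Matrix.mulVec_mulVec]
    · simp only [LinearMap.mem_eqLocus, Matrix.toLin'_apply]
      rw [Matrix.mulVec_mulVec, hB, Matrix.mulVec_mulVec]
  refine Matrix.ext_iff_mulVec.2 fun v => ?_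
  have h2 : v ∈ LinearMap.eqLocus (Matrix.toLin' X) (Matrix.toLin' Y) := h1 ▸ Submodule.mem_top
  simpa using h2

/-- State feedback and an invertible change of the input preserve controllability. -/
lemma Controllable.feedback [Fintype κ] [DecidableEq κ] {A : Matrix (Fin n) (Fin n) ℂ}
    {B : Matrix (Fin n) κ ℂ} (h : Controllable A B) (F : Matrix κ (Fin n) ℂ) {G G' : Matrix κ κ ℂ}
    (hG : G * G' = 1) : Controllable (A + B * F) (B * G) := by
  intro V hA hB
  have hB' : ∀ u, B *ᵥ u ∈ V := fun u => by
    have := hB (G' *ᵥ u)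
    rwa [Matrix.mulVec_mulVec, Matrix.mul_assoc, hG, Matrix.mul_one] at this
  refine h V (fun v hv => ?_) hB'
  have h1 := hA v hv
  rw [Matrix.add_mulVec, ← Matrix.mulVec_mulVec] at h1
  exact (Submodule.add_mem_iff_left _ (hB' _)).1 h1

lemma Controllable.neg_left [Fintype κ] {A : Matrix (Fin n) (Fin n) ℂ}
    {B : Matrix (Fin n) κ ℂ} (h : Controllable A B) : Controllable (-A) B := by
  intro V hA hB
  refine h V (fun v hv => ?_) hB
  have := V.neg_mem (hA v hv)
  rwa [Matrix.neg_mulVec, neg_neg] at this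

/-- Complex conjugation of both matrices preserves controllability. -/
lemma Controllable.conj [Fintype κ] {A : Matrix (Fin n) (Fin n) ℂ}
    {B : Matrix (Fin n) κ ℂ} (h : Controllable A B) : Controllable Aᴴᵀ Bᴴᵀ := by
  intro V hA hB
  let W : Submodule ℂ (Fin n → ℂ) :=
    { carrier := {w | star w ∈ V}
      add_mem' := fun {a b} ha hb => by
        rw [Set.mem_ofPred_eq, star_add]; exact V.add_mem ha hb
      zero_mem' := by rw [Set.mem_ofPred_eq, star_zero]; exact V.zero_mem
      smul_mem' := fun c a ha => by
        rw [Set.mem_ofPred_eq, star_smul]; exact V.smul_mem _ ha }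
  have hW : W = ⊤ := by
    refine h W (fun w hw => ?_) (fun u => ?_)
    · have := hA _ hw
      change star (A *ᵥ w) ∈ V
      rwa [Matrix.star_mulVec, ← Matrix.mulVec_transpose]
    · have := hB (star u)
      change star (B *ᵥ u) ∈ V
      rwa [Matrix.star_mulVec, ← Matrix.mulVec_transpose]
  refine (Submodule.eq_top_iff'.2 fun v => ?_)
  have h1 : star v ∈ W := hW ▸ Submodule.mem_top
  have h2 : star (star v) ∈ V := h1
  rwa [star_star] at h2

/-- Systems with the same Markov parameters, the first controllable and the second observable,
are related by an intertwining matrix. -/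
lemma exists_intertwiner [Fintype ι] [Fintype κ] {A : Matrix (Fin n) (Fin n) ℂ}
    {B : Matrix (Fin n) κ ℂ} {C : Matrix ι (Fin n) ℂ} {A' : Matrix (Fin m) (Fin m) ℂ}
    {B' : Matrix (Fin m) κ ℂ} {C' : Matrix ι (Fin m) ℂ} (hc : Controllable A B)
    (ho : Observable A' C') (hM : ∀ k : ℕ, C * A ^ k * B = C' * A' ^ k * B') :
    ∃ X : Matrix (Fin m) (Fin n) ℂ, X * A = A' * X ∧ X * B = B' ∧ C' * X = C := by
  let U : Submodule ℂ (Fin m → ℂ) := ⨅ k : ℕ, LinearMap.ker (Matrix.toLin' (C' * A' ^ k))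
  have hUmem : ∀ v, v ∈ U ↔ ∀ k : ℕ, (C' * A' ^ k) *ᵥ v = 0 := fun v => by
    simp only [U, Submodule.mem_iInf, LinearMap.mem_ker, Matrix.toLin'_apply]
  have hU : U = ⊥ := by
    refine ho.eq_bot (fun v hv => ?_) (fun v hv => ?_)
    · rw [hUmem] at hv ⊢
      intro k
      rw [Matrix.mulVec_mulVec, Matrix.mul_assoc, ← pow_succ]
      exact hv (k + 1)
    · simpa using (hUmem v).1 hv 0
  have huniq : ∀ v w : Fin m → ℂ, (∀ k : ℕ, (C' * A' ^ k) *ᵥ v = (C' * A' ^ k) *ᵥ w) → v = w := by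
    intro v w h
    have : v - w ∈ U := (hUmem _).2 fun k => by rw [Matrix.mulVec_sub, h k, sub_self]
    rw [hU, Submodule.mem_bot] at this
    exact sub_eq_zero.1 this
  let V : Submodule ℂ (Fin n → ℂ) :=
    { carrier := {v | ∃ w : Fin m → ℂ, ∀ k : ℕ, (C' * A' ^ k) *ᵥ w = (C * A ^ k) *ᵥ v}
      add_mem' := by
        rintro a b ⟨w, hw⟩ ⟨w', hw'⟩
        exact ⟨w + w', fun k => by rw [Matrix.mulVec_add, hw, hw', Matrix.mulVec_add]⟩
      zero_mem' := ⟨0, fun k => by simp⟩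
      smul_mem' := by
        rintro c a ⟨w, hw⟩
        exact ⟨c • w, fun k => by rw [Matrix.mulVec_smul, hw, Matrix.mulVec_smul]⟩ }
  have hstep : ∀ (v : Fin n → ℂ) (w : Fin m → ℂ),
      (∀ k : ℕ, (C' * A' ^ k) *ᵥ w = (C * A ^ k) *ᵥ v) →
        ∀ k : ℕ, (C' * A' ^ k) *ᵥ (A' *ᵥ w) = (C * A ^ k) *ᵥ (A *ᵥ v) := by
    intro v w h k
    rw [Matrix.mulVec_mulVec, Matrix.mulVec_mulVec, Matrix.mul_assoc, Matrix.mul_assoc,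
      ← pow_succ, ← pow_succ, h]
  have hV : V = ⊤ := by
    refine hc V ?_ ?_
    · rintro v ⟨w, hw⟩
      exact ⟨A' *ᵥ w, hstep v w hw⟩
    · intro u
      exact ⟨B' *ᵥ u, fun k => by
        rw [Matrix.mulVec_mulVec, Matrix.mulVec_mulVec, hM]⟩
  have hex : ∀ v, ∃ w : Fin m → ℂ, ∀ k : ℕ, (C' * A' ^ k) *ᵥ w = (C * A ^ k) *ᵥ v := fun v =>
    (hV ▸ Submodule.mem_top : v ∈ V)
  choose f hf using hex
  let F : (Fin n → ℂ) →ₗ[ℂ] (Fin m → ℂ) :=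
    { toFun := f
      map_add' := fun v w => huniq _ _ fun k => by
        rw [hf, Matrix.mulVec_add, Matrix.mulVec_add, hf, hf]
      map_smul' := fun c v => huniq _ _ fun k => by
        rw [hf, RingHom.id_apply, Matrix.mulVec_smul, Matrix.mulVec_smul, hf] }
  have hF : ∀ v, LinearMap.toMatrix' F *ᵥ v = f v := fun v => by
    rw [← Matrix.toLin'_apply, Matrix.toLin'_toMatrix']; rfl
  refine ⟨LinearMap.toMatrix' F, ?_, ?_, ?_⟩
  · refine Matrix.ext_iff_mulVec.2 fun v => ?_
    rw [← Matrix.mulVec_mulVec, ← Matrix.mulVec_mulVec, hF, hF]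
    exact huniq _ _ fun k => by rw [hf, hstep v _ (hf v)]
  · refine Matrix.ext_iff_mulVec.2 fun u => ?_
    rw [← Matrix.mulVec_mulVec, hF]
    exact huniq _ _ fun k => by rw [hf, Matrix.mulVec_mulVec, Matrix.mulVec_mulVec, hM]
  · refine Matrix.ext_iff_mulVec.2 fun v => ?_
    rw [← Matrix.mulVec_mulVec, hF]
    simpa using hf v 0

lemma sMinus_mul_X (A : Matrix (Fin n) (Fin n) ℂ) :
    (RatFunc.X : RatFunc ℂ) • (sMinus A)⁻¹ = 1 + A.map RatFunc.C * (sMinus A)⁻¹ := by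
  have h := sMinus_mul_inv A
  have h2 : sMinus A = (RatFunc.X : RatFunc ℂ) • 1 - A.map RatFunc.C := by
    rw [sMinus, Matrix.smul_one_eq_diagonal]; rfl
  nth_rewrite 1 [h2] at h
  rw [Matrix.sub_mul, Matrix.smul_mul, Matrix.one_mul] at h
  exact sub_eq_iff_eq_add.1 h

/-- Multiplication of a strictly proper transfer function by `s` shifts its Markov parameters
`C Aᵏ B`. -/
lemma transfer_shift (A : Matrix (Fin n) (Fin n) ℂ)
    (B : Matrix (Fin n) κ ℂ) (C : Matrix ι (Fin n) ℂ) :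
    (RatFunc.X : RatFunc ℂ) • transfer A B C 0 = transfer A B (C * A) (C * B) := by
  have h0 : (0 : Matrix ι κ ℂ).map (RatFunc.C : ℂ →+* RatFunc ℂ) = 0 := by
    ext i j; simp
  rw [transfer_def, transfer_def, h0, add_zero, ← Matrix.smul_mul, ← Matrix.mul_smul,
    sMinus_mul_X, Matrix.mul_add, Matrix.add_mul, Matrix.mul_one, map_C_mul, map_C_mul, add_comm]
  simp only [Matrix.mul_assoc]

/-- The Markov parameters are determined by the transfer function. -/
lemma markov_eq {A : Matrix (Fin n) (Fin n) ℂ}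
    {B : Matrix (Fin n) κ ℂ} {C : Matrix ι (Fin n) ℂ} {D : Matrix ι κ ℂ}
    {A' : Matrix (Fin m) (Fin m) ℂ}
    {B' : Matrix (Fin m) κ ℂ} {C' : Matrix ι (Fin m) ℂ} {D' : Matrix ι κ ℂ}
    (h : transfer A B C D = transfer A' B' C' D') :
    D = D' ∧ ∀ k : ℕ, C * A ^ k * B = C' * A' ^ k * B' := by
  have hval : ∀ {C₁ : Matrix ι (Fin n) ℂ} {C₁' : Matrix ι (Fin m) ℂ} {D₁ D₁' : Matrix ι κ ℂ},
      transfer A B C₁ D₁ = transfer A' B' C₁' D₁' →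
        D₁ = D₁' ∧ transfer A B C₁ 0 = transfer A' B' C₁' 0 := by
    intro C₁ C₁' D₁ D₁' h
    have hD : D₁ = D₁' := by
      have h1 := hasValueAtInfinity_transfer A B C₁ D₁
      rw [h] at h1
      exact h1.unique (hasValueAtInfinity_transfer A' B' C₁' D₁')
    refine ⟨hD, ?_⟩
    rw [transfer_def, transfer_def, hD] at h
    rw [transfer_def, transfer_def, add_right_cancel h]
  have hk : ∀ k : ℕ, transfer A B (C * A ^ k) 0 = transfer A' B' (C' * A' ^ k) 0 := by
    intro k
    induction k with
    | zero => simpa using (hval h).2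
    | succ k ih =>
      have h1 := congrArg (fun M => (RatFunc.X : RatFunc ℂ) • M) ih
      simp only [transfer_shift] at h1
      rw [pow_succ, pow_succ, ← Matrix.mul_assoc, ← Matrix.mul_assoc]
      exact (hval h1).2
  refine ⟨(hval h).1, fun k => ?_⟩
  have h1 := congrArg (fun M => (RatFunc.X : RatFunc ℂ) • M) (hk k)
  simp only [transfer_shift] at h1
  exact (hval h1).1

/-- State space isomorphism theorem. -/
lemma exists_isomorphism [Fintype ι] [Fintype κ] {A : Matrix (Fin n) (Fin n) ℂ}
    {B : Matrix (Fin n) κ ℂ} {C : Matrix ι (Fin n) ℂ} {D : Matrix ι κ ℂ}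
    {A' : Matrix (Fin n) (Fin n) ℂ} {B' : Matrix (Fin n) κ ℂ} {C' : Matrix ι (Fin n) ℂ}
    {D' : Matrix ι κ ℂ} (hc : Controllable A B) (ho : Observable A C) (hc' : Controllable A' B')
    (ho' : Observable A' C') (h : transfer A B C D = transfer A' B' C' D') :
    ∃ X Y : Matrix (Fin n) (Fin n) ℂ, X * Y = 1 ∧ Y * X = 1 ∧
      X * A = A' * X ∧ X * B = B' ∧ C' * X = C := by
  have hM := (markov_eq h).2
  obtain ⟨X, h1, h2, h3⟩ := exists_intertwiner hc ho' hM
  obtain ⟨Y, h4, h5, h6⟩ := exists_intertwiner hc' ho (fun k => (hM k).symm)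
  have hYX : Y * X = 1 := by
    refine hc.intertwiner_unique (A' := A) ?_ (by simp) ?_
    · rw [Matrix.mul_assoc, h1, ← Matrix.mul_assoc, h4, Matrix.mul_assoc]
    · rw [Matrix.mul_assoc, h2, h5, Matrix.one_mul]
  exact ⟨X, Y, mul_eq_one_comm.1 hYX, hYX, h1, h2, h3⟩

/-! ### Minimal realizations -/

/-- A minimal realization is controllable: otherwise the system restricts to a smaller invariant
subspace containing the range of `B`. -/
lemma IsMinimalRealization.controllable [Fintype κ] {S : Matrix ι κ (RatFunc ℂ)}
    {A : Matrix (Fin n) (Fin n) ℂ} {B : Matrix (Fin n) κ ℂ} {C : Matrix ι (Fin n) ℂ}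
    {D : Matrix ι κ ℂ} (h : IsMinimalRealization S A B C D) : Controllable A B := by
  classical
  intro V hA hB
  by_contra hne
  have hlt : Module.finrank ℂ V < n := by
    have := Submodule.finrank_lt hne
    simpa using this
  let b := Module.finBasis ℂ V
  let J : Matrix (Fin n) (Fin (Module.finrank ℂ V)) ℂ := Matrix.of fun i k => (b k : Fin n → ℂ) i
  have hJ : ∀ v : V, J *ᵥ (b.repr v) = v := by
    intro v
    have h1 := congrArg (V.subtype) (b.sum_repr v)
    rw [map_sum] at h1
    ext i
    have h2 := congrFun h1 i
    simp only [map_smul, Submodule.subtype_apply, Finset.sum_apply, Pi.smul_apply,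
      smul_eq_mul] at h2
    rw [← h2]
    simp only [J, Matrix.mulVec, dotProduct, Matrix.of_apply, mul_comm]
  let A' : Matrix (Fin (Module.finrank ℂ V)) (Fin (Module.finrank ℂ V)) ℂ :=
    Matrix.of fun k l => b.repr ⟨A *ᵥ (b l : Fin n → ℂ), hA _ (b l).2⟩ k
  let B' : Matrix (Fin (Module.finrank ℂ V)) κ ℂ :=
    Matrix.of fun k u => b.repr ⟨B *ᵥ (Pi.single u 1), hB _⟩ k
  have h1 : A * J = J * A' := by
    ext i l
    have := congrFun (hJ ⟨A *ᵥ (b l : Fin n → ℂ), hA _ (b l).2⟩) i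
    simp only [Matrix.mulVec, dotProduct] at this
    simp only [Matrix.mul_apply, A', Matrix.of_apply, this]
    rfl
  have h2 : B = J * B' := by
    ext i u
    have := congrFun (hJ ⟨B *ᵥ (Pi.single u 1), hB _⟩) i
    have h3 : (B *ᵥ (Pi.single u 1)) i = B i u := by rw [Matrix.mulVec_single_one]; rfl
    rw [← h3]
    exact this.symm
  have h3 : HasRealizationOfSize S (Module.finrank ℂ V) :=
    ⟨A', B', C * J, D, by rw [h.1, transfer_eq_of_intertwine C D h1 h2]⟩
  exact absurd (h.2.2 h3) (not_le.2 hlt)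

lemma HasRealizationOfSize.transpose {S : Matrix ι κ (RatFunc ℂ)}
    (h : HasRealizationOfSize S n) : HasRealizationOfSize Sᵀ n := by
  obtain ⟨A, B, C, D, rfl⟩ := h
  exact ⟨_, _, _, _, transfer_transpose A B C D⟩

lemma IsMinimalRealization.transpose {S : Matrix ι κ (RatFunc ℂ)}
    {A : Matrix (Fin n) (Fin n) ℂ} {B : Matrix (Fin n) κ ℂ} {C : Matrix ι (Fin n) ℂ}
    {D : Matrix ι κ ℂ} (h : IsMinimalRealization S A B C D) :
    IsMinimalRealization Sᵀ Aᵀ Cᵀ Bᵀ Dᵀ :=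
  ⟨by rw [h.1, transfer_transpose], ⟨h.2.1.transpose, fun _ hm => h.2.2 hm.transpose⟩⟩

lemma IsMinimalRealization.observable [Fintype ι] {S : Matrix ι κ (RatFunc ℂ)}
    {A : Matrix (Fin n) (Fin n) ℂ} {B : Matrix (Fin n) κ ℂ} {C : Matrix ι (Fin n) ℂ}
    {D : Matrix ι κ ℂ} (h : IsMinimalRealization S A B C D) : Observable A C :=
  h.transpose.controllable

/-- If the pair `(A, B)` is controllable, a pole of `K (s I - A)⁻¹` is a pole of
`K (s I - A)⁻¹ B`. -/
lemma Controllable.finiteAt_mul_inv [Fintype κ] {A : Matrix (Fin n) (Fin n) ℂ}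
    {B : Matrix (Fin n) κ ℂ} (h : Controllable A B) (K : Matrix ι (Fin n) ℂ) {s : ℂ}
    (hf : FiniteAt (K.map RatFunc.C * (sMinus A)⁻¹ * B.map RatFunc.C) s) :
    FiniteAt (K.map RatFunc.C * (sMinus A)⁻¹) s := by
  set G : Matrix ι (Fin n) (RatFunc ℂ) := K.map RatFunc.C * (sMinus A)⁻¹ with hG
  have hGA : G * A.map RatFunc.C = (RatFunc.X : RatFunc ℂ) • G - K.map RatFunc.C := by
    have h2 : A.map RatFunc.C = (RatFunc.X : RatFunc ℂ) • 1 - sMinus A := by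
      rw [sMinus, Matrix.smul_one_eq_diagonal]
      exact (sub_sub_cancel _ _).symm
    rw [h2, Matrix.mul_sub, Matrix.mul_smul, Matrix.mul_one, hG, Matrix.mul_assoc, inv_mul_sMinus,
      Matrix.mul_one]
  -- The vectors `v` for which `K (s I - A)⁻¹ v` has no pole at the point form an `A`-invariant
  -- subspace that contains the range of `B`.
  let V : Submodule ℂ (Fin n → ℂ) :=
    { carrier := {v | ∀ i, (G *ᵥ fun j => RatFunc.C (v j)) i ∈ regularAt s}
      add_mem' := fun {a b} ha hb i => by
        have : (fun j => RatFunc.C ((a + b) j)) = (fun j => RatFunc.C (a j))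
            + fun j => (RatFunc.C (b j) : RatFunc ℂ) := by ext j; simp
        rw [this, Matrix.mulVec_add]
        exact (regularAt s).add_mem (ha i) (hb i)
      zero_mem' := fun i => by
        have : (fun j => RatFunc.C ((0 : Fin n → ℂ) j)) = (0 : Fin n → RatFunc ℂ) := by ext j; simp
        rw [this, Matrix.mulVec_zero]
        exact (regularAt s).zero_mem
      smul_mem' := fun c a ha i => by
        have : (fun j => RatFunc.C ((c • a) j))
            = (RatFunc.C c : RatFunc ℂ) • fun j => (RatFunc.C (a j) : RatFunc ℂ) := by ext j; simp
        rw [this, Matrix.mulVec_smul]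
        exact (regularAt s).mul_mem (C_mem_regularAt s c) (ha i) }
  have hV : V = ⊤ := by
    refine h V (fun v hv i => ?_) (fun u i => ?_)
    · have hh : (fun j => (RatFunc.C ((A *ᵥ v) j) : RatFunc ℂ))
          = A.map RatFunc.C *ᵥ fun j => RatFunc.C (v j) := by
        ext j
        simp [Matrix.mulVec, dotProduct, map_sum]
      rw [hh, Matrix.mulVec_mulVec, hGA, Matrix.sub_mulVec, Matrix.smul_mulVec]
      refine (regularAt s).sub_mem ((regularAt s).mul_mem (X_mem_regularAt s) (hv i)) ?_
      have hK : ∀ j ∈ Finset.univ, (K.map RatFunc.C i j * RatFunc.C (v j) : RatFunc ℂ)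
          ∈ regularAt s := fun j _ =>
        (regularAt s).mul_mem (C_mem_regularAt s (K i j)) (C_mem_regularAt s (v j))
      exact Subring.sum_mem (regularAt s) hK
    · have hh : (fun j => (RatFunc.C ((B *ᵥ u) j) : RatFunc ℂ))
          = B.map RatFunc.C *ᵥ fun j => RatFunc.C (u j) := by
        ext j
        simp [Matrix.mulVec, dotProduct, map_sum]
      rw [hh, Matrix.mulVec_mulVec]
      exact Subring.sum_mem (regularAt s) fun j _ =>
        (regularAt s).mul_mem (hf i j) (C_mem_regularAt s (u j))
  intro i j
  have h1 : Pi.single j 1 ∈ V := hV ▸ Submodule.mem_top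
  have h2 := h1 i
  have h3 : (fun k => RatFunc.C ((Pi.single j 1 : Fin n → ℂ) k))
      = (Pi.single j 1 : Fin n → RatFunc ℂ) := by
    ext k
    by_cases hk : k = j
    · subst hk; simp
    · simp [hk]
  rw [h3, Matrix.mulVec_single_one] at h2
  exact h2

lemma transpose_inv_sMinus (A : Matrix (Fin n) (Fin n) ℂ) :
    ((sMinus A)⁻¹)ᵀ = (sMinus Aᵀ)⁻¹ := by
  have h : (sMinus A)ᵀ = sMinus Aᵀ := by
    ext i j
    by_cases h : i = j
    · subst h; simp [sMinus]
    · simp [sMinus, h, Ne.symm h]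
  rw [Matrix.transpose_nonsing_inv, h]

/-- The eigenvalues of a controllable and observable system are poles of its transfer function. -/
lemma charpoly_eval_ne_zero_of_finiteAt_transfer [Fintype ι] [Fintype κ]
    {A : Matrix (Fin n) (Fin n) ℂ} {B : Matrix (Fin n) κ ℂ} {C : Matrix ι (Fin n) ℂ}
    {D : Matrix ι κ ℂ} (hc : Controllable A B) (ho : Observable A C) {s : ℂ}
    (hf : FiniteAt (transfer A B C D) s) : A.charpoly.eval s ≠ 0 := by
  have h1 : FiniteAt (C.map RatFunc.C * (sMinus A)⁻¹ * B.map RatFunc.C) s := by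
    have h := hf.add (finiteAt_const (-D) s)
    have h2 : transfer A B C D + (-D).map RatFunc.C
        = C.map RatFunc.C * (sMinus A)⁻¹ * B.map RatFunc.C := by
      rw [transfer_def, add_assoc]
      have : D.map (RatFunc.C : ℂ →+* RatFunc ℂ) + (-D).map RatFunc.C = 0 := by ext i j; simp
      rw [this, add_zero]
    rwa [h2] at h
  have h2 := hc.finiteAt_mul_inv C h1
  have h3 : FiniteAt ((1 : Matrix (Fin n) (Fin n) ℂ).map RatFunc.C * (sMinus Aᵀ)⁻¹
      * Cᵀ.map RatFunc.C) s := by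
    have h4 : (1 : Matrix (Fin n) (Fin n) ℂ).map RatFunc.C * (sMinus Aᵀ)⁻¹ * Cᵀ.map RatFunc.C
        = (C.map RatFunc.C * (sMinus A)⁻¹)ᵀ := by
      rw [Matrix.transpose_mul, transpose_inv_sMinus, Matrix.transpose_map,
        Matrix.map_one _ (map_zero _) (map_one _), Matrix.one_mul]
    rw [h4]
    exact fun i j => h2 j i
  have h4 := Controllable.finiteAt_mul_inv ho 1 h3
  rw [Matrix.map_one _ (map_zero _) (map_one _), Matrix.one_mul] at h4
  have h5 := charpoly_eval_ne_zero_of_finiteAt h4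
  rwa [Matrix.charpoly_transpose] at h5

end Controllability

/-! ### Existence of realizations -/

section Realizable

variable {ι κ μ : Type*}

/-- `S` has a realization of some size. -/
def Realizable (S : Matrix ι κ (RatFunc ℂ)) : Prop := ∃ n, HasRealizationOfSize S n

/-- A realization may have any finite type as index set of its state space; the resolvent enters only
through a solution `Y` of `(s - A) Y = B`. -/
lemma realizable_of_mul_eq {σ : Type*} [Fintype σ] [DecidableEq σ] {A : Matrix σ σ ℂ}
    {B : Matrix σ κ ℂ} (C : Matrix ι σ ℂ) (D : Matrix ι κ ℂ) {Y : Matrix σ κ (RatFunc ℂ)}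
    (hY : sMinus A * Y = B.map RatFunc.C) : Realizable (C.map RatFunc.C * Y + D.map RatFunc.C) := by
  let e := (Fintype.equivFin σ).symm
  refine ⟨Fintype.card σ, A.submatrix e e, B.submatrix e id, C.submatrix id e, D, ?_⟩
  have h1 : sMinus (A.submatrix e e) = (sMinus A).submatrix e e := by
    ext i j
    by_cases h : i = j
    · subst h; simp [sMinus]
    · simp [sMinus, h]
  rw [transfer_eq_of_mul_eq _ _ (Y := Y.submatrix e id)]
  · congr 1
    rw [← Matrix.submatrix_map, Matrix.submatrix_mul_equiv, Matrix.submatrix_id_id]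
  · rw [h1, Matrix.submatrix_mul_equiv, hY]; rfl

lemma realizable_const (D : Matrix ι κ ℂ) : Realizable (D.map RatFunc.C) := by
  have h := realizable_of_mul_eq (σ := Fin 0) (A := 0) (B := (0 : Matrix (Fin 0) κ ℂ))
    (0 : Matrix ι (Fin 0) ℂ) D (Y := 0) (by ext i j; exact i.elim0)
  simpa using h

lemma exists_mul_eq {n : ℕ} (A : Matrix (Fin n) (Fin n) ℂ) (B : Matrix (Fin n) κ ℂ)
    (C : Matrix ι (Fin n) ℂ) (D : Matrix ι κ ℂ) :
    ∃ Y : Matrix (Fin n) κ (RatFunc ℂ), sMinus A * Y = B.map RatFunc.C ∧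
      transfer A B C D = C.map RatFunc.C * Y + D.map RatFunc.C := by
  refine ⟨(sMinus A)⁻¹ * B.map RatFunc.C, ?_, ?_⟩
  · rw [← Matrix.mul_assoc, sMinus_mul_inv, Matrix.one_mul]
  · rw [transfer_def, Matrix.mul_assoc]

lemma sMinus_fromBlocks {σ τ : Type*} [Fintype σ] [DecidableEq σ] [Fintype τ] [DecidableEq τ]
    (A : Matrix σ σ ℂ) (N : Matrix σ τ ℂ) (A' : Matrix τ τ ℂ) :
    sMinus (Matrix.fromBlocks A N 0 A')
      = Matrix.fromBlocks (sMinus A) (-N.map RatFunc.C) 0 (sMinus A') := by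
  ext i j
  rcases i with i | i <;> rcases j with j | j
  · by_cases h : i = j
    · subst h; simp [sMinus]
    · simp [sMinus, h]
  · simp [sMinus]
  · simp [sMinus]
  · by_cases h : i = j
    · subst h; simp [sMinus]
    · simp [sMinus, h]

lemma Realizable.add {S T : Matrix ι κ (RatFunc ℂ)} (hS : Realizable S) (hT : Realizable T) :
    Realizable (S + T) := by
  obtain ⟨n, A, B, C, D, rfl⟩ := hS
  obtain ⟨m, A', B', C', D', rfl⟩ := hT
  obtain ⟨Y, hY, h1⟩ := exists_mul_eq A B C D
  obtain ⟨Y', hY', h2⟩ := exists_mul_eq A' B' C' D'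
  have h := realizable_of_mul_eq (A := Matrix.fromBlocks A 0 0 A') (B := Matrix.fromRows B B')
    (Matrix.fromCols C C') (D + D') (Y := Matrix.fromRows Y Y') (by
      have h0 : (0 : Matrix (Fin n) (Fin m) ℂ).map (RatFunc.C : ℂ →+* RatFunc ℂ) = 0 := by
        ext i j; simp
      rw [sMinus_fromBlocks, Matrix.fromBlocks_mul_fromRows, hY, hY', h0]
      ext i j
      rcases i with i | i <;> simp)
  convert h using 1
  rw [h1, h2]
  have h3 : (Matrix.fromCols C C').map (RatFunc.C : ℂ →+* RatFunc ℂ)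
      = Matrix.fromCols (C.map RatFunc.C) (C'.map RatFunc.C) := by
    ext i j; rcases j with j | j <;> simp
  have h4 : (D + D').map (RatFunc.C : ℂ →+* RatFunc ℂ) = D.map RatFunc.C + D'.map RatFunc.C := by
    ext i j; simp
  rw [h3, h4, Matrix.fromCols_mul_fromRows]
  abel

lemma Realizable.mul [Fintype κ] {S : Matrix ι κ (RatFunc ℂ)} {T : Matrix κ μ (RatFunc ℂ)}
    (hS : Realizable S) (hT : Realizable T) : Realizable (S * T) := by
  obtain ⟨n, A, B, C, D, rfl⟩ := hS
  obtain ⟨m, A', B', C', D', rfl⟩ := hT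
  obtain ⟨Y, hY, h1⟩ := exists_mul_eq A B C D
  obtain ⟨Y', hY', h2⟩ := exists_mul_eq A' B' C' D'
  have h := realizable_of_mul_eq (A := Matrix.fromBlocks A (B * C') 0 A')
    (B := Matrix.fromRows (B * D') B') (Matrix.fromCols C (D * C')) (D * D')
    (Y := Matrix.fromRows (Y * transfer A' B' C' D') Y') (by
      rw [sMinus_fromBlocks, Matrix.fromBlocks_mul_fromRows, hY', ← Matrix.mul_assoc, hY, h2,
        map_C_mul, Matrix.mul_add, Matrix.neg_mul, Matrix.zero_mul, zero_add, ← Matrix.mul_assoc,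
        add_neg_cancel_comm, ← map_C_mul]
      ext i j
      rcases i with i | i <;> rfl)
  convert h using 1
  have h3 : (Matrix.fromCols C (D * C')).map (RatFunc.C : ℂ →+* RatFunc ℂ)
      = Matrix.fromCols (C.map RatFunc.C) ((D * C').map RatFunc.C) := by
    ext i j; rcases j with j | j <;> rfl
  rw [h3, Matrix.fromCols_mul_fromRows, map_C_mul, map_C_mul, h1, Matrix.add_mul,
    Matrix.mul_assoc, add_assoc, Matrix.mul_assoc, ← Matrix.mul_add, ← h2]

/-- A rational function as a one by one matrix. -/
noncomputable def scalarMatrix (f : RatFunc ℂ) : Matrix Unit Unit (RatFunc ℂ) :=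
  Matrix.of fun _ _ => f

lemma realizable_inv_X_sub_C (a : ℂ) :
    Realizable (scalarMatrix (RatFunc.X - RatFunc.C a)⁻¹) := by
  have hne : (RatFunc.X - RatFunc.C a : RatFunc ℂ) ≠ 0 := by
    have h := Polynomial.X_sub_C_ne_zero a
    have h2 : (RatFunc.X - RatFunc.C a : RatFunc ℂ)
        = algebraMap (Polynomial ℂ) (RatFunc ℂ) (Polynomial.X - Polynomial.C a) := by simp
    rw [h2]
    exact (map_ne_zero_iff _ (RatFunc.algebraMap_injective ℂ)).2 h
  have h := realizable_of_mul_eq (σ := Unit) (A := Matrix.of fun _ _ => a)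
    (B := (1 : Matrix Unit Unit ℂ)) (1 : Matrix Unit Unit ℂ) 0
    (Y := scalarMatrix (RatFunc.X - RatFunc.C a)⁻¹) (by
      ext i j
      simp [sMinus, scalarMatrix, Matrix.mul_apply, hne])
  convert h using 1
  ext i j
  simp

lemma scalarMatrix_add (f g : RatFunc ℂ) :
    scalarMatrix (f + g) = scalarMatrix f + scalarMatrix g := rfl

lemma scalarMatrix_mul (f g : RatFunc ℂ) :
    scalarMatrix (f * g) = scalarMatrix f * scalarMatrix g := by
  ext i j; simp [scalarMatrix, Matrix.mul_apply]

/-- Every rational function is the sum of a polynomial and of a realizable function. -/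
lemma exists_polynomial_add_realizable (f : RatFunc ℂ) :
    ∃ (q : Polynomial ℂ) (g : RatFunc ℂ), Realizable (scalarMatrix g) ∧
      f = algebraMap (Polynomial ℂ) (RatFunc ℂ) q + g := by
  have key : ∀ (m : Multiset ℂ) (r : Polynomial ℂ),
      ∃ (q : Polynomial ℂ) (g : RatFunc ℂ), Realizable (scalarMatrix g) ∧
        algebraMap (Polynomial ℂ) (RatFunc ℂ) r / algebraMap (Polynomial ℂ) (RatFunc ℂ)
          (m.map fun a => Polynomial.X - Polynomial.C a).prod
          = algebraMap (Polynomial ℂ) (RatFunc ℂ) q + g := by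
    intro m
    induction m using Multiset.induction_on with
    | empty =>
      intro r
      refine ⟨r, 0, ?_, by simp⟩
      have := realizable_const (0 : Matrix Unit Unit ℂ)
      convert this using 1
      ext i j
      simp [scalarMatrix]
    | cons a m ih =>
      intro r
      obtain ⟨q, g, hg, h⟩ := ih r
      have hne : (RatFunc.X - RatFunc.C a : RatFunc ℂ) ≠ 0 := by
        have h := Polynomial.X_sub_C_ne_zero a
        have h2 : (RatFunc.X - RatFunc.C a : RatFunc ℂ)
            = algebraMap (Polynomial ℂ) (RatFunc ℂ) (Polynomial.X - Polynomial.C a) := by simp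
        rw [h2]
        exact (map_ne_zero_iff _ (RatFunc.algebraMap_injective ℂ)).2 h
      refine ⟨q /ₘ (Polynomial.X - Polynomial.C a),
        (RatFunc.C (q.eval a) + g) * (RatFunc.X - RatFunc.C a)⁻¹, ?_, ?_⟩
      · rw [scalarMatrix_mul, scalarMatrix_add]
        refine Realizable.mul (Realizable.add ?_ hg) (realizable_inv_X_sub_C a)
        have := realizable_const (Matrix.of fun _ _ => q.eval a : Matrix Unit Unit ℂ)
        exact this
      · have hq : algebraMap (Polynomial ℂ) (RatFunc ℂ) q
            = RatFunc.C (q.eval a) + (RatFunc.X - RatFunc.C a)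
              * algebraMap (Polynomial ℂ) (RatFunc ℂ) (q /ₘ (Polynomial.X - Polynomial.C a)) := by
          conv_lhs => rw [← Polynomial.modByMonic_add_div q (Polynomial.X - Polynomial.C a),
            Polynomial.modByMonic_X_sub_C_eq_C_eval]
          simp
        rw [Multiset.map_cons, Multiset.prod_cons, map_mul, mul_comm, ← div_div, h, hq, map_sub,
          RatFunc.algebraMap_X, RatFunc.algebraMap_C]
        field_simp
        ring
  obtain ⟨q, g, hg, h⟩ := key f.denom.roots f.num
  refine ⟨q, g, hg, ?_⟩
  rw [← h, ← (IsAlgClosed.splits f.denom).eq_prod_roots_of_monic (RatFunc.monic_denom f),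
    RatFunc.num_div_denom]

open Filter Bornology in
/-- A rational function with a finite limit at infinity is realizable: its polynomial part is
bounded, hence constant. -/
lemma realizable_of_tendsto {f : RatFunc ℂ} {d : ℂ}
    (h : Tendsto (fun s => f.eval (RingHom.id ℂ) s) (cobounded ℂ) (nhds d)) :
    Realizable (scalarMatrix f) := by
  obtain ⟨q, g, hg, rfl⟩ := exists_polynomial_add_realizable f
  obtain ⟨n, A, B, C, D, hgt⟩ := hg
  have h1 := hasValueAtInfinity_transfer A B C D () ()
  rw [← hgt] at h1
  have h2 : Tendsto (fun s => q.eval s) (cobounded ℂ) (nhds (d - D () ())) := by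
    refine (h.sub h1).congr' ?_
    filter_upwards [eventually_charpoly_ne_zero A] with s hs
    have h3 : FiniteAt (scalarMatrix g) s := by
      rw [hgt]; exact finiteAt_transfer B C D hs
    have h4 : evalAt (scalarMatrix g) s () () = g.eval (RingHom.id ℂ) s := rfl
    have h5 : g ∈ regularAt s := h3 () ()
    rw [h4, eval_add_of_regular (algebraMap_mem_regularAt s q) h5,
      eval_algebraMap_polynomial, add_sub_cancel_right]
  have h3 : q.degree ≤ 0 := by
    by_contra hq
    have h4 := q.tendsto_norm_atTop (not_le.1 hq) tendsto_norm_cobounded_atTop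
    exact not_tendsto_atTop_of_tendsto_nhds h2.norm h4
  rw [Polynomial.eq_C_of_degree_le_zero h3, scalarMatrix_add]
  refine Realizable.add ?_ ⟨n, A, B, C, D, hgt⟩
  have := realizable_const (Matrix.of fun _ _ => q.coeff 0 : Matrix Unit Unit ℂ)
  convert this using 1
  ext i j
  simp [scalarMatrix]

lemma Realizable.sum {α : Type*} (s : Finset α) {S : α → Matrix ι κ (RatFunc ℂ)}
    (h : ∀ a ∈ s, Realizable (S a)) : Realizable (∑ a ∈ s, S a) := by
  classical
  induction s using Finset.induction_on with
  | empty =>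
    have := realizable_const (0 : Matrix ι κ ℂ)
    convert this using 1
    ext i j
    simp
  | insert a s ha ih =>
    rw [Finset.sum_insert ha]
    exact (h a (Finset.mem_insert_self a s)).add
      (ih fun b hb => h b (Finset.mem_insert_of_mem hb))

/-- A proper rational matrix has a realization. -/
lemma HasValueAtInfinity.realizable [Fintype ι] [Fintype κ] {S : Matrix ι κ (RatFunc ℂ)}
    {D : Matrix ι κ ℂ} (h : HasValueAtInfinity S D) : Realizable S := by
  classical
  have h1 : S = ∑ i, ∑ j, Matrix.single i j (S i j) := Matrix.matrix_eq_sum_single S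
  rw [h1]
  refine Realizable.sum _ fun i _ => Realizable.sum _ fun j _ => ?_
  have h2 : Matrix.single i j (S i j)
      = (Matrix.of fun k (_ : Unit) => if k = i then (1 : ℂ) else 0).map RatFunc.C
        * scalarMatrix (S i j)
        * (Matrix.of fun (_ : Unit) k => if k = j then (1 : ℂ) else 0).map RatFunc.C := by
    ext k l
    rcases eq_or_ne i k with rfl | hk
    · rcases eq_or_ne j l with rfl | hl
      · simp [scalarMatrix, Matrix.mul_apply]
      · simp [scalarMatrix, Matrix.mul_apply, hl, hl.symm]
    · simp [scalarMatrix, Matrix.mul_apply, hk, hk.symm]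
  rw [h2]
  exact ((realizable_const _).mul (realizable_of_tendsto (h i j))).mul (realizable_const _)

lemma Realizable.exists_minimal {S : Matrix ι κ (RatFunc ℂ)} (h : Realizable S) :
    ∃ n, ∃ (A : Matrix (Fin n) (Fin n) ℂ) (B : Matrix (Fin n) κ ℂ) (C : Matrix ι (Fin n) ℂ)
      (D : Matrix ι κ ℂ), IsMinimalRealization S A B C D := by
  classical
  have h1 : HasMcMillanDegree S (Nat.find h) :=
    ⟨Nat.find_spec h, fun m hm => Nat.find_min' h hm⟩
  obtain ⟨A, B, C, D, hS⟩ := h1.1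
  exact ⟨Nat.find h, A, B, C, D, hS, h1⟩

end Realizable

/-! ### Symmetric realizations -/

section Symmetric

variable {n : ℕ}

/-- Polarization: a complex symmetric matrix is determined by its quadratic form `vᵀ M v`. -/
lemma eq_of_quadratic_eq {M N : Matrix (Fin n) (Fin n) ℂ} (hM : Mᵀ = M) (hN : Nᵀ = N)
    (h : ∀ v, v ⬝ᵥ M *ᵥ v = v ⬝ᵥ N *ᵥ v) : M = N := by
  have hpol : ∀ L : Matrix (Fin n) (Fin n) ℂ, Lᵀ = L → ∀ u v, 2 * (u ⬝ᵥ L *ᵥ v)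
      = (u + v) ⬝ᵥ L *ᵥ (u + v) - u ⬝ᵥ L *ᵥ u - v ⬝ᵥ L *ᵥ v := by
    intro L hL u v
    have h1 : v ⬝ᵥ L *ᵥ u = u ⬝ᵥ L *ᵥ v := by
      rw [Matrix.dotProduct_mulVec, ← Matrix.mulVec_transpose, hL, dotProduct_comm]
    rw [Matrix.mulVec_add, add_dotProduct, dotProduct_add, dotProduct_add, h1]
    ring
  refine Matrix.ext_iff_mulVec.2 fun v => ?_
  refine dotProduct_eq _ _ fun u => ?_
  have h2 : 2 * (u ⬝ᵥ M *ᵥ v) = 2 * (u ⬝ᵥ N *ᵥ v) := by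
    rw [hpol M hM, hpol N hN, h, h, h]
  rw [dotProduct_comm, dotProduct_comm _ u]
  exact mul_left_cancel₀ two_ne_zero h2

/-- Over the complex numbers, an invertible symmetric matrix is of the form `Rᵀ R`. -/
lemma exists_transpose_mul_self {X : Matrix (Fin n) (Fin n) ℂ} (hX : Xᵀ = X)
    (hdet : IsUnit X.det) : ∃ R : Matrix (Fin n) (Fin n) ℂ, Rᵀ * R = X := by
  have hsep : ∀ M : Matrix (Fin n) (Fin n) ℂ, Mᵀ = M → IsUnit M.det →
      (QuadraticMap.associated (R := ℂ) (Matrix.toQuadraticForm' M)).SeparatingLeft := by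
    intro M hM hd
    have h1 : QuadraticMap.associated (R := ℂ) (Matrix.toQuadraticForm' M)
        = Matrix.toLinearMap₂' ℂ M := by
      refine QuadraticMap.associated_left_inverse (S := ℂ) ?_
      intro x y
      simp only [Matrix.toLinearMap₂'_apply']
      rw [Matrix.dotProduct_mulVec, ← Matrix.mulVec_transpose, hM, dotProduct_comm]
    rw [h1]
    exact LinearMap.separatingLeft_toLinearMap₂'_of_det_ne_zero' (isUnit_iff_ne_zero.1 hd)
  obtain ⟨e⟩ := QuadraticForm.equivalent_of_isAlgClosed (Matrix.toQuadraticForm' X)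
    (Matrix.toQuadraticForm' (1 : Matrix (Fin n) (Fin n) ℂ)) (hsep X hX hdet)
    (hsep 1 (by simp) (by simp))
  refine ⟨LinearMap.toMatrix' e.toLinearEquiv.toLinearMap, ?_⟩
  refine eq_of_quadratic_eq (by simp) hX fun v => ?_
  have h1 := e.map_app v
  simp only [Matrix.toQuadraticForm', LinearMap.BilinMap.toQuadraticMap_apply,
    Matrix.toLinearMap₂'_apply', Matrix.one_mulVec] at h1
  have h2 : LinearMap.toMatrix' e.toLinearEquiv.toLinearMap *ᵥ v = e v := by
    rw [← Matrix.toLin'_apply, Matrix.toLin'_toMatrix']; rfl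
  rw [← h1, ← Matrix.mulVec_mulVec, h2, Matrix.dotProduct_mulVec, Matrix.vecMul_transpose, h2]
  rfl

/-- A proper symmetric rational matrix has a minimal symmetric realization. -/
lemma exists_minimal_symmetric_realization {ι : Type*} [Fintype ι] {S : Matrix ι ι (RatFunc ℂ)}
    (hS : Sᵀ = S) (hr : Realizable S) :
    ∃ (n : ℕ) (A : Matrix (Fin n) (Fin n) ℂ) (B : Matrix (Fin n) ι ℂ) (C : Matrix ι (Fin n) ℂ)
      (D : Matrix ι ι ℂ), IsMinimalSymmetricRealization S A B C D := by
  obtain ⟨n, A, B, C, D, h⟩ := hr.exists_minimal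
  have ht := h.transpose
  rw [hS] at ht
  have heq : transfer A B C D = transfer Aᵀ Cᵀ Bᵀ Dᵀ := by rw [← h.1, ← ht.1]
  obtain ⟨X, Y, hXY, hYX, h1, h2, h3⟩ := exists_isomorphism h.controllable h.observable
    ht.controllable ht.observable heq
  have hD : D = Dᵀ := (markov_eq heq).1
  have hsym : Xᵀ = X := by
    refine h.controllable.intertwiner_unique (A' := Aᵀ) ?_ h1 ?_
    · have := congrArg Matrix.transpose h1
      rw [Matrix.transpose_mul, Matrix.transpose_mul, Matrix.transpose_transpose] at this
      exact this.symm
    · have := congrArg Matrix.transpose h3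
      rw [Matrix.transpose_mul, Matrix.transpose_transpose] at this
      rw [this, h2]
  obtain ⟨R, hR⟩ := exists_transpose_mul_self hsym
    ((Matrix.isUnit_iff_isUnit_det _).1 ⟨⟨X, Y, hXY, hYX⟩, rfl⟩)
  have hQR : Y * Rᵀ * R = 1 := by rw [Matrix.mul_assoc, hR, hYX]
  have hRQ : R * (Y * Rᵀ) = 1 := mul_eq_one_comm.1 hQR
  have hY : Yᵀ = Y := by
    have h4 : Yᵀ * X = 1 := by rw [← hsym, ← Matrix.transpose_mul, hXY, Matrix.transpose_one]
    calc Yᵀ = Yᵀ * (X * Y) := by rw [hXY, Matrix.mul_one]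
      _ = Y := by rw [← Matrix.mul_assoc, h4, Matrix.one_mul]
  have h1' : A * Y = Y * Aᵀ := by
    calc A * Y = Y * (X * A) * Y := by rw [← Matrix.mul_assoc, hYX, Matrix.one_mul]
      _ = Y * Aᵀ := by rw [h1, Matrix.mul_assoc, Matrix.mul_assoc, hXY, Matrix.mul_one]
  refine ⟨n, R * A * (Y * Rᵀ), R * B, C * (Y * Rᵀ), D, ⟨?_, h.2⟩, ?_, ?_, hD⟩
  · rw [h.1]
    refine transfer_eq_of_intertwine C D ?_ ?_
    · simp only [← Matrix.mul_assoc, hQR, Matrix.one_mul]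
    · rw [← Matrix.mul_assoc, hQR, Matrix.one_mul]
  · rw [Matrix.transpose_mul, Matrix.transpose_mul, Matrix.transpose_mul,
      Matrix.transpose_transpose, hY, Matrix.mul_assoc, ← Matrix.mul_assoc A, h1']
    simp only [Matrix.mul_assoc]
  · have h4 : C = Bᵀ * X := h3.symm
    rw [Matrix.transpose_mul, h4, Matrix.mul_assoc, ← Matrix.mul_assoc X, hXY, Matrix.one_mul]

end Symmetric

/-! ### Self-adjoint operators for a complex symmetric bilinear form -/

section SelfAdjoint

open Module

variable {M : Type*} [AddCommGroup M] [Module ℂ M]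

/-- Generalized eigenspaces of a self-adjoint operator for distinct eigenvalues are orthogonal. -/
lemma maxGenEigenspace_orthogonal {B : LinearMap.BilinForm ℂ M} {f : End ℂ M}
    (hf : ∀ v w, B (f v) w = B v (f w)) {a b : ℂ} (hab : a ≠ b) {x y : M}
    (hx : x ∈ f.maxGenEigenspace a) (hy : y ∈ f.maxGenEigenspace b) : B x y = 0 := by
  rw [End.mem_maxGenEigenspace] at hx hy
  obtain ⟨j, hj⟩ := hx
  obtain ⟨k, hk⟩ := hy
  have key : ∀ (N j k : ℕ), j + k = N → ∀ x y : M, ((f - a • (1 : End ℂ M)) ^ j) x = 0 →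
      ((f - b • (1 : End ℂ M)) ^ k) y = 0 → B x y = 0 := by
    intro N
    induction N with
    | zero =>
      intro j k hjk x y hx _
      obtain rfl : j = 0 := by omega
      have : x = 0 := by simpa using hx
      rw [this, map_zero, LinearMap.zero_apply]
    | succ N ih =>
      intro j k hjk x y hx hy
      rcases j with _ | j
      · have : x = 0 := by simpa using hx
        rw [this, map_zero, LinearMap.zero_apply]
      rcases k with _ | k
      · have : y = 0 := by simpa using hy
        rw [this, map_zero]
      have h1 : B ((f - a • (1 : End ℂ M)) x) y = 0 :=
        ih j (k + 1) (by omega) _ y (by rw [pow_succ, End.mul_apply] at hx; exact hx) hy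
      have h2 : B x ((f - b • (1 : End ℂ M)) y) = 0 :=
        ih (j + 1) k (by omega) x _ hx (by rw [pow_succ, End.mul_apply] at hy; exact hy)
      simp only [LinearMap.sub_apply, LinearMap.smul_apply, End.one_apply, map_sub, map_smul,
        smul_eq_mul] at h1 h2
      rw [hf] at h1
      have h3 : (a - b) * B x y = 0 := by linear_combination h2 - h1
      exact (mul_eq_zero.1 h3).resolve_left (sub_ne_zero.2 hab)
  exact key _ j k rfl x y hj hk

/-- For a nondegenerate symmetric form on a complex space of even dimension, a nilpotent
self-adjoint operator has an invariant subspace equal to its own orthogonal complement. The proof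
takes a maximal invariant isotropic subspace `W`; if its complement `W'` were larger, then the
vectors of `W'` sent into `W` would contain an isotropic vector outside `W`. -/
lemma exists_invariant_lagrangian [FiniteDimensional ℂ M] {B : LinearMap.BilinForm ℂ M}
    (hB : ∀ v w, B v w = B w v) (hnd : ∀ v, (∀ w, B v w = 0) → v = 0) {N : End ℂ M}
    (hN : ∀ v w, B (N v) w = B v (N w)) (hnil : IsNilpotent N) (heven : Even (finrank ℂ M)) :
    ∃ W : Submodule ℂ M, (∀ w ∈ W, N w ∈ W) ∧ ∀ x, (∀ w ∈ W, B x w = 0) ↔ x ∈ W := by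
  let P : Set (Submodule ℂ M) := {W | (∀ w ∈ W, N w ∈ W) ∧ ∀ v ∈ W, ∀ w ∈ W, B v w = 0}
  have hP : P.Nonempty := ⟨⊥, by
    constructor
    · intro w hw
      rw [Submodule.mem_bot] at hw ⊢
      rw [hw, map_zero]
    · intro v hv w _
      rw [Submodule.mem_bot] at hv
      rw [hv, map_zero, LinearMap.zero_apply]⟩
  obtain ⟨W, ⟨hWN, hWi⟩, hmax⟩ :=
    (wellFounded_gt (α := Submodule ℂ M)).has_min P hP
  refine ⟨W, hWN, fun x => ⟨?_, fun hx w hw => hWi x hx w hw⟩⟩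
  let W' := B.orthogonal W
  have hW'mem : ∀ x, x ∈ W' ↔ ∀ w ∈ W, B x w = 0 := fun x => by
    rw [LinearMap.BilinForm.mem_orthogonal_iff]
    exact ⟨fun h w hw => by rw [hB]; exact h w hw, fun h w hw => by
      rw [hB]; exact h w hw⟩
  have hle : W ≤ W' := fun w hw => (hW'mem w).2 fun v hv => hWi w hw v hv
  rw [← hW'mem]
  suffices h : W' ≤ W from fun hx => h hx
  by_contra hne
  have hW'N : ∀ x ∈ W', N x ∈ W' := fun x hx => (hW'mem _).2 fun w hw => by
    rw [hN]; exact (hW'mem x).1 hx _ (hWN w hw)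
  -- An isotropic vector of `W'` outside `W` that is sent into `W` contradicts maximality.
  have hext : ∀ x ∈ W', N x ∈ W → x ∉ W → B x x ≠ 0 := by
    intro x hx hNx hxW h0
    have hmem : W ⊔ Submodule.span ℂ {x} ∈ P := by
      constructor
      · intro w hw
        obtain ⟨a, ha, y, hy, rfl⟩ := Submodule.mem_sup.1 hw
        obtain ⟨c, rfl⟩ := Submodule.mem_span_singleton.1 hy
        rw [map_add, map_smul]
        exact Submodule.mem_sup_left (W.add_mem (hWN a ha) (W.smul_mem c hNx))
      · intro v hv w hw
        obtain ⟨a, ha, y, hy, rfl⟩ := Submodule.mem_sup.1 hv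
        obtain ⟨c, rfl⟩ := Submodule.mem_span_singleton.1 hy
        obtain ⟨a', ha', y', hy', rfl⟩ := Submodule.mem_sup.1 hw
        obtain ⟨c', rfl⟩ := Submodule.mem_span_singleton.1 hy'
        have h1 := hWi a ha a' ha'
        have h2 := (hW'mem x).1 hx a' ha'
        have h3 := (hW'mem x).1 hx a ha
        rw [hB] at h3
        simp [h0, h1, h2, h3]
    refine hmax _ hmem (lt_of_le_of_ne le_sup_left fun h => hxW ?_)
    rw [h]
    exact Submodule.mem_sup_right (Submodule.mem_span_singleton_self x)
  have hdim : finrank ℂ W + finrank ℂ W' = finrank ℂ M := by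
    have hrefl : B.IsRefl := fun x y h => by rw [hB]; exact h
    rw [LinearMap.BilinForm.finrank_add_finrank_orthogonal hrefl]
    have : B.orthogonal ⊤ = ⊥ := by
      refine (Submodule.eq_bot_iff _).2 fun v hv => hnd v fun w => ?_
      rw [hB]
      exact (LinearMap.BilinForm.mem_orthogonal_iff.1 hv) w Submodule.mem_top
    rw [this, inf_bot_eq, finrank_bot, add_zero]
  have hlt : finrank ℂ W < finrank ℂ W' :=
    Submodule.finrank_lt_finrank_of_lt (lt_of_le_not_ge hle hne)
  have hlt2 : finrank ℂ W + 2 ≤ finrank ℂ W' := by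
    obtain ⟨r, hr⟩ := heven
    omega
  by_cases hU : ∀ y ∈ W', N y ∈ W
  · -- The quadratic form of `B` on a plane of `W'` modulo `W` has an isotropic vector.
    obtain ⟨x, hx, hxW⟩ := Set.not_subset.1 hne
    have hlt3 : ¬ W' ≤ W ⊔ Submodule.span ℂ {x} := by
      intro h
      have h1 := Submodule.finrank_mono h
      have h2 := Submodule.finrank_add_le_finrank_add_finrank W (Submodule.span ℂ {x})
      have h3 := finrank_span_le_card (R := ℂ) ({x} : Set M)
      simp only [Set.toFinset_singleton, Finset.card_singleton] at h3
      omega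
    obtain ⟨y, hy, hyW⟩ := Set.not_subset.1 hlt3
    have hxx := hext x hx (hU x hx) hxW
    obtain ⟨c, hc⟩ : ∃ c : ℂ, B x x * (c * c) + 2 * B x y * c + B y y = 0 := by
      have hs := IsAlgClosed.exists_pow_nat_eq (discrim (B x x) (2 * B x y) (B y y))
        (n := 2) (by norm_num)
      obtain ⟨s, hs⟩ := hs
      exact exists_quadratic_eq_zero hxx ⟨s, by rw [← hs]; ring⟩
    have hz : c • x + y ∈ W' := W'.add_mem (W'.smul_mem c hx) hy
    refine hext _ hz (hU _ hz) (fun h => hyW ?_) ?_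
    · have : y = (c • x + y) + (-c) • x := by rw [neg_smul]; abel
      rw [this]
      exact Submodule.add_mem_sup h (Submodule.smul_mem _ _ (Submodule.mem_span_singleton_self x))
    · simp only [map_add, map_smul, LinearMap.add_apply, LinearMap.smul_apply, smul_eq_mul]
      rw [hB y x]
      linear_combination hc
  · -- Iterating `N` on `y` reaches a vector `z` with `N z ∉ W` and `N (N z) ∈ W`.
    push Not at hU
    obtain ⟨y, hy, hNy⟩ := hU
    obtain ⟨r, hr⟩ := hnil
    have hex : ∃ k, (N ^ k) y ∈ W := ⟨r, by rw [hr]; exact W.zero_mem⟩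
    classical
    have hiter : ∀ k, (N ^ k) y ∈ W' := by
      intro k
      induction k with
      | zero => simpa using hy
      | succ k ih => rw [pow_succ', End.mul_apply]; exact hW'N _ ih
    obtain ⟨k, hk⟩ : ∃ k, Nat.find hex = k + 2 := by
      have h0 : Nat.find hex ≠ 0 := fun h => by
        have h1 := Nat.find_spec hex
        rw [h] at h1
        exact hNy (hWN _ (by simpa using h1))
      have h1 : Nat.find hex ≠ 1 := fun h => by
        have h1 := Nat.find_spec hex
        rw [h] at h1
        exact hNy (by simpa using h1)
      exact ⟨Nat.find hex - 2, by omega⟩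
    have hk2 : (N ^ (k + 2)) y ∈ W := hk ▸ Nat.find_spec hex
    have hk1 : (N ^ (k + 1)) y ∉ W := Nat.find_min hex (by omega)
    have hs1 : (N ^ (k + 1)) y = N ((N ^ k) y) := by rw [pow_succ', End.mul_apply]
    have hs2 : (N ^ (k + 2)) y = N ((N ^ (k + 1)) y) := by rw [pow_succ', End.mul_apply]
    refine hext _ (hiter (k + 1)) (hs2 ▸ hk2) hk1 ?_
    have h3 : B ((N ^ (k + 1)) y) ((N ^ (k + 1)) y) = B ((N ^ k) y) ((N ^ (k + 2)) y) := by
      rw [hs2, ← hN, ← hs1]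
    rw [h3]
    exact (hW'mem _).1 (hiter k) _ hk2

/-- For an operator self-adjoint with respect to a nondegenerate symmetric bilinear form, a
generalized eigenspace of even dimension contains an invariant subspace that is its own orthogonal
complement there: the form restricts to a nondegenerate form, and the operator minus the eigenvalue
to a nilpotent one. -/
lemma exists_lagrangian_maxGenEigenspace [FiniteDimensional ℂ M] {B : LinearMap.BilinForm ℂ M}
    (hB : ∀ v w, B v w = B w v) (hnd : ∀ v, (∀ w, B v w = 0) → v = 0) {f : End ℂ M}
    (hf : ∀ v w, B (f v) w = B v (f w)) (a : ℂ) (heven : Even (finrank ℂ (f.maxGenEigenspace a))) :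
    ∃ W : Submodule ℂ M, W ≤ f.maxGenEigenspace a ∧ (∀ w ∈ W, f w ∈ W) ∧
      ∀ x ∈ f.maxGenEigenspace a, (∀ w ∈ W, B x w = 0) ↔ x ∈ W := by
  set E := f.maxGenEigenspace a with hE
  have hmaps : Set.MapsTo (f - algebraMap ℂ (End ℂ M) a) E E :=
    End.mapsTo_maxGenEigenspace_of_comm (Algebra.mul_sub_algebraMap_commutes f a) a
  have hnil := End.isNilpotent_restrict_maxGenEigenspace_sub_algebraMap f a hmaps
  have hB' : ∀ v w : E, (B.restrict E) v w = B v w := fun v w => rfl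
  have happ : ∀ v : E, (((f - algebraMap ℂ (End ℂ M) a).restrict hmaps v : E) : M)
      = f v - a • (v : M) := fun v => rfl
  have hndE : ∀ v : E, (∀ w : E, (B.restrict E) v w = 0) → v = 0 := by
    intro v hv
    refine Subtype.ext (hnd _ fun w => ?_)
    have hw : w ∈ ⨆ b, f.maxGenEigenspace b := by
      rw [End.iSup_maxGenEigenspace_eq_top]; exact Submodule.mem_top
    refine Submodule.iSup_induction _ (motive := fun w => B v w = 0) hw (fun b y hy => ?_)
      (map_zero _) (fun y z hy hz => by rw [map_add, hy, hz, add_zero])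
    by_cases hab : a = b
    · subst hab; exact hv ⟨y, hy⟩
    · exact maxGenEigenspace_orthogonal hf hab v.2 hy
  obtain ⟨W, hWN, hW⟩ := exists_invariant_lagrangian (B := B.restrict E)
    (fun v w => hB v w) hndE (N := (f - algebraMap ℂ (End ℂ M) a).restrict hmaps)
    (fun v w => by
      rw [hB', hB', happ, happ, map_sub, map_sub, LinearMap.sub_apply, map_smul, map_smul, hf]
      rfl) hnil heven
  refine ⟨W.map E.subtype, Submodule.map_subtype_le E W, ?_, ?_⟩
  · rintro _ ⟨w, hw, rfl⟩
    have h1 := hWN w hw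
    refine ⟨_, W.add_mem h1 (W.smul_mem a hw), ?_⟩
    rw [map_add, map_smul, Submodule.subtype_apply, Submodule.subtype_apply, happ,
      sub_add_cancel]
  · intro x hx
    have h1 := hW ⟨x, hx⟩
    constructor
    · intro h
      exact ⟨⟨x, hx⟩, h1.1 fun w hw => h w ⟨w, hw, rfl⟩, rfl⟩
    · rintro ⟨x', hx', rfl⟩ _ ⟨w, hw, rfl⟩
      exact (hW x').2 hx' w hw

end SelfAdjoint

/-! ### Hamiltonian matrices with a real structure -/

section Hamiltonian

open Module
open scoped ComplexOrder

variable {n : ℕ}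

/-- The Hamiltonian matrix with rows `(-A*, -Rᵀ)` and `(R, A)`. -/
def hamBlock (A R : Matrix (Fin n) (Fin n) ℂ) : Matrix (Fin n ⊕ Fin n) (Fin n ⊕ Fin n) ℂ :=
  Matrix.fromBlocks (-Aᴴ) (-Rᵀ) R A

/-- The operator of the matrix `hamBlock A R`. -/
noncomputable def hamOp (A R : Matrix (Fin n) (Fin n) ℂ) : End ℂ (Fin n ⊕ Fin n → ℂ) :=
  Matrix.toLin' (hamBlock A R)

lemma hamOp_apply (A R : Matrix (Fin n) (Fin n) ℂ) (x y : Fin n → ℂ) :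
    hamOp A R (Sum.elim x y) = Sum.elim (-(Aᴴ *ᵥ x) - Rᵀ *ᵥ y) (R *ᵥ x + A *ᵥ y) := by
  rw [hamOp, Matrix.toLin'_apply, hamBlock, Matrix.fromBlocks_mulVec]
  simp only [Sum.elim_comp_inl, Sum.elim_comp_inr, Matrix.neg_mulVec]
  rfl

/-- The symmetric bilinear form `(x, y), (x', y') ↦ xᵀ x' - yᵀ y'`. -/
noncomputable def symForm (n : ℕ) : LinearMap.BilinForm ℂ (Fin n ⊕ Fin n → ℂ) :=
  Matrix.toBilin' (Matrix.fromBlocks 1 0 0 (-1))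

lemma symForm_apply (x y x' y' : Fin n → ℂ) :
    symForm n (Sum.elim x y) (Sum.elim x' y') = x ⬝ᵥ x' - y ⬝ᵥ y' := by
  rw [symForm, Matrix.toBilin'_apply', Matrix.fromBlocks_mulVec]
  simp only [Sum.elim_comp_inl, Sum.elim_comp_inr, Matrix.one_mulVec, Matrix.zero_mulVec,
    Matrix.neg_mulVec, add_zero, zero_add, sumElim_dotProduct_sumElim, dotProduct_neg,
    sub_eq_add_neg]

/-- The antilinear involution `(x, y) ↦ (ȳ, x̄)`. -/
def swapConj (v : Fin n ⊕ Fin n → ℂ) : Fin n ⊕ Fin n → ℂ :=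
  Sum.elim (star (v ∘ Sum.inr)) (star (v ∘ Sum.inl))

lemma exists_eq_elim (v : Fin n ⊕ Fin n → ℂ) : ∃ x y, v = Sum.elim x y :=
  ⟨v ∘ Sum.inl, v ∘ Sum.inr, (Sum.elim_comp_inl_inr v).symm⟩

lemma elim_add (x y x' y' : Fin n → ℂ) :
    Sum.elim (x + x') (y + y') = Sum.elim x y + Sum.elim x' y' := by
  ext i; rcases i with i | i <;> rfl

lemma elim_smul (c : ℂ) (x y : Fin n → ℂ) :
    Sum.elim (c • x) (c • y) = c • Sum.elim x y := by
  ext i; rcases i with i | i <;> rfl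

lemma elim_zero : Sum.elim (0 : Fin n → ℂ) (0 : Fin n → ℂ) = 0 := by
  ext i; rcases i with i | i <;> rfl

@[simp] lemma swapConj_elim (x y : Fin n → ℂ) :
    swapConj (Sum.elim x y) = Sum.elim (star y) (star x) := rfl

@[simp] lemma swapConj_swapConj (v : Fin n ⊕ Fin n → ℂ) : swapConj (swapConj v) = v := by
  obtain ⟨x, y, rfl⟩ := exists_eq_elim v
  simp

lemma swapConj_add (v w : Fin n ⊕ Fin n → ℂ) : swapConj (v + w) = swapConj v + swapConj w := by
  obtain ⟨x, y, rfl⟩ := exists_eq_elim v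
  obtain ⟨x', y', rfl⟩ := exists_eq_elim w
  rw [← elim_add, swapConj_elim, swapConj_elim, swapConj_elim, ← elim_add, star_add, star_add]

lemma swapConj_smul (c : ℂ) (v : Fin n ⊕ Fin n → ℂ) :
    swapConj (c • v) = star c • swapConj v := by
  obtain ⟨x, y, rfl⟩ := exists_eq_elim v
  rw [← elim_smul, swapConj_elim, swapConj_elim, ← elim_smul, star_smul, star_smul]

lemma swapConj_zero : swapConj (0 : Fin n ⊕ Fin n → ℂ) = 0 := by
  rw [← elim_zero, swapConj_elim, star_zero]

lemma symForm_comm (v w : Fin n ⊕ Fin n → ℂ) : symForm n v w = symForm n w v := by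
  obtain ⟨x, y, rfl⟩ := exists_eq_elim v
  obtain ⟨x', y', rfl⟩ := exists_eq_elim w
  rw [symForm_apply, symForm_apply, dotProduct_comm x, dotProduct_comm y]

lemma symForm_swapConj (v w : Fin n ⊕ Fin n → ℂ) :
    symForm n (swapConj v) (swapConj w) = -star (symForm n v w) := by
  obtain ⟨x, y, rfl⟩ := exists_eq_elim v
  obtain ⟨x', y', rfl⟩ := exists_eq_elim w
  rw [swapConj_elim, swapConj_elim, symForm_apply, symForm_apply, star_sub,
    ← Matrix.star_dotProduct_star, ← Matrix.star_dotProduct_star, dotProduct_comm (star x'),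
    dotProduct_comm (star y'), neg_sub]

lemma symForm_swapConj_left (v w : Fin n ⊕ Fin n → ℂ) :
    symForm n (swapConj v) w = -star (symForm n v (swapConj w)) := by
  conv_lhs => rw [← swapConj_swapConj w]
  exact symForm_swapConj v (swapConj w)

lemma symForm_nondegenerate (v : Fin n ⊕ Fin n → ℂ) (h : ∀ w, symForm n v w = 0) : v = 0 := by
  obtain ⟨x, y, rfl⟩ := exists_eq_elim v
  have hx : x = 0 := dotProduct_star_self_eq_zero.1 (by
    have := h (Sum.elim (star x) 0)
    rwa [symForm_apply, dotProduct_zero, sub_zero, dotProduct_comm] at this)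
  have hy : y = 0 := dotProduct_star_self_eq_zero.1 (by
    have := h (Sum.elim 0 (star y))
    rwa [symForm_apply, dotProduct_zero, zero_sub, neg_eq_zero, dotProduct_comm] at this)
  rw [hx, hy, elim_zero]

variable {A R : Matrix (Fin n) (Fin n) ℂ}

lemma conjTranspose_transpose_eq (hA : Aᵀ = A) : Aᴴᵀ = Aᴴ := by
  rw [Matrix.conjTranspose_transpose, Matrix.conjTranspose, hA]

/-- For symmetric `A` the Hamiltonian is self-adjoint for the symmetric form. -/
lemma symForm_hamOp (hA : Aᵀ = A) (v w : Fin n ⊕ Fin n → ℂ) :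
    symForm n (hamOp A R v) w = symForm n v (hamOp A R w) := by
  obtain ⟨x, y, rfl⟩ := exists_eq_elim v
  obtain ⟨x', y', rfl⟩ := exists_eq_elim w
  have hm : ∀ (L : Matrix (Fin n) (Fin n) ℂ) (a b : Fin n → ℂ),
      L *ᵥ a ⬝ᵥ b = a ⬝ᵥ Lᵀ *ᵥ b := fun L a b => by
    rw [Matrix.dotProduct_transpose_mulVec, dotProduct_comm]
  rw [hamOp_apply, hamOp_apply, symForm_apply, symForm_apply]
  simp only [sub_dotProduct, dotProduct_sub, neg_dotProduct, dotProduct_neg, add_dotProduct,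
    dotProduct_add, hm, conjTranspose_transpose_eq hA, hA, Matrix.transpose_transpose]
  ring

/-- For symmetric `A` and Hermitian `R` the involution anticommutes with the Hamiltonian. -/
lemma hamOp_swapConj (hA : Aᵀ = A) (hR : Rᴴ = R) (v : Fin n ⊕ Fin n → ℂ) :
    hamOp A R (swapConj v) = -swapConj (hamOp A R v) := by
  obtain ⟨x, y, rfl⟩ := exists_eq_elim v
  have hs : ∀ (L : Matrix (Fin n) (Fin n) ℂ) (a : Fin n → ℂ),
      star (L *ᵥ a) = Lᴴᵀ *ᵥ star a := fun L a => by
    rw [Matrix.star_mulVec, ← Matrix.mulVec_transpose]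
  have h1 : Rᵀᴴᵀ = R := by
    rw [Matrix.conjTranspose_transpose, Matrix.transpose_map]
    exact hR
  rw [swapConj_elim, hamOp_apply, hamOp_apply, swapConj_elim]
  simp only [star_add, star_sub, star_neg, hs, hR, h1, conjTranspose_transpose_eq hA,
    Matrix.conjTranspose_conjTranspose, hA]
  ext i
  rcases i with i | i
  · simp only [Sum.elim_inl, Pi.neg_apply, Pi.add_apply, Pi.sub_apply]
    ring
  · simp only [Sum.elim_inr, Pi.neg_apply, Pi.add_apply, Pi.sub_apply]
    ring

lemma symForm_elim_swapConj_elim (x y x' y' : Fin n → ℂ) :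
    symForm n (Sum.elim x y) (swapConj (Sum.elim x' y')) = x ⬝ᵥ star y' - y ⬝ᵥ star x' := by
  rw [swapConj_elim, symForm_apply]

/-- The involution maps the generalized eigenspace for `a` to the one for `-ā`. -/
lemma swapConj_mem_maxGenEigenspace (hA : Aᵀ = A) (hR : Rᴴ = R) {a : ℂ}
    {v : Fin n ⊕ Fin n → ℂ} (hv : v ∈ (hamOp A R).maxGenEigenspace a) :
    swapConj v ∈ (hamOp A R).maxGenEigenspace (-star a) := by
  rw [End.mem_maxGenEigenspace] at hv ⊢
  obtain ⟨k, hk⟩ := hv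
  refine ⟨k, ?_⟩
  induction k generalizing v with
  | zero =>
    have : v = 0 := by simpa using hk
    rw [this, swapConj_zero, map_zero]
  | succ k ih =>
    rw [pow_succ, End.mul_apply] at hk ⊢
    have h1 : (hamOp A R - (-star a) • (1 : End ℂ (Fin n ⊕ Fin n → ℂ))) (swapConj v)
        = -swapConj ((hamOp A R - a • (1 : End ℂ (Fin n ⊕ Fin n → ℂ))) v) := by
      simp only [LinearMap.sub_apply, LinearMap.smul_apply, End.one_apply]
      rw [hamOp_swapConj hA hR, sub_eq_add_neg (hamOp A R v), swapConj_add, ← neg_smul,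
        swapConj_smul, neg_smul, star_neg, neg_smul]
      abel
    rw [h1, map_neg, ih hk, neg_zero]

/-- The image of a subspace under the antilinear involution. -/
def conjSub (W : Submodule ℂ (Fin n ⊕ Fin n → ℂ)) : Submodule ℂ (Fin n ⊕ Fin n → ℂ) where
  carrier := {v | swapConj v ∈ W}
  add_mem' {a b} ha hb := by
    change swapConj (a + b) ∈ W
    rw [swapConj_add]; exact W.add_mem ha hb
  zero_mem' := by
    change swapConj 0 ∈ W
    rw [swapConj_zero]; exact W.zero_mem
  smul_mem' c a ha := by
    change swapConj (c • a) ∈ W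
    rw [swapConj_smul]; exact W.smul_mem _ ha

lemma mem_conjSub {W : Submodule ℂ (Fin n ⊕ Fin n → ℂ)} {v : Fin n ⊕ Fin n → ℂ} :
    v ∈ conjSub W ↔ swapConj v ∈ W := Iff.rfl

lemma conjSub_invariant (hA : Aᵀ = A) (hR : Rᴴ = R) {W : Submodule ℂ (Fin n ⊕ Fin n → ℂ)}
    (hW : ∀ w ∈ W, hamOp A R w ∈ W) : ∀ w ∈ conjSub W, hamOp A R w ∈ conjSub W := by
  intro w hw
  have h1 := hamOp_swapConj hA hR (swapConj w)
  rw [swapConj_swapConj] at h1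
  rw [mem_conjSub, h1, ← neg_one_smul ℂ, swapConj_smul, swapConj_swapConj]
  exact W.smul_mem _ (hW _ hw)

/-- A subspace is Lagrangian if it is its own orthogonal complement for the sesquilinear form
`(v, w) ↦ symForm v (swapConj w)`, that is `((x, y), (x', y')) ↦ y'* x - x'* y`. -/
def IsLagrangian (W : Submodule ℂ (Fin n ⊕ Fin n → ℂ)) : Prop :=
  ∀ x, (∀ w ∈ W, symForm n x (swapConj w) = 0) ↔ x ∈ W

lemma IsLagrangian.conjSub {W : Submodule ℂ (Fin n ⊕ Fin n → ℂ)} (hW : IsLagrangian W) :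
    IsLagrangian (conjSub W) := by
  intro x
  rw [mem_conjSub, ← hW]
  constructor
  · intro h w hw
    have h1 := h (swapConj w) (by rw [mem_conjSub, swapConj_swapConj]; exact hw)
    rw [swapConj_swapConj] at h1
    rw [symForm_swapConj, h1, star_zero, neg_zero]
  · intro h w hw
    have h1 := h _ hw
    rw [swapConj_swapConj, symForm_swapConj_left] at h1
    exact star_eq_zero.1 (neg_eq_zero.1 h1)

/-- The pair `(Rᵀ, A)` is observable: no nonzero `A`-invariant subspace lies in the kernel. -/
def NoUnobservable (A R : Matrix (Fin n) (Fin n) ℂ) : Prop :=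
  ∀ U : Submodule ℂ (Fin n → ℂ), (∀ v ∈ U, A *ᵥ v ∈ U) → (∀ v ∈ U, Rᵀ *ᵥ v = 0) → U = ⊥

/-- An invariant Lagrangian subspace is the graph of a Hermitian solution of the Riccati
equation. -/
lemma exists_riccati_of_lagrangian (hR : R.PosSemidef) (hobs : NoUnobservable A R)
    {W : Submodule ℂ (Fin n ⊕ Fin n → ℂ)} (hWf : ∀ w ∈ W, hamOp A R w ∈ W)
    (hW : IsLagrangian W) :
    ∃ P : Matrix (Fin n) (Fin n) ℂ, P.IsHermitian ∧ P * Rᵀ * P + A * P + P * Aᴴ + R = 0 ∧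
      ∀ x y, Sum.elim x y ∈ W ↔ y = P *ᵥ x := by
  have hiso : ∀ {x y x' y' : Fin n → ℂ}, Sum.elim x y ∈ W → Sum.elim x' y' ∈ W →
      x ⬝ᵥ star y' = y ⬝ᵥ star x' := by
    intro x y x' y' h h'
    have := (hW _).2 h _ h'
    rw [symForm_elim_swapConj_elim] at this
    exact sub_eq_zero.1 this
  let U : Submodule ℂ (Fin n → ℂ) :=
    { carrier := {y | Sum.elim (0 : Fin n → ℂ) y ∈ W}
      add_mem' := fun {a b} ha hb => by
        have := W.add_mem ha hb
        rwa [← elim_add, add_zero] at this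
      zero_mem' := by
        change Sum.elim (0 : Fin n → ℂ) (0 : Fin n → ℂ) ∈ W
        rw [elim_zero]; exact W.zero_mem
      smul_mem' := fun c a ha => by
        have := W.smul_mem c ha
        rwa [← elim_smul, smul_zero] at this }
  have hU0 : ∀ y ∈ U, Rᵀ *ᵥ y = 0 ∧ A *ᵥ y ∈ U := by
    intro y hy
    have h1 := hWf _ hy
    rw [hamOp_apply, Matrix.mulVec_zero, Matrix.mulVec_zero, neg_zero, zero_sub, zero_add] at h1
    have h2 := hiso h1 hy
    rw [star_zero, dotProduct_zero, neg_dotProduct, neg_eq_zero, dotProduct_comm] at h2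
    have h3 : Rᵀ *ᵥ y = 0 := (hR.transpose.dotProduct_mulVec_zero_iff y).1 h2
    rw [h3, neg_zero] at h1
    exact ⟨h3, h1⟩
  have hU : U = ⊥ := hobs U (fun v hv => (hU0 v hv).2) (fun v hv => (hU0 v hv).1)
  have huniq : ∀ {x y y' : Fin n → ℂ}, Sum.elim x y ∈ W → Sum.elim x y' ∈ W → y = y' := by
    intro x y y' h h'
    have h1 : y - y' ∈ U := by
      have h2 := W.add_mem h (W.smul_mem (-1) h')
      rw [← elim_smul, ← elim_add] at h2
      rw [neg_one_smul, neg_one_smul, add_neg_cancel, ← sub_eq_add_neg] at h2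
      exact h2
    rw [hU, Submodule.mem_bot] at h1
    exact sub_eq_zero.1 h1
  let X : Submodule ℂ (Fin n → ℂ) :=
    { carrier := {x | ∃ y, Sum.elim x y ∈ W}
      add_mem' := by
        rintro a b ⟨y, hy⟩ ⟨y', hy'⟩
        exact ⟨y + y', by rw [elim_add]; exact W.add_mem hy hy'⟩
      zero_mem' := ⟨0, by rw [elim_zero]; exact W.zero_mem⟩
      smul_mem' := by
        rintro c a ⟨y, hy⟩
        exact ⟨c • y, by rw [elim_smul]; exact W.smul_mem c hy⟩ }
  have hX : X = ⊤ := by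
    by_contra hne
    obtain ⟨φ, hφ, hle⟩ := X.exists_le_ker_of_lt_top (lt_top_iff_ne_top.2 hne)
    let c : Fin n → ℂ := fun i => φ (Pi.single i 1)
    have hc : ∀ x, φ x = c ⬝ᵥ x := by
      intro x
      conv_lhs => rw [pi_eq_sum_univ' x, map_sum]
      simp [c, dotProduct, mul_comm]
    have h1 : Sum.elim (0 : Fin n → ℂ) (star c) ∈ W := by
      refine (hW _).1 fun w hw => ?_
      obtain ⟨x, y, rfl⟩ := exists_eq_elim w
      have h2 : φ x = 0 := hle ⟨y, hw⟩
      rw [symForm_elim_swapConj_elim, zero_dotProduct, zero_sub, neg_eq_zero,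
        Matrix.star_dotProduct_star, dotProduct_comm, ← hc, h2, star_zero]
    have h2 : star c ∈ U := h1
    rw [hU, Submodule.mem_bot, star_eq_zero] at h2
    refine hφ (LinearMap.ext fun x => ?_)
    rw [hc, h2, zero_dotProduct, LinearMap.zero_apply]
  have hex : ∀ x, ∃ y, Sum.elim x y ∈ W := fun x => (hX ▸ Submodule.mem_top : x ∈ X)
  choose f hf using hex
  let F : (Fin n → ℂ) →ₗ[ℂ] (Fin n → ℂ) :=
    { toFun := f
      map_add' := fun v w => huniq (hf _) (by rw [elim_add]; exact W.add_mem (hf v) (hf w))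
      map_smul' := fun c v => huniq (hf _) (by
        rw [RingHom.id_apply, elim_smul]; exact W.smul_mem c (hf v)) }
  have hF : ∀ v, LinearMap.toMatrix' F *ᵥ v = f v := fun v => by
    rw [← Matrix.toLin'_apply, Matrix.toLin'_toMatrix']; rfl
  have hgraph : ∀ x y, Sum.elim x y ∈ W ↔ y = LinearMap.toMatrix' F *ᵥ x := fun x y => by
    rw [hF]
    exact ⟨fun h => huniq h (hf x), fun h => h ▸ hf x⟩
  generalize LinearMap.toMatrix' F = P at hgraph
  refine ⟨P, ?_, ?_, hgraph⟩
  · refine Matrix.ext_iff_mulVec.2 fun x => ?_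
    refine dotProduct_eq _ _ fun z => ?_
    have h1 := hiso ((hgraph x _).2 rfl) ((hgraph (star z) _).2 rfl)
    rw [star_star] at h1
    rw [← h1, Matrix.star_mulVec, star_star, dotProduct_comm x, ← Matrix.dotProduct_mulVec,
      dotProduct_comm z]
  · refine Matrix.ext_iff_mulVec.2 fun x => ?_
    have h1 := hWf _ ((hgraph x _).2 rfl)
    rw [hamOp_apply, hgraph] at h1
    simp only [Matrix.add_mulVec, ← Matrix.mulVec_mulVec, Matrix.zero_mulVec]
    rw [Matrix.mulVec_sub, Matrix.mulVec_neg] at h1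
    linear_combination (exp := 1) h1

/-- The graph of a matrix. -/
def graphSub (P : Matrix (Fin n) (Fin n) ℂ) : Submodule ℂ (Fin n ⊕ Fin n → ℂ) where
  carrier := {v | v ∘ Sum.inr = P *ᵥ (v ∘ Sum.inl)}
  add_mem' {a b} ha hb := by
    change (a + b) ∘ Sum.inr = P *ᵥ ((a + b) ∘ Sum.inl)
    have h1 : (a + b) ∘ Sum.inl = a ∘ Sum.inl + b ∘ Sum.inl := rfl
    have h2 : (a + b) ∘ Sum.inr = a ∘ Sum.inr + b ∘ Sum.inr := rfl
    rw [h1, h2, Matrix.mulVec_add]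
    exact congrArg₂ _ ha hb
  zero_mem' := (Matrix.mulVec_zero P).symm
  smul_mem' c a ha := by
    change (c • a) ∘ Sum.inr = P *ᵥ ((c • a) ∘ Sum.inl)
    have h1 : (c • a) ∘ Sum.inl = c • (a ∘ Sum.inl) := rfl
    have h2 : (c • a) ∘ Sum.inr = c • (a ∘ Sum.inr) := rfl
    rw [h1, h2, Matrix.mulVec_smul]
    exact congrArg _ ha

lemma elim_mem_graphSub {P : Matrix (Fin n) (Fin n) ℂ} {x y : Fin n → ℂ} :
    Sum.elim x y ∈ graphSub P ↔ y = P *ᵥ x := Iff.rfl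

lemma graphSub_invariant {P : Matrix (Fin n) (Fin n) ℂ}
    (hP : P * Rᵀ * P + A * P + P * Aᴴ + R = 0) :
    ∀ w ∈ graphSub P, hamOp A R w ∈ graphSub P := by
  intro w hw
  obtain ⟨x, y, rfl⟩ := exists_eq_elim w
  rw [elim_mem_graphSub] at hw
  subst hw
  rw [hamOp_apply, elim_mem_graphSub, Matrix.mulVec_sub, Matrix.mulVec_neg]
  have h1 := congrArg (fun L => L *ᵥ x) hP
  simp only [Matrix.add_mulVec, ← Matrix.mulVec_mulVec, Matrix.zero_mulVec] at h1
  linear_combination (exp := 1) h1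

lemma isLagrangian_graphSub {P : Matrix (Fin n) (Fin n) ℂ} (hP : P.IsHermitian) :
    IsLagrangian (graphSub P) := by
  intro v
  obtain ⟨x, y, rfl⟩ := exists_eq_elim v
  have key : ∀ x', symForm n (Sum.elim x y) (swapConj (Sum.elim x' (P *ᵥ x')))
      = (P *ᵥ x - y) ⬝ᵥ star x' := by
    intro x'
    rw [symForm_elim_swapConj_elim, Matrix.star_mulVec, hP.eq, dotProduct_comm,
      ← Matrix.dotProduct_mulVec, sub_dotProduct, dotProduct_comm (star x')]
  rw [elim_mem_graphSub]
  constructor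
  · intro h
    have h1 : P *ᵥ x - y = 0 := dotProduct_eq_zero _ fun z => by
      have h2 := h _ (elim_mem_graphSub.2 (rfl : P *ᵥ star z = P *ᵥ star z))
      rwa [key, star_star] at h2
    exact (sub_eq_zero.1 h1).symm
  · rintro rfl w hw
    obtain ⟨x', y', rfl⟩ := exists_eq_elim w
    rw [elim_mem_graphSub] at hw
    rw [hw, key, sub_self, zero_dotProduct]

/-- On generalized eigenvectors for imaginary eigenvalues all Hermitian solutions of the Riccati
equation agree. -/
lemma riccati_eq_on_imaginary (hR : R.PosSemidef) (hobs : NoUnobservable A R)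
    {P₀ P₁ : Matrix (Fin n) (Fin n) ℂ}
    (h₀ : P₀.IsHermitian) (h₁ : P₁.IsHermitian) (hr₀ : P₀ * Rᵀ * P₀ + A * P₀ + P₀ * Aᴴ + R = 0)
    (hr₁ : P₁ * Rᵀ * P₁ + A * P₁ + P₁ * Aᴴ + R = 0) {a : ℂ} (ha : star a = -a)
    {v : Fin n ⊕ Fin n → ℂ} (hv : v ∈ (hamOp A R).maxGenEigenspace a) (hv₀ : v ∈ graphSub P₀) :
    v ∈ graphSub P₁ := by
  rw [End.mem_maxGenEigenspace] at hv
  obtain ⟨k, hk⟩ := hv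
  induction k generalizing v with
  | zero =>
    have : v = 0 := by simpa using hk
    rw [this]; exact Submodule.zero_mem _
  | succ k ih =>
    rw [pow_succ, End.mul_apply] at hk
    have hv' : (hamOp A R - a • (1 : End ℂ (Fin n ⊕ Fin n → ℂ))) v ∈ graphSub P₀ := by
      simp only [LinearMap.sub_apply, LinearMap.smul_apply, End.one_apply]
      exact Submodule.sub_mem _ (graphSub_invariant hr₀ v hv₀) (Submodule.smul_mem _ a hv₀)
    have hv'' := ih hv' hk
    obtain ⟨x, y, rfl⟩ := exists_eq_elim v
    rw [elim_mem_graphSub] at hv₀ ⊢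
    subst hv₀
    set Δ := P₁ - P₀ with hΔ
    set x' := -(Aᴴ *ᵥ x) - Rᵀ *ᵥ (P₀ *ᵥ x) - a • x with hx'
    have he : (hamOp A R - a • (1 : End ℂ (Fin n ⊕ Fin n → ℂ))) (Sum.elim x (P₀ *ᵥ x))
        = Sum.elim x' (R *ᵥ x + A *ᵥ (P₀ *ᵥ x) - a • (P₀ *ᵥ x)) := by
      simp only [LinearMap.sub_apply, LinearMap.smul_apply, End.one_apply]
      rw [hamOp_apply, ← elim_smul]
      ext i; rcases i with i | i <;> rfl
    rw [he, elim_mem_graphSub] at hv' hv''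
    have hΔx' : Δ *ᵥ x' = 0 := by rw [hΔ, Matrix.sub_mulVec, ← hv', ← hv'', sub_self]
    have hΔH : Δᴴ = Δ := by rw [hΔ, Matrix.conjTranspose_sub, h₀.eq, h₁.eq]
    have hM : (A + P₀ * Rᵀ)ᴴ = Aᴴ + Rᵀ * P₀ := by
      rw [Matrix.conjTranspose_add, Matrix.conjTranspose_mul, h₀.eq, hR.transpose.1.eq]
    have hMx : (Aᴴ + Rᵀ * P₀) *ᵥ x = -(a • x) - x' := by
      rw [Matrix.add_mulVec, ← Matrix.mulVec_mulVec, hx']; abel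
    have hdiff : (A + P₀ * Rᵀ) * Δ + Δ * (Aᴴ + Rᵀ * P₀) + Δ * Rᵀ * Δ = 0 := by
      rw [← sub_self (0 : Matrix (Fin n) (Fin n) ℂ)]
      nth_rewrite 1 [← hr₁]
      rw [← hr₀, hΔ]
      noncomm_ring
    have hE : (A + P₀ * Rᵀ) *ᵥ (Δ *ᵥ x) - a • (Δ *ᵥ x) + Δ *ᵥ (Rᵀ *ᵥ (Δ *ᵥ x)) = 0 := by
      have h1 := congrArg (fun L => L *ᵥ x) hdiff
      simp only [Matrix.add_mulVec _ _ x, ← Matrix.mulVec_mulVec, Matrix.zero_mulVec] at h1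
      rw [Matrix.add_mulVec, ← Matrix.mulVec_mulVec] at hMx
      rw [hMx, Matrix.mulVec_sub, hΔx', sub_zero, Matrix.mulVec_neg, Matrix.mulVec_smul,
        ← sub_eq_add_neg] at h1
      exact h1
    have hstar : ∀ (L : Matrix (Fin n) (Fin n) ℂ) (u w : Fin n → ℂ),
        star u ⬝ᵥ L *ᵥ w = star (Lᴴ *ᵥ u) ⬝ᵥ w := fun L u w => by
      rw [Matrix.star_mulVec, Matrix.conjTranspose_conjTranspose, Matrix.dotProduct_mulVec]
    -- Pairing `hE` with `x` cancels the terms in `A` because `a` is imaginary; what remains is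
    -- the value of the semidefinite form `Rᵀ` at `Δ x`. Hence `Δ x` is an unobservable eigenvector.
    have hQ : Rᵀ *ᵥ (Δ *ᵥ x) = 0 := by
      refine (hR.transpose.dotProduct_mulVec_zero_iff _).1 ?_
      have h1 := congrArg (fun u => star x ⬝ᵥ u) hE
      simp only [dotProduct_add, dotProduct_sub, dotProduct_zero] at h1
      rw [hstar, hM, hMx, hstar Δ x (Rᵀ *ᵥ (Δ *ᵥ x)), hΔH, star_sub, star_neg, star_smul, ha,
        sub_dotProduct, neg_smul, neg_neg, smul_dotProduct, dotProduct_smul, hstar Δ x', hΔH,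
        hΔx', star_zero, zero_dotProduct, sub_zero, sub_self, zero_add] at h1
      exact h1
    have hAΔ : A *ᵥ (Δ *ᵥ x) = a • (Δ *ᵥ x) := by
      rw [hQ, Matrix.mulVec_zero, add_zero, Matrix.add_mulVec, ← Matrix.mulVec_mulVec, hQ,
        Matrix.mulVec_zero, add_zero] at hE
      exact sub_eq_zero.1 hE
    have hU := hobs (Submodule.span ℂ {Δ *ᵥ x}) (fun v hv => by
        obtain ⟨c, rfl⟩ := Submodule.mem_span_singleton.1 hv
        rw [Matrix.mulVec_smul, hAΔ]
        exact Submodule.smul_mem _ _ (Submodule.smul_mem _ _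
          (Submodule.mem_span_singleton_self _))) (fun v hv => by
        obtain ⟨c, rfl⟩ := Submodule.mem_span_singleton.1 hv
        rw [Matrix.mulVec_smul, hQ, smul_zero])
    rw [Submodule.span_singleton_eq_bot, hΔ, Matrix.sub_mulVec] at hU
    exact (sub_eq_zero.1 hU).symm

/-- A family of invariant subspaces of the generalized eigenspaces, matching under the pairing of
`a` with `-ā`, spans an invariant Lagrangian subspace. -/
lemma isLagrangian_iSup (hA : Aᵀ = A) (hR : Rᴴ = R)
    {W : ℂ → Submodule ℂ (Fin n ⊕ Fin n → ℂ)} (hle : ∀ a, W a ≤ (hamOp A R).maxGenEigenspace a)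
    (hW : ∀ a, ∀ x ∈ (hamOp A R).maxGenEigenspace a,
      (∀ w ∈ W (-star a), symForm n x (swapConj w) = 0) ↔ x ∈ W a) :
    IsLagrangian (⨆ a, W a) := by
  have horth : ∀ {a b : ℂ} {x w : Fin n ⊕ Fin n → ℂ}, x ∈ (hamOp A R).maxGenEigenspace a →
      w ∈ (hamOp A R).maxGenEigenspace b → b ≠ -star a → symForm n x (swapConj w) = 0 := by
    intro a b x w hx hw hab
    refine maxGenEigenspace_orthogonal (symForm_hamOp hA) ?_ hx
      (swapConj_mem_maxGenEigenspace hA hR hw)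
    rintro rfl
    exact hab (by rw [star_neg, star_star, neg_neg])
  intro x
  constructor
  · intro hx
    have hxtop : x ∈ ⨆ a, (hamOp A R).maxGenEigenspace a := by
      rw [End.iSup_maxGenEigenspace_eq_top]; exact Submodule.mem_top
    obtain ⟨g, hg, rfl⟩ := (Submodule.mem_iSup_iff_exists_finsupp _ _).1 hxtop
    refine (Submodule.mem_iSup_iff_exists_finsupp _ _).2 ⟨g, fun a => ?_, rfl⟩
    refine (hW a _ (hg a)).1 fun w hw => ?_
    have h1 := hx w (Submodule.mem_iSup_of_mem _ hw)
    rw [Finsupp.sum, map_sum, LinearMap.sum_apply] at h1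
    have h2 : ∑ b ∈ g.support, symForm n (g b) (swapConj w) = symForm n (g a) (swapConj w) := by
      refine Finset.sum_eq_single a (fun b _ hb => ?_) (fun ha => ?_)
      · refine horth (hg b) (hle _ hw) fun h => hb ?_
        have := congrArg star (neg_injective h)
        rw [star_star, star_star] at this
        exact this.symm
      · rw [Finsupp.notMem_support_iff.1 ha, map_zero, LinearMap.zero_apply]
    rw [← h2, h1]
  · intro hx w hw
    refine Submodule.iSup_induction W (motive := fun x => symForm n x (swapConj w) = 0) hx
      (fun a x hx => ?_) (by rw [map_zero, LinearMap.zero_apply])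
      (fun y z hy hz => by rw [map_add, LinearMap.add_apply, hy, hz, add_zero])
    refine Submodule.iSup_induction W (motive := fun w => symForm n x (swapConj w) = 0) hw
      (fun b w hw => ?_) (by rw [swapConj_zero, map_zero])
      (fun y z hy hz => by rw [swapConj_add, map_add, hy, hz, add_zero])
    by_cases hab : b = -star a
    · subst hab
      exact (hW a x (hle a hx)).2 hx w hw
    · exact horth (hle a hx) (hle b hw) hab

lemma iSup_invariant {f : End ℂ (Fin n ⊕ Fin n → ℂ)}
    {W : ℂ → Submodule ℂ (Fin n ⊕ Fin n → ℂ)} (hW : ∀ a, ∀ w ∈ W a, f w ∈ W a) :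
    ∀ w ∈ ⨆ a, W a, f w ∈ ⨆ a, W a := fun w hw =>
  Submodule.iSup_induction W (motive := fun w => f w ∈ ⨆ a, W a) hw
    (fun a w hw => Submodule.mem_iSup_of_mem a (hW a w hw))
    (by rw [map_zero]; exact Submodule.zero_mem _)
    (fun y z hy hz => by rw [map_add]; exact Submodule.add_mem _ hy hz)

lemma maxGenEigenspace_invariant {M : Type*} [AddCommGroup M] [Module ℂ M] (f : End ℂ M) (a : ℂ) :
    ∀ w ∈ f.maxGenEigenspace a, f w ∈ f.maxGenEigenspace a :=
  fun _ hw => End.mapsTo_maxGenEigenspace_of_comm (Commute.refl f) a hw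

/-- Without imaginary eigenvalues, the stable subspace of the Hamiltonian yields a Hermitian
solution of the Riccati equation. -/
lemma exists_riccati_of_no_imaginary (hA : Aᵀ = A) (hR : R.PosSemidef)
    (hobs : NoUnobservable A R)
    (him : ∀ a : ℂ, a.re = 0 → (hamOp A R).maxGenEigenspace a = ⊥) :
    ∃ P : Matrix (Fin n) (Fin n) ℂ, P.IsHermitian ∧ P * Rᵀ * P + A * P + P * Aᴴ + R = 0 := by
  classical
  let W : ℂ → Submodule ℂ (Fin n ⊕ Fin n → ℂ) := fun a =>
    if a.re < 0 then (hamOp A R).maxGenEigenspace a else ⊥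
  have hle : ∀ a, W a ≤ (hamOp A R).maxGenEigenspace a := by
    intro a
    by_cases ha : a.re < 0
    · simp only [W, if_pos ha]; exact le_rfl
    · simp only [W, if_neg ha]; exact bot_le
  have hinv : ∀ a, ∀ w ∈ W a, hamOp A R w ∈ W a := by
    intro a
    by_cases ha : a.re < 0
    · simp only [W, if_pos ha]; exact maxGenEigenspace_invariant _ a
    · simp only [W, if_neg ha]
      intro w hw
      rw [Submodule.mem_bot] at hw ⊢
      rw [hw, map_zero]
  have hre : ∀ a : ℂ, (-star a).re = -a.re := fun a => by simp
  have hL := isLagrangian_iSup hA hR.1.eq hle (fun a x hx => by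
    by_cases ha : a.re < 0
    · have h2 : ¬ (-star a).re < 0 := by rw [hre]; linarith
      simp only [W, if_pos ha, if_neg h2]
      refine ⟨fun _ => hx, fun _ w hw => ?_⟩
      rw [(Submodule.mem_bot ℂ).1 hw, swapConj_zero, map_zero]
    · simp only [W, if_neg ha, Submodule.mem_bot]
      constructor
      · intro h
        rcases eq_or_ne a.re 0 with h0 | h0
        · rw [him a h0] at hx
          exact hx
        have h2 : (-star a).re < 0 := by
          rw [hre]
          have := lt_of_le_of_ne (not_lt.1 ha) h0.symm
          linarith
        rw [if_pos h2] at h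
        refine symForm_nondegenerate x fun w => ?_
        have hw : w ∈ ⨆ b, (hamOp A R).maxGenEigenspace b := by
          rw [End.iSup_maxGenEigenspace_eq_top]; exact Submodule.mem_top
        refine Submodule.iSup_induction _ (motive := fun w => symForm n x w = 0) hw
          (fun b y hy => ?_) (map_zero _) (fun y z hy hz => by rw [map_add, hy, hz, add_zero])
        by_cases hab : a = b
        · subst hab
          have h3 := h _ (swapConj_mem_maxGenEigenspace hA hR.1.eq hy)
          rwa [swapConj_swapConj] at h3
        · exact maxGenEigenspace_orthogonal (symForm_hamOp hA) hab hx hy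
      · rintro rfl w _
        rw [map_zero, LinearMap.zero_apply])
  obtain ⟨P, h1, h2, -⟩ := exists_riccati_of_lagrangian hR hobs (iSup_invariant hinv) hL
  exact ⟨P, h1, h2⟩

/-- If the Riccati equation has a Hermitian solution and all eigenvalues of the Hamiltonian have
even algebraic multiplicity, then it has a Hermitian solution `P` with `P Pᵀ = 1`. Its graph is
built from isotropic halves of the generalized eigenspaces in the right half-plane, their images
under the involution, and, on the imaginary axis, the part common to all solutions. -/
lemma exists_symmetric_riccati (hA : Aᵀ = A) (hR : R.PosSemidef) (hobs : NoUnobservable A R)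
    {P₀ : Matrix (Fin n) (Fin n) ℂ} (h₀ : P₀.IsHermitian)
    (hr₀ : P₀ * Rᵀ * P₀ + A * P₀ + P₀ * Aᴴ + R = 0)
    (heven : ∀ a : ℂ, Even (finrank ℂ ((hamOp A R).maxGenEigenspace a))) :
    ∃ P : Matrix (Fin n) (Fin n) ℂ,
      P.IsHermitian ∧ P * Rᵀ * P + A * P + P * Aᴴ + R = 0 ∧ P * Pᵀ = 1 := by
  classical
  have hRH := hR.1.eq
  choose L hLle hLinv hL using fun a => exists_lagrangian_maxGenEigenspace (B := symForm n)
    symForm_comm symForm_nondegenerate (symForm_hamOp (R := R) hA) a (heven a)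
  set E := (hamOp A R).maxGenEigenspace with hE
  -- The piece of the future graph in the generalized eigenspace of `a`; the involution maps the
  -- eigenspace of `a` to that of `-star a`, the reflection of `a` in the imaginary axis.
  let W : ℂ → Submodule ℂ (Fin n ⊕ Fin n → ℂ) := fun a =>
    if 0 < a.re then L a else if a.re < 0 then conjSub (L (-star a)) else graphSub P₀ ⊓ E a
  have hWpos : ∀ a : ℂ, 0 < a.re → W a = L a := fun a ha => if_pos ha
  have hWneg : ∀ a : ℂ, a.re < 0 → W a = conjSub (L (-star a)) := fun a ha => by
    simp only [W]; rw [if_neg (by linarith), if_pos ha]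
  have hWzero : ∀ a : ℂ, a.re = 0 → W a = graphSub P₀ ⊓ E a := fun a ha => by
    simp only [W]; rw [if_neg (by linarith), if_neg (by linarith)]
  have hre : ∀ a : ℂ, (-star a).re = -a.re := fun a => by simp
  have hinvol : ∀ a : ℂ, -star (-star a) = a := fun a => by rw [star_neg, star_star, neg_neg]
  have hτE : ∀ {a : ℂ} {v : Fin n ⊕ Fin n → ℂ}, v ∈ E a → swapConj v ∈ E (-star a) :=
    fun hv => swapConj_mem_maxGenEigenspace hA hRH hv
  have hτE' : ∀ {a : ℂ} {v : Fin n ⊕ Fin n → ℂ}, swapConj v ∈ E (-star a) → v ∈ E a := by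
    intro a v hv
    have := hτE hv
    rwa [swapConj_swapConj, hinvol] at this
  have hG₀ := isLagrangian_graphSub h₀
  have hG₀inv := graphSub_invariant hr₀
  have hle : ∀ a, W a ≤ E a := by
    intro a
    rcases lt_trichotomy a.re 0 with ha | ha | ha
    · rw [hWneg a ha]
      intro v hv
      exact hτE' (hLle _ hv)
    · rw [hWzero a ha]; exact inf_le_right
    · rw [hWpos a ha]; exact hLle a
  have hinv : ∀ a, ∀ w ∈ W a, hamOp A R w ∈ W a := by
    intro a
    rcases lt_trichotomy a.re 0 with ha | ha | ha
    · rw [hWneg a ha]; exact conjSub_invariant hA hRH (hLinv _)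
    · rw [hWzero a ha]
      exact fun w hw => ⟨hG₀inv w hw.1, maxGenEigenspace_invariant _ a w hw.2⟩
    · rw [hWpos a ha]; exact hLinv a
  have hpair : ∀ a, ∀ x ∈ E a,
      (∀ w ∈ W (-star a), symForm n x (swapConj w) = 0) ↔ x ∈ W a := by
    intro a x hx
    rcases lt_trichotomy a.re 0 with ha | ha | ha
    · rw [hWneg a ha, hWpos _ (by rw [hre]; linarith), mem_conjSub, ← hL _ _ (hτE hx)]
      refine forall₂_congr fun w _ => ?_
      rw [symForm_swapConj_left, neg_eq_zero, star_eq_zero]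
    · have haa : -star a = a := by
        apply Complex.ext <;> simp [ha]
      rw [haa, hWzero a ha]
      constructor
      · intro h
        refine ⟨(hG₀ x).1 fun g hg => ?_, hx⟩
        have hg' : g ∈ ⨆ b, graphSub P₀ ⊓ E b := by
          rw [hE, ← Submodule.eq_iSup_inf_genEigenspace ⊤ hG₀inv
            (End.iSup_maxGenEigenspace_eq_top _)]
          exact hg
        refine Submodule.iSup_induction _ (motive := fun g => symForm n x (swapConj g) = 0) hg'
          (fun b y hy => ?_) (by rw [swapConj_zero, map_zero])
          (fun y z hy hz => by rw [swapConj_add, map_add, hy, hz, add_zero])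
        by_cases hab : b = a
        · subst hab; exact h y hy
        · refine maxGenEigenspace_orthogonal (symForm_hamOp hA) ?_ hx (hτE hy.2)
          intro h1
          apply hab
          rw [← hinvol b, ← h1, haa]
      · rintro ⟨hxG, -⟩ w ⟨hw, -⟩
        exact (hG₀ x).2 hxG w hw
    · rw [hWpos a ha, hWneg _ (by rw [hre]; linarith), hinvol, ← hL _ _ hx]
      constructor
      · intro h w hw
        have := h (swapConj w) (by rw [mem_conjSub, swapConj_swapConj]; exact hw)
        rwa [swapConj_swapConj] at this
      · exact fun h w hw => h _ hw
  have hlag := isLagrangian_iSup hA hRH hle hpair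
  -- `P₁` is the solution whose graph is the image of the graph of `P₀` under the involution. Over
  -- imaginary eigenvalues the two graphs agree, so the pieces of `W` there are invariant.
  obtain ⟨P₁, h₁, hr₁, hgr₁⟩ := exists_riccati_of_lagrangian hR hobs
    (conjSub_invariant hA hRH hG₀inv) hG₀.conjSub
  have hgr₁' : ∀ v, v ∈ graphSub P₁ ↔ swapConj v ∈ graphSub P₀ := by
    intro v
    obtain ⟨x, y, rfl⟩ := exists_eq_elim v
    rw [elim_mem_graphSub, ← hgr₁, mem_conjSub]
  have hτW : ∀ a, ∀ w ∈ W a, swapConj w ∈ W (-star a) := by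
    intro a w hw
    rcases lt_trichotomy a.re 0 with ha | ha | ha
    · rw [hWneg a ha] at hw
      rw [hWpos _ (by rw [hre]; linarith)]
      exact hw
    · have haa : star a = -a := by
        apply Complex.ext <;> simp [ha]
      rw [hWzero a ha] at hw
      rw [hWzero _ (by rw [hre, ha, neg_zero])]
      refine ⟨?_, hτE hw.2⟩
      rw [SetLike.mem_coe, ← hgr₁']
      exact riccati_eq_on_imaginary hR hobs h₀ h₁ hr₀ hr₁ haa hw.2 hw.1
    · rw [hWpos a ha] at hw
      rw [hWneg _ (by rw [hre]; linarith), hinvol, mem_conjSub, swapConj_swapConj]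
      exact hw
  have hτ : ∀ w ∈ ⨆ a, W a, swapConj w ∈ ⨆ a, W a := fun w hw =>
    Submodule.iSup_induction W (motive := fun w => swapConj w ∈ ⨆ a, W a) hw
      (fun a w hw => Submodule.mem_iSup_of_mem _ (hτW a w hw))
      (by rw [swapConj_zero]; exact Submodule.zero_mem _)
      (fun y z hy hz => by rw [swapConj_add]; exact Submodule.add_mem _ hy hz)
  obtain ⟨P, hP, hr, hgr⟩ := exists_riccati_of_lagrangian hR hobs (iSup_invariant hinv) hlag
  refine ⟨P, hP, hr, ?_⟩
  -- The graph is isotropic for the bilinear form as well: `xᵀ z = (P x)ᵀ (P z)`.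
  rw [mul_eq_one_comm]
  refine Matrix.ext_iff_mulVec.2 fun x => ?_
  refine dotProduct_eq _ _ fun z => ?_
  have h1 := (hlag _).2 ((hgr x _).2 rfl) _ (hτ _ ((hgr z _).2 rfl))
  rw [swapConj_swapConj, symForm_apply] at h1
  rw [Matrix.one_mulVec, ← Matrix.mulVec_mulVec, dotProduct_comm,
    Matrix.dotProduct_transpose_mulVec]
  exact (sub_eq_zero.1 h1).symm

end Hamiltonian

/-! ### Defect operators of a strict contraction -/

section Defect

open scoped ComplexOrder

variable {ι : Type*} [Fintype ι] [DecidableEq ι]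

/-- `D` is a strict contraction, expressed through its two defect matrices. -/
structure IsStrictContraction (D : Matrix ι ι ℂ) : Prop where
  right : (1 - Dᴴ * D).PosDef
  left : (1 - D * Dᴴ).PosDef

open scoped Matrix.Norms.L2Operator MatrixOrder in
lemma posDef_one_sub_of_norm_lt {D : Matrix ι ι ℂ} (h : ‖D‖ < 1) : (1 - Dᴴ * D).PosDef := by
  have h1 : ‖Dᴴ * D‖ < 1 := by
    rw [Matrix.l2_opNorm_conjTranspose_mul_self]
    nlinarith [norm_nonneg D]
  have h2 : (0 : Matrix ι ι ℂ) ≤ Dᴴ * D :=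
    Matrix.nonneg_iff_posSemidef.2 (Matrix.posSemidef_conjTranspose_mul_self D)
  have h3 : Dᴴ * D ≤ 1 := (CStarAlgebra.norm_le_one_iff_of_nonneg _ h2).1 h1.le
  exact (Matrix.le_iff.1 h3).posDef_iff_isUnit.2 (isUnit_one_sub_of_norm_lt_one h1)

open scoped Matrix.Norms.L2Operator in
lemma isStrictContraction_of_norm_lt {D : Matrix ι ι ℂ} (h : ‖D‖ < 1) :
    IsStrictContraction D := by
  refine ⟨posDef_one_sub_of_norm_lt h, ?_⟩
  have := posDef_one_sub_of_norm_lt (D := Dᴴ) (by rwa [Matrix.l2_opNorm_conjTranspose])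
  rwa [Matrix.conjTranspose_conjTranspose] at this

open scoped MatrixOrder in
lemma posSemidef_sqrtR (D : Matrix ι ι ℂ) : (sqrtR D).PosSemidef :=
  Matrix.nonneg_iff_posSemidef.1 (CFC.sqrt_nonneg _)

open scoped MatrixOrder in
lemma posSemidef_sqrtL (D : Matrix ι ι ℂ) : (sqrtL D).PosSemidef :=
  Matrix.nonneg_iff_posSemidef.1 (CFC.sqrt_nonneg _)

variable {D : Matrix ι ι ℂ}

open scoped MatrixOrder in
lemma IsStrictContraction.sqrtR_mul_self (h : IsStrictContraction D) :
    sqrtR D * sqrtR D = 1 - Dᴴ * D :=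
  CFC.sqrt_mul_sqrt_self _ (Matrix.nonneg_iff_posSemidef.2 h.right.posSemidef)

open scoped MatrixOrder in
lemma IsStrictContraction.sqrtL_mul_self (h : IsStrictContraction D) :
    sqrtL D * sqrtL D = 1 - D * Dᴴ :=
  CFC.sqrt_mul_sqrt_self _ (Matrix.nonneg_iff_posSemidef.2 h.left.posSemidef)

lemma conjTranspose_sqrtR (D : Matrix ι ι ℂ) : (sqrtR D)ᴴ = sqrtR D := (posSemidef_sqrtR D).1

lemma conjTranspose_sqrtL (D : Matrix ι ι ℂ) : (sqrtL D)ᴴ = sqrtL D := (posSemidef_sqrtL D).1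

lemma IsStrictContraction.isUnit_right (h : IsStrictContraction D) :
    IsUnit (1 - Dᴴ * D).det := (Matrix.isUnit_iff_isUnit_det _).1 h.right.isUnit

lemma IsStrictContraction.isUnit_left (h : IsStrictContraction D) :
    IsUnit (1 - D * Dᴴ).det := (Matrix.isUnit_iff_isUnit_det _).1 h.left.isUnit

lemma IsStrictContraction.isUnit_sqrtR (h : IsStrictContraction D) : IsUnit (sqrtR D).det := by
  have h1 := h.isUnit_right
  rw [← h.sqrtR_mul_self, Matrix.det_mul] at h1
  exact isUnit_of_mul_isUnit_left h1

lemma IsStrictContraction.isUnit_sqrtL (h : IsStrictContraction D) : IsUnit (sqrtL D).det := by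
  have h1 := h.isUnit_left
  rw [← h.sqrtL_mul_self, Matrix.det_mul] at h1
  exact isUnit_of_mul_isUnit_left h1

lemma IsStrictContraction.sqrtR_inv_mul_self (h : IsStrictContraction D) :
    (sqrtR D)⁻¹ * (sqrtR D)⁻¹ = (1 - Dᴴ * D)⁻¹ := by
  rw [← h.sqrtR_mul_self, Matrix.mul_inv_rev]

lemma IsStrictContraction.sqrtL_inv_mul_self (h : IsStrictContraction D) :
    (sqrtL D)⁻¹ * (sqrtL D)⁻¹ = (1 - D * Dᴴ)⁻¹ := by
  rw [← h.sqrtL_mul_self, Matrix.mul_inv_rev]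

/-- The defect operators intertwine `D*`. Their difference `Z` on `D*` satisfies a homogeneous
Sylvester equation `X Z + Z Y = 0` with positive definite coefficients. -/
lemma IsStrictContraction.sqrtR_mul_conjTranspose (h : IsStrictContraction D) :
    sqrtR D * Dᴴ = Dᴴ * sqrtL D := by
  set X := sqrtR D with hX
  set Y := sqrtL D with hY
  set Z := X * Dᴴ - Dᴴ * Y with hZ
  have hXX : X * X = 1 - Dᴴ * D := h.sqrtR_mul_self
  have hYY : Y * Y = 1 - D * Dᴴ := h.sqrtL_mul_self
  have h1 : X * Z + Z * Y = 0 := by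
    have : X * Z + Z * Y = (X * X) * Dᴴ - Dᴴ * (Y * Y) := by rw [hZ]; noncomm_ring
    rw [this, hXX, hYY]; noncomm_ring
  have hYpd : Y.PosDef := (posSemidef_sqrtL D).posDef_iff_isUnit.2
    ((Matrix.isUnit_iff_isUnit_det _).2 h.isUnit_sqrtL)
  have h2 : (Zᴴ * X * Z).PosSemidef := (posSemidef_sqrtR D).conjTranspose_mul_mul_same Z
  have h3 : (Z * Y * Zᴴ).PosSemidef := hYpd.posSemidef.mul_mul_conjTranspose_same Z
  have h4 : (Zᴴ * X * Z).trace + (Z * Y * Zᴴ).trace = 0 := by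
    have e1 : (Zᴴ * X * Z).trace = (X * Z * Zᴴ).trace := by
      rw [Matrix.mul_assoc, Matrix.trace_mul_comm]
    rw [e1, ← Matrix.trace_add, ← Matrix.add_mul, h1, Matrix.zero_mul, Matrix.trace_zero]
  have h5 : (Z * Y * Zᴴ).trace = 0 := by
    have a1 := h2.trace_nonneg
    have a2 := h3.trace_nonneg
    refine le_antisymm ?_ a2
    rw [← h4]
    exact le_add_of_nonneg_left a1
  have h6 : Z * Y * Zᴴ = 0 := h3.trace_eq_zero_iff.1 h5
  have h7 : Zᴴ = 0 := by
    refine Matrix.ext_iff_mulVec.2 fun x => ?_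
    rw [Matrix.zero_mulVec]
    by_contra hne
    have h8 := hYpd.dotProduct_mulVec_pos hne
    have h9 : star (Zᴴ *ᵥ x) ⬝ᵥ Y *ᵥ (Zᴴ *ᵥ x) = star x ⬝ᵥ (Z * Y * Zᴴ) *ᵥ x := by
      rw [Matrix.star_mulVec, Matrix.conjTranspose_conjTranspose, ← Matrix.dotProduct_mulVec,
        Matrix.mulVec_mulVec, Matrix.mulVec_mulVec]
    rw [h9, h6, Matrix.zero_mulVec, dotProduct_zero] at h8
    exact lt_irrefl _ h8
  have h10 : Z = 0 := by rw [← Matrix.conjTranspose_conjTranspose Z, h7, Matrix.conjTranspose_zero]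
  exact sub_eq_zero.1 h10

lemma IsStrictContraction.mul_sqrtR (h : IsStrictContraction D) :
    D * sqrtR D = sqrtL D * D := by
  have := congrArg Matrix.conjTranspose h.sqrtR_mul_conjTranspose
  rwa [Matrix.conjTranspose_mul, Matrix.conjTranspose_mul, Matrix.conjTranspose_conjTranspose,
    conjTranspose_sqrtR, conjTranspose_sqrtL] at this

lemma IsStrictContraction.conjTranspose_mul_sqrtL_inv (h : IsStrictContraction D) :
    Dᴴ * (sqrtL D)⁻¹ = (sqrtR D)⁻¹ * Dᴴ := by
  have h1 := h.sqrtR_mul_conjTranspose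
  calc Dᴴ * (sqrtL D)⁻¹ = (sqrtR D)⁻¹ * (sqrtR D * Dᴴ) * (sqrtL D)⁻¹ := by
        rw [Matrix.nonsing_inv_mul_cancel_left _ _ h.isUnit_sqrtR]
    _ = (sqrtR D)⁻¹ * Dᴴ := by
        rw [h1, Matrix.mul_assoc, Matrix.mul_assoc, Matrix.mul_nonsing_inv _ h.isUnit_sqrtL,
          Matrix.mul_one]

lemma IsStrictContraction.mul_inv_right (h : IsStrictContraction D) :
    D * (1 - Dᴴ * D)⁻¹ = (1 - D * Dᴴ)⁻¹ * D := by
  have h1 : (1 - D * Dᴴ) * D = D * (1 - Dᴴ * D) := by noncomm_ring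
  calc D * (1 - Dᴴ * D)⁻¹
      = (1 - D * Dᴴ)⁻¹ * ((1 - D * Dᴴ) * D) * (1 - Dᴴ * D)⁻¹ := by
        rw [Matrix.nonsing_inv_mul_cancel_left _ _ h.isUnit_left]
    _ = (1 - D * Dᴴ)⁻¹ * D := by
        rw [h1, Matrix.mul_assoc, Matrix.mul_assoc, Matrix.mul_nonsing_inv _ h.isUnit_right,
          Matrix.mul_one]

lemma IsStrictContraction.conjTranspose (h : IsStrictContraction D) : IsStrictContraction Dᴴ :=
  ⟨by rw [Matrix.conjTranspose_conjTranspose]; exact h.left,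
    by rw [Matrix.conjTranspose_conjTranspose]; exact h.right⟩

lemma IsStrictContraction.conjTranspose_mul_inv_left (h : IsStrictContraction D) :
    Dᴴ * (1 - D * Dᴴ)⁻¹ = (1 - Dᴴ * D)⁻¹ * Dᴴ := by
  have := h.conjTranspose.mul_inv_right
  rwa [Matrix.conjTranspose_conjTranspose] at this

lemma transpose_one_sub (hD : D = Dᵀ) : (1 - D * Dᴴ)ᵀ = 1 - Dᴴ * D := by
  have hDh : Dᴴᵀ = Dᴴ := by rw [Matrix.conjTranspose_transpose, Matrix.conjTranspose, ← hD]
  rw [Matrix.transpose_sub, Matrix.transpose_mul, Matrix.transpose_one, ← hD, hDh]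

open scoped MatrixOrder in
/-- For symmetric `D` the two defect operators are transposes of each other. -/
lemma IsStrictContraction.transpose_sqrtL (h : IsStrictContraction D) (hD : D = Dᵀ) :
    (sqrtL D)ᵀ = sqrtR D := by
  have h1 : (sqrtL D)ᵀ * (sqrtL D)ᵀ = 1 - Dᴴ * D := by
    rw [← Matrix.transpose_mul, h.sqrtL_mul_self, transpose_one_sub hD]
  exact (CFC.sqrt_unique h1 (Matrix.nonneg_iff_posSemidef.2 (posSemidef_sqrtL D).transpose)).symm

end Defect

/-! ### The Riccati equation and its Hamiltonian -/

section Hats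

open scoped ComplexOrder
open Module

variable {n : ℕ} {ι : Type*} [Fintype ι] [DecidableEq ι]
  {A : Matrix (Fin n) (Fin n) ℂ} {B : Matrix (Fin n) ι ℂ} {C : Matrix ι (Fin n) ℂ}
  {D : Matrix ι ι ℂ}

/-- The matrix `B̂ B̂*`. -/
noncomputable def hatR (B : Matrix (Fin n) ι ℂ) (D : Matrix ι ι ℂ) : Matrix (Fin n) (Fin n) ℂ :=
  hatB B D * (hatB B D)ᴴ

lemma posSemidef_hatR (B : Matrix (Fin n) ι ℂ) (D : Matrix ι ι ℂ) : (hatR B D).PosSemidef :=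
  Matrix.posSemidef_self_mul_conjTranspose _

lemma IsStrictContraction.hatR_eq (h : IsStrictContraction D) (B : Matrix (Fin n) ι ℂ) :
    hatR B D = B * (1 - Dᴴ * D)⁻¹ * Bᴴ := by
  rw [hatR, hatB, Matrix.conjTranspose_mul, Matrix.conjTranspose_nonsing_inv, conjTranspose_sqrtR,
    ← h.sqrtR_inv_mul_self]
  simp only [Matrix.mul_assoc]

lemma IsStrictContraction.hatC_mul (h : IsStrictContraction D) (C : Matrix ι (Fin n) ℂ) :
    (hatC C D)ᴴ * hatC C D = Cᴴ * (1 - D * Dᴴ)⁻¹ * C := by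
  rw [hatC, Matrix.conjTranspose_mul, Matrix.conjTranspose_nonsing_inv, conjTranspose_sqrtL,
    ← h.sqrtL_inv_mul_self]
  simp only [Matrix.mul_assoc]

lemma conjTranspose_transpose_comm {α β : Type*} (M : Matrix α β ℂ) : Mᴴᵀ = Mᵀᴴ :=
  Matrix.conjTranspose_transpose_eq_transpose_conjTranspose M

lemma IsStrictContraction.hatC_mul_eq_transpose (h : IsStrictContraction D) (hBC : Bᵀ = C)
    (hD : D = Dᵀ) : (hatC C D)ᴴ * hatC C D = (hatR B D)ᵀ := by
  rw [h.hatC_mul, h.hatR_eq, Matrix.transpose_mul, Matrix.transpose_mul,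
    Matrix.transpose_nonsing_inv, ← transpose_one_sub hD, Matrix.transpose_transpose,
    conjTranspose_transpose_comm, hBC, Matrix.mul_assoc]

lemma IsStrictContraction.hatA_transpose (h : IsStrictContraction D) (hA : A = Aᵀ) (hBC : Bᵀ = C)
    (hD : D = Dᵀ) : (hatA A B C D)ᵀ = hatA A B C D := by
  have hDh : Dᴴᵀ = Dᴴ := by rw [conjTranspose_transpose_comm, ← hD]
  have hCB : Cᵀ = B := by rw [← hBC, Matrix.transpose_transpose]
  rw [hatA, Matrix.transpose_add, ← hA, Matrix.transpose_mul, Matrix.transpose_mul,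
    Matrix.transpose_mul, Matrix.transpose_nonsing_inv, transpose_one_sub hD, hDh, hBC, hCB,
    Matrix.mul_assoc B Dᴴ, h.conjTranspose_mul_inv_left]
  simp only [Matrix.mul_assoc]

lemma hamiltonian_eq (h : IsStrictContraction D) (hBC : Bᵀ = C) (hD : D = Dᵀ) :
    hamiltonian A B C D = hamBlock (hatA A B C D) (hatR B D) := by
  rw [hamiltonian, h.hatC_mul_eq_transpose hBC hD]; rfl

lemma isHermitianRiccatiSolution_iff (h : IsStrictContraction D) (hBC : Bᵀ = C) (hD : D = Dᵀ)
    (P : Matrix (Fin n) (Fin n) ℂ) : IsHermitianRiccatiSolution A B C D P ↔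
      P.IsHermitian ∧ P * (hatR B D)ᵀ * P + hatA A B C D * P + P * (hatA A B C D)ᴴ
        + hatR B D = 0 := by
  rw [IsHermitianRiccatiSolution, h.hatC_mul_eq_transpose hBC hD]; rfl

/-- Output injection does not change the unobservable subspaces, so the observability of `(A, C)`
passes to the pair that enters the Riccati equation. -/
lemma noUnobservable_hat (h : IsStrictContraction D) (hBC : Bᵀ = C) (hD : D = Dᵀ)
    (ho : Observable A C) : NoUnobservable (hatA A B C D) (hatR B D) := by
  intro U hUA hUR
  have hC : ∀ v ∈ U, C *ᵥ v = 0 := by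
    intro v hv
    have h1 := hUR v hv
    rw [← h.hatC_mul_eq_transpose hBC hD, Matrix.conjTranspose_mul_self_mulVec_eq_zero, hatC,
      ← Matrix.mulVec_mulVec] at h1
    have h2 := congrArg (fun w => sqrtL D *ᵥ w) h1
    simp only [Matrix.mulVec_mulVec, Matrix.mulVec_zero] at h2
    rwa [← Matrix.mul_assoc, Matrix.mul_nonsing_inv _ h.isUnit_sqrtL, Matrix.one_mul] at h2
  refine ho.eq_bot (fun v hv => ?_) hC
  have h1 := hUA v hv
  rwa [hatA, Matrix.add_mulVec, ← Matrix.mulVec_mulVec _ _ C, hC v hv, Matrix.mulVec_zero,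
    add_zero] at h1

/-- Existence of a symmetric solution makes the characteristic polynomial of the Hamiltonian a
square: the Hamiltonian is similar to a block triangular matrix with diagonal blocks `-Z*` and
`Z = A + P Rᵀ`, and these two are similar up to transposition. -/
lemma charpoly_hamBlock_eq_sq {A R P : Matrix (Fin n) (Fin n) ℂ} (hA : Aᵀ = A)
    (hR : R.PosSemidef) (hP : P.IsHermitian) (hr : P * Rᵀ * P + A * P + P * Aᴴ + R = 0)
    (hPP : P * Pᵀ = 1) : (hamBlock A R).charpoly = (A + P * Rᵀ).charpoly ^ 2 := by
  set Z := A + P * Rᵀ with hZ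
  have hZH : Zᴴ = Aᴴ + Rᵀ * P := by
    rw [hZ, Matrix.conjTranspose_add, Matrix.conjTranspose_mul, hP.eq, hR.transpose.1.eq]
  have hr' : R + A * P = P * -(Aᴴ + Rᵀ * P) := by
    have : R + A * P - P * -(Aᴴ + Rᵀ * P) = P * Rᵀ * P + A * P + P * Aᴴ + R := by noncomm_ring
    exact sub_eq_zero.1 (this.trans hr)
  let T : (Matrix (Fin n ⊕ Fin n) (Fin n ⊕ Fin n) ℂ)ˣ :=
    ⟨Matrix.fromBlocks 1 0 P 1, Matrix.fromBlocks 1 0 (-P) 1,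
      by rw [Matrix.fromBlocks_multiply]; simp, by rw [Matrix.fromBlocks_multiply]; simp⟩
  have h1 : hamBlock A R
      = T.val * Matrix.fromBlocks (-Zᴴ) (-Rᵀ) 0 Z * T⁻¹.val := by
    have h2 : hamBlock A R * T.val = T.val * Matrix.fromBlocks (-Zᴴ) (-Rᵀ) 0 Z := by
      change hamBlock A R * Matrix.fromBlocks 1 0 P 1 = Matrix.fromBlocks 1 0 P 1 * _
      rw [hamBlock, Matrix.fromBlocks_multiply, Matrix.fromBlocks_multiply, hZH]
      simp only [Matrix.mul_one, Matrix.mul_zero, Matrix.one_mul, Matrix.zero_mul, add_zero,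
        zero_add]
      rw [hr', hZ]
      congr 1
      · noncomm_ring
      · noncomm_ring
    rw [← h2, Matrix.mul_assoc, ← Units.val_mul, mul_inv_cancel, Units.val_one, Matrix.mul_one]
  have h3 : (-Zᴴ)ᵀ.charpoly = Z.charpoly := by
    have hAt : Aᴴᵀ = Aᴴ := conjTranspose_transpose_eq hA
    have h4 : Z * P = P * (-Zᴴ)ᵀ := by
      rw [hZH, Matrix.transpose_neg, Matrix.transpose_add, Matrix.transpose_mul,
        Matrix.transpose_transpose, hAt, hZ]
      have : P * -(Aᴴ + Pᵀ * R) = -(P * Aᴴ) - (P * Pᵀ) * R := by noncomm_ring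
      rw [this, hPP, Matrix.one_mul, Matrix.add_mul]
      have h5 : A * P + P * Rᵀ * P - (-(P * Aᴴ) - R) = P * Rᵀ * P + A * P + P * Aᴴ + R := by
        noncomm_ring
      exact sub_eq_zero.1 (h5.trans hr)
    let V : (Matrix (Fin n) (Fin n) ℂ)ˣ := ⟨P, Pᵀ, hPP, mul_eq_one_comm.1 hPP⟩
    have h6 : Z = V.val * (-Zᴴ)ᵀ * V⁻¹.val := by
      change Z = P * (-Zᴴ)ᵀ * Pᵀ
      rw [← h4, Matrix.mul_assoc, hPP, Matrix.mul_one]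
    have h7 := Matrix.charpoly_units_conj V (-Zᴴ)ᵀ
    rw [← Matrix.coe_units_inv, ← h6] at h7
    exact h7.symm
  have h8 := Matrix.charpoly_units_conj T (Matrix.fromBlocks (-Zᴴ) (-Rᵀ) 0 Z)
  rw [← Matrix.coe_units_inv, ← h1] at h8
  rw [h8, Matrix.charpoly_fromBlocks_zero₂₁, ← h3, Matrix.charpoly_transpose, sq]

lemma even_finrank_of_charpoly_eq_sq {A R : Matrix (Fin n) (Fin n) ℂ} {q : Polynomial ℂ}
    (h : (hamBlock A R).charpoly = q ^ 2) (a : ℂ) :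
    Even (finrank ℂ ((hamOp A R).maxGenEigenspace a)) := by
  rw [LinearMap.finrank_maxGenEigenspace_eq, hamOp, Matrix.charpoly_toLin', h, ← Polynomial.count_roots,
    Polynomial.roots_pow, Multiset.count_nsmul]
  exact even_two_mul _

/-- If `G Gᴴ` has no fixed vector, where `G` is the value of the transfer function at the point
`s` of the imaginary axis, then `s` is not an eigenvalue of the Hamiltonian: an eigenvector yields
an input `u` and an output `z` with `z = G u` and `u = Gᴴ z`. -/
lemma hamOp_no_eigenvector (h : IsStrictContraction D) (hBC : Bᵀ = C) (hD : D = Dᵀ) {s : ℂ}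
    (hs : star s = -s) (hdet : IsUnit (Matrix.scalar (Fin n) s - A).det)
    (hG : ∀ z : ι → ℂ, ((C * (Matrix.scalar (Fin n) s - A)⁻¹ * B + D)
      * (C * (Matrix.scalar (Fin n) s - A)⁻¹ * B + D)ᴴ) *ᵥ z = z → z = 0)
    {v : Fin n ⊕ Fin n → ℂ} (hv : hamOp (hatA A B C D) (hatR B D) v = s • v) : v = 0 := by
  obtain ⟨x, y, rfl⟩ := exists_eq_elim v
  obtain ⟨Φ, hΦ⟩ : ∃ w, w = (Matrix.scalar (Fin n) s - A)⁻¹ := ⟨_, rfl⟩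
  rw [← hΦ] at hG
  obtain ⟨G, hGdef⟩ : ∃ w, w = C * Φ * B + D := ⟨_, rfl⟩
  rw [← hGdef] at hG
  obtain ⟨K, hK⟩ : ∃ w, w = (1 - Dᴴ * D)⁻¹ := ⟨_, rfl⟩
  obtain ⟨L, hL⟩ : ∃ w, w = (1 - D * Dᴴ)⁻¹ := ⟨_, rfl⟩
  have hLH : Lᴴ = L := by
    rw [hL, Matrix.conjTranspose_nonsing_inv, Matrix.conjTranspose_sub, Matrix.conjTranspose_mul,
      Matrix.conjTranspose_conjTranspose, Matrix.conjTranspose_one]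
  have hL1 : 1 + D * (Dᴴ * L) = L := by
    have := Matrix.mul_nonsing_inv _ h.isUnit_left
    rw [← hL, Matrix.sub_mul, Matrix.one_mul, Matrix.mul_assoc] at this
    rw [← this]; abel
  have hK1 : 1 + Dᴴ * (L * D) = K := by
    have := Matrix.nonsing_inv_mul _ h.isUnit_right
    rw [← hK, Matrix.mul_sub, Matrix.mul_one, ← Matrix.mul_assoc, hK,
      ← h.conjTranspose_mul_inv_left, ← hK, ← hL, Matrix.mul_assoc] at this
    rw [← this]; abel
  have hL2 : ∀ w, w + D *ᵥ (Dᴴ *ᵥ (L *ᵥ w)) = L *ᵥ w := fun w => by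
    rw [Matrix.mulVec_mulVec, Matrix.mulVec_mulVec]
    nth_rewrite 1 [← Matrix.one_mulVec w]
    rw [← Matrix.add_mulVec, Matrix.mul_assoc, hL1]
  have hK2 : ∀ w, w + Dᴴ *ᵥ (L *ᵥ (D *ᵥ w)) = K *ᵥ w := fun w => by
    rw [Matrix.mulVec_mulVec, Matrix.mulVec_mulVec]
    nth_rewrite 1 [← Matrix.one_mulVec w]
    rw [← Matrix.add_mulVec, Matrix.mul_assoc, hK1]
  have hLD : D * K = L * D := by rw [hK, hL, h.mul_inv_right]
  obtain ⟨u, hu⟩ : ∃ w, w = K *ᵥ (Bᴴ *ᵥ x) + Dᴴ *ᵥ (L *ᵥ (C *ᵥ y)) := ⟨_, rfl⟩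
  obtain ⟨z, hz⟩ : ∃ w, w = L *ᵥ (D *ᵥ (Bᴴ *ᵥ x)) + L *ᵥ (C *ᵥ y) := ⟨_, rfl⟩
  have hzu : z = C *ᵥ y + D *ᵥ u := by
    rw [hu, hz, Matrix.mulVec_add, Matrix.mulVec_mulVec _ D K, hLD, ← Matrix.mulVec_mulVec]
    rw [add_left_comm, hL2]
  have huz : u = Bᴴ *ᵥ x + Dᴴ *ᵥ z := by
    rw [hu, hz, Matrix.mulVec_add, ← add_assoc, hK2]
  rw [hamOp_apply] at hv
  have hv1 : -((hatA A B C D)ᴴ *ᵥ x) - (hatR B D)ᵀ *ᵥ y = s • x := by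
    funext i
    simpa using congrFun hv (Sum.inl i)
  have hv2 : hatR B D *ᵥ x + hatA A B C D *ᵥ y = s • y := by
    funext i
    simpa using congrFun hv (Sum.inr i)
  rw [← h.hatC_mul_eq_transpose hBC hD, h.hatC_mul, hatA, Matrix.conjTranspose_add,
    Matrix.conjTranspose_mul, Matrix.conjTranspose_mul, Matrix.conjTranspose_mul,
    Matrix.conjTranspose_conjTranspose, ← hL, hLH] at hv1
  rw [h.hatR_eq, hatA, ← hK, ← hL] at hv2
  simp only [Matrix.add_mulVec, ← Matrix.mulVec_mulVec] at hv1 hv2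
  have hy : (Matrix.scalar (Fin n) s - A) *ᵥ y = B *ᵥ u := by
    rw [Matrix.sub_mulVec, Matrix.scalar_apply, ← Matrix.smul_one_eq_diagonal, Matrix.smul_mulVec,
      Matrix.one_mulVec, ← hv2, hu, Matrix.mulVec_add]
    abel
  have hx : (Matrix.scalar (Fin n) s - A)ᴴ *ᵥ x = Cᴴ *ᵥ z := by
    rw [Matrix.conjTranspose_sub, Matrix.scalar_apply, ← Matrix.smul_one_eq_diagonal,
      Matrix.conjTranspose_smul, Matrix.conjTranspose_one, hs, Matrix.sub_mulVec,
      Matrix.smul_mulVec, Matrix.one_mulVec, neg_smul, ← hv1, hz, Matrix.mulVec_add]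
    abel
  have hy' : y = Φ *ᵥ (B *ᵥ u) := by
    rw [← hy, Matrix.mulVec_mulVec, hΦ, Matrix.nonsing_inv_mul _ hdet, Matrix.one_mulVec]
  have hx' : x = Φᴴ *ᵥ (Cᴴ *ᵥ z) := by
    rw [← hx, Matrix.mulVec_mulVec, ← Matrix.conjTranspose_mul, hΦ, Matrix.mul_nonsing_inv _ hdet,
      Matrix.conjTranspose_one, Matrix.one_mulVec]
  have hz1 : z = G *ᵥ u := by
    rw [hzu, hGdef, Matrix.add_mulVec, ← Matrix.mulVec_mulVec, ← Matrix.mulVec_mulVec, ← hy']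
  have hu1 : u = Gᴴ *ᵥ z := by
    rw [huz, hGdef, Matrix.conjTranspose_add, Matrix.add_mulVec, Matrix.conjTranspose_mul,
      Matrix.conjTranspose_mul, ← Matrix.mulVec_mulVec, ← Matrix.mulVec_mulVec, ← hx']
  have hz0 : z = 0 := hG z (by rw [← Matrix.mulVec_mulVec, ← hu1, ← hz1])
  have hu0 : u = 0 := by rw [hu1, hz0, Matrix.mulVec_zero]
  rw [hx', hy', hz0, hu0]
  simp only [Matrix.mulVec_zero]
  exact elim_zero

end Hats

/-! ### Boundary behaviour of Schur functions -/

section Boundary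

open scoped ComplexOrder
open Filter Topology

variable {ι : Type*} [Fintype ι] [DecidableEq ι]

lemma tendsto_dotProduct_mulVec {α κ : Type*} [Fintype κ] {F : Filter α} {M : α → Matrix κ κ ℂ}
    {M₀ : Matrix κ κ ℂ} (h : Tendsto M F (𝓝 M₀)) (x y : κ → ℂ) :
    Tendsto (fun a => x ⬝ᵥ (M a *ᵥ y)) F (𝓝 (x ⬝ᵥ (M₀ *ᵥ y))) := by
  have hc : Continuous fun N : Matrix κ κ ℂ => x ⬝ᵥ (N *ᵥ y) :=
    continuous_const.dotProduct (continuous_id.matrix_mulVec continuous_const)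
  exact (hc.tendsto M₀).comp h

lemma posSemidef_of_tendsto {α κ : Type*} [Fintype κ] {F : Filter α} [F.NeBot]
    {M : α → Matrix κ κ ℂ} {M₀ : Matrix κ κ ℂ} (h : Tendsto M F (𝓝 M₀))
    (hp : ∀ᶠ a in F, (M a).PosSemidef) : M₀.PosSemidef := by
  refine Matrix.PosSemidef.of_dotProduct_mulVec_nonneg ?_ fun x => ?_
  · have h1 : Tendsto (fun a => (M a)ᴴ) F (𝓝 M₀ᴴ) :=
      ((continuous_id.matrix_conjTranspose).tendsto M₀).comp h
    exact tendsto_nhds_unique (h1.congr' (hp.mono fun a ha => ha.1.eq)) h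
  · exact ge_of_tendsto (tendsto_dotProduct_mulVec h (star x) x)
      (hp.mono fun a ha => ha.dotProduct_mulVec_nonneg x)

lemma tendsto_matrix_inv {α κ : Type*} [Fintype κ] [DecidableEq κ] {F : Filter α}
    {M : α → Matrix κ κ ℂ} {M₀ : Matrix κ κ ℂ} (h : Tendsto M F (𝓝 M₀)) (hM : IsUnit M₀.det) :
    Tendsto (fun a => (M a)⁻¹) F (𝓝 M₀⁻¹) := by
  refine (continuousAt_matrix_inv M₀ ?_).tendsto.comp h
  rw [Ring.inverse_eq_inv']
  exact continuousAt_inv₀ hM.ne_zero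

lemma norm_apply_le_one {M : Matrix ι ι ℂ} (h : (1 - M * Mᴴ).PosSemidef) (i j : ι) :
    ‖M i j‖ ≤ 1 := by
  have h1 := h.diag_nonneg (i := i)
  rw [Matrix.sub_apply, Matrix.one_apply_eq, Matrix.mul_apply] at h1
  have h2 : (∑ k, M i k * Mᴴ k i) = ((∑ k, ‖M i k‖ ^ 2 : ℝ) : ℂ) := by
    push_cast
    refine Finset.sum_congr rfl fun k _ => ?_
    rw [Matrix.conjTranspose_apply]
    exact Complex.mul_conj' _
  rw [h2, sub_nonneg, ← Complex.ofReal_one, Complex.real_le_real] at h1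
  have h3 : ‖M i j‖ ^ 2 ≤ ∑ k, ‖M i k‖ ^ 2 :=
    Finset.single_le_sum (f := fun k => ‖M i k‖ ^ 2) (fun k _ => sq_nonneg _) (Finset.mem_univ j)
  nlinarith [norm_nonneg (M i j)]

lemma tendsto_add_nhdsGT (s : ℂ) : Tendsto (fun t : ℝ => s + t) (𝓝[>] 0) (𝓝 s) := by
  have : Tendsto (fun t : ℝ => s + t) (𝓝 0) (𝓝 (s + (0 : ℝ))) :=
    (continuous_const.add Complex.continuous_ofReal).tendsto 0
  rw [Complex.ofReal_zero, add_zero] at this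
  exact this.mono_left nhdsWithin_le_nhds

/-- A rational Schur function has no poles on the imaginary axis: near a pole of an entry on the
axis that entry would be unbounded on the right half-plane. -/
lemma IsSchur.finiteAt {S : Matrix ι ι (RatFunc ℂ)} (hS : IsSchur S) {s : ℂ} (hs : 0 ≤ s.re) :
    FiniteAt S s := by
  rcases hs.lt_or_eq with hs | hs
  · exact (hS s hs).1
  intro i j h0
  have h1 : ∀ᶠ t : ℝ in 𝓝[>] 0, ‖(S i j).num.eval (s + t)‖ ≤ ‖(S i j).denom.eval (s + t)‖ := by
    filter_upwards [self_mem_nhdsWithin] with t ht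
    have hre : 0 < (s + t).re := by
      rw [Complex.add_re, ← hs, zero_add, Complex.ofReal_re]; exact ht
    obtain ⟨hf, hp⟩ := hS _ hre
    have h2 := norm_apply_le_one hp i j
    rw [evalAt, Matrix.map_apply, RatFunc.eval, Polynomial.eval₂_id, Polynomial.eval₂_id, norm_div,
      div_le_one (norm_pos_iff.2 (hf i j))] at h2
    exact h2
  have hlim := tendsto_add_nhdsGT s
  have h2 := le_of_tendsto_of_tendsto (((S i j).num.continuous.tendsto s).comp hlim).norm
    (((S i j).denom.continuous.tendsto s).comp hlim).norm h1
  rw [h0, norm_zero] at h2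
  have h3 : (S i j).num.eval s = 0 := norm_le_zero_iff.1 h2
  obtain ⟨a, b, hab⟩ := RatFunc.isCoprime_num_denom (S i j)
  have h4 := congrArg (Polynomial.eval s) hab
  rw [Polynomial.eval_add, Polynomial.eval_mul, Polynomial.eval_mul, h0, h3] at h4
  simp at h4

variable {n : ℕ} {A : Matrix (Fin n) (Fin n) ℂ} {B : Matrix (Fin n) ι ℂ} {C : Matrix ι (Fin n) ℂ}
  {D : Matrix ι ι ℂ}

lemma IsSchur.charpoly_eval_ne_zero {S : Matrix ι ι (RatFunc ℂ)} (hS : IsSchur S)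
    (h : IsMinimalRealization S A B C D) {s : ℂ} (hs : 0 ≤ s.re) : A.charpoly.eval s ≠ 0 :=
  charpoly_eval_ne_zero_of_finiteAt_transfer h.controllable h.observable (D := D)
    (h.1 ▸ hS.finiteAt hs)

lemma tendsto_scalar_sub {α : Type*} {F : Filter α} {f : α → ℂ} {s : ℂ} (h : Tendsto f F (𝓝 s))
    (A : Matrix (Fin n) (Fin n) ℂ) :
    Tendsto (fun a => Matrix.scalar (Fin n) (f a) - A) F (𝓝 (Matrix.scalar (Fin n) s - A)) := by
  have hc : Continuous fun s : ℂ => Matrix.scalar (Fin n) s - A := by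
    simp only [Matrix.scalar_apply]
    exact (Continuous.matrix_diagonal (continuous_pi fun _ => continuous_id)).sub continuous_const
  exact (hc.tendsto s).comp h

/-- The contractivity of a Schur function extends to the imaginary axis, by a limit from the right. -/
lemma IsSchur.posSemidef_boundary {S : Matrix ι ι (RatFunc ℂ)} (hS : IsSchur S)
    (h : IsMinimalRealization S A B C D) {s : ℂ} (hs : s.re = 0) :
    (1 - (C * (Matrix.scalar (Fin n) s - A)⁻¹ * B + D)
      * (C * (Matrix.scalar (Fin n) s - A)⁻¹ * B + D)ᴴ).PosSemidef := by
  have hlim := tendsto_matrix_inv (tendsto_scalar_sub (tendsto_add_nhdsGT s) A)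
    (isUnit_scalar_sub (hS.charpoly_eval_ne_zero h hs.ge))
  have hc : Continuous fun Φ : Matrix (Fin n) (Fin n) ℂ =>
      1 - (C * Φ * B + D) * (C * Φ * B + D)ᴴ := by
    have h1 : Continuous fun Φ : Matrix (Fin n) (Fin n) ℂ => C * Φ * B + D :=
      ((continuous_const.matrix_mul continuous_id).matrix_mul continuous_const).add
        continuous_const
    exact continuous_const.sub (h1.matrix_mul h1.matrix_conjTranspose)
  refine posSemidef_of_tendsto ((hc.tendsto _).comp hlim) ?_
  filter_upwards [self_mem_nhdsWithin] with t ht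
  have hre : 0 < (s + t).re := by
    rw [Complex.add_re, hs, zero_add, Complex.ofReal_re]; exact ht
  have h1 := (hS _ hre).2
  rw [h.1, evalAt_transfer B C D (hS.charpoly_eval_ne_zero h hre.le)] at h1
  exact h1

end Boundary

/-! ### A Hermitian solution of the Riccati equation -/

section Perturbation

open scoped ComplexOrder
open Filter Topology

variable {n : ℕ}

open scoped Matrix.Norms.L2Operator in
/-- Hermitian solutions of Riccati equations with converging data stay bounded when the limit pair
is observable; hence the limit equation is solvable. In the unbounded case a limit `N ≠ 0` of the
normalized solutions would have an `A`-invariant range on which `Rᵀ` vanishes. -/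
lemma exists_riccati_of_tendsto {A R : Matrix (Fin n) (Fin n) ℂ} (hR : R.PosSemidef)
    (hobs : NoUnobservable A R) {Ak Rk : ℕ → Matrix (Fin n) (Fin n) ℂ}
    (hAk : Tendsto Ak atTop (𝓝 A)) (hRk : Tendsto Rk atTop (𝓝 R)) (hpsd : ∀ k, (Rk k).PosSemidef)
    (hP : ∀ k, ∃ P : Matrix (Fin n) (Fin n) ℂ, P.IsHermitian ∧
      P * (Rk k)ᵀ * P + Ak k * P + P * (Ak k)ᴴ + Rk k = 0) :
    ∃ P : Matrix (Fin n) (Fin n) ℂ, P.IsHermitian ∧ P * Rᵀ * P + A * P + P * Aᴴ + R = 0 := by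
  choose P hPH hPr using hP
  -- With `c = 1 / (1 + ‖P‖)` and `N = c P` one has `‖N‖ + c = 1`, so the pairs `(N, c)` have a
  -- limit point `(M, d)`; the solutions are bounded along the subsequence exactly when `d ≠ 0`.
  set c : ℕ → ℝ := fun k => (1 + ‖P k‖)⁻¹ with hc
  have hpos : ∀ k, 0 < 1 + ‖P k‖ := fun k => by positivity
  have hcpos : ∀ k, 0 < c k := fun k => inv_pos.2 (hpos k)
  set N : ℕ → Matrix (Fin n) (Fin n) ℂ := fun k => (c k : ℂ) • P k with hN
  have hNc : ∀ k, ‖N k‖ + c k = 1 := fun k => by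
    rw [hN]
    simp only [norm_smul, Complex.norm_real, Real.norm_eq_abs, abs_of_pos (hcpos k)]
    have := inv_mul_cancel₀ (hpos k).ne'
    change c k * (1 + ‖P k‖) = 1 at this
    linarith
  have hmem : ∀ k, (N k, c k) ∈ Metric.closedBall (0 : Matrix (Fin n) (Fin n) ℂ) 1 ×ˢ
      Set.Icc (0 : ℝ) 1 := fun k => by
    have h1 := hNc k
    have h2 := norm_nonneg (N k)
    have h3 := (hcpos k).le
    refine ⟨?_, h3, by linarith⟩
    rw [mem_closedBall_zero_iff]
    linarith
  have : ProperSpace (Matrix (Fin n) (Fin n) ℂ) := FiniteDimensional.proper ℂ _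
  obtain ⟨⟨M, d⟩, -, φ, hφ, hlim⟩ :=
    ((isCompact_closedBall _ _).prod isCompact_Icc).tendsto_subseq hmem
  have hM : Tendsto (fun k => N (φ k)) atTop (𝓝 M) := (continuous_fst.tendsto _).comp hlim
  have hd : Tendsto (fun k => c (φ k)) atTop (𝓝 d) := (continuous_snd.tendsto _).comp hlim
  have hdC : Tendsto (fun k => (c (φ k) : ℂ)) atTop (𝓝 (d : ℂ)) :=
    (Complex.continuous_ofReal.tendsto _).comp hd
  have hA' := hAk.comp hφ.tendsto_atTop
  have hR' := hRk.comp hφ.tendsto_atTop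
  have hAH : Tendsto (fun k => (Ak (φ k))ᴴ) atTop (𝓝 Aᴴ) :=
    (continuous_id.matrix_conjTranspose.tendsto _).comp hA'
  have hRT : Tendsto (fun k => (Rk (φ k))ᵀ) atTop (𝓝 Rᵀ) :=
    (continuous_id.matrix_transpose.tendsto _).comp hR'
  have hMd : ‖M‖ + d = 1 :=
    tendsto_nhds_unique (hM.norm.add hd) (by simp only [hNc]; exact tendsto_const_nhds)
  have hNH : ∀ k, (N k).IsHermitian := fun k => by
    rw [hN, Matrix.IsHermitian, Matrix.conjTranspose_smul, (hPH k).eq, Complex.star_def,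
      Complex.conj_ofReal]
  have hMH : M.IsHermitian := by
    have h1 : Tendsto (fun k => (N (φ k))ᴴ) atTop (𝓝 Mᴴ) :=
      (continuous_id.matrix_conjTranspose.tendsto _).comp hM
    simp only [(hNH _).eq] at h1
    exact tendsto_nhds_unique h1 hM
  have hNr : ∀ k, N k * (Rk k)ᵀ * N k + (c k : ℂ) • (Ak k * N k + N k * (Ak k)ᴴ)
      + ((c k : ℂ) * c k) • Rk k = 0 := fun k => by
    have h1 := congrArg (fun X => ((c k : ℂ) * c k) • X) (hPr k)
    simp only [smul_zero] at h1
    rw [← h1, hN]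
    simp only [Matrix.smul_mul, Matrix.mul_smul, smul_add, smul_smul]
    abel
  have hlimit : M * Rᵀ * M + (d : ℂ) • (A * M + M * Aᴴ) + ((d : ℂ) * d) • R = 0 := by
    refine tendsto_nhds_unique (f := fun k => N (φ k) * (Rk (φ k))ᵀ * N (φ k)
      + (c (φ k) : ℂ) • (Ak (φ k) * N (φ k) + N (φ k) * (Ak (φ k))ᴴ)
      + ((c (φ k) : ℂ) * c (φ k)) • Rk (φ k)) (l := atTop) ?_ (by
        simp only [hNr]; exact tendsto_const_nhds)
    exact (((hM.mul hRT).mul hM).add (hdC.smul ((hA'.mul hM).add (hM.mul hAH)))).add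
      ((hdC.mul hdC).smul hR')
  by_cases hd0 : d = 0
  · exfalso
    rw [hd0, Complex.ofReal_zero, zero_smul, zero_mul, zero_smul, add_zero, add_zero] at hlimit
    have hRM : Rᵀ * M = 0 := by
      refine Matrix.ext_iff_mulVec.2 fun x => ?_
      rw [Matrix.zero_mulVec, ← Matrix.mulVec_mulVec]
      refine (hR.transpose.dotProduct_mulVec_zero_iff (M *ᵥ x)).1 ?_
      rw [Matrix.star_mulVec, hMH.eq, ← Matrix.dotProduct_mulVec, Matrix.mulVec_mulVec,
        Matrix.mulVec_mulVec, hlimit, Matrix.zero_mulVec, dotProduct_zero]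
    have hMR : M * Rᵀ = 0 := by
      have := congrArg Matrix.conjTranspose hRM
      rwa [Matrix.conjTranspose_mul, hMH.eq, hR.transpose.1.eq, Matrix.conjTranspose_zero] at this
    have hLpsd : (-(A * M + M * Aᴴ)).PosSemidef := by
      refine posSemidef_of_tendsto ((hA'.mul hM).add (hM.mul hAH)).neg (.of_forall fun k => ?_)
      have h1 : -(Ak (φ k) * N (φ k) + N (φ k) * (Ak (φ k))ᴴ)
          = ((c (φ k))⁻¹ : ℝ) • (N (φ k) * (Rk (φ k))ᵀ * (N (φ k))ᴴ) + (c (φ k)) • Rk (φ k) := by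
        have h2 : (c (φ k) : ℂ) ≠ 0 := by exact_mod_cast (hcpos _).ne'
        have h3 := hNr (φ k)
        have h4 : N (φ k) * (Rk (φ k))ᵀ * N (φ k)
            = -((c (φ k) : ℂ) • (Ak (φ k) * N (φ k) + N (φ k) * (Ak (φ k))ᴴ)
              + ((c (φ k) : ℂ) * c (φ k)) • Rk (φ k)) := by
          rw [add_assoc] at h3
          exact eq_neg_of_add_eq_zero_left h3
        rw [(hNH _).eq, h4, ← Complex.coe_smul, ← Complex.coe_smul, Complex.ofReal_inv, smul_neg,
          smul_add, smul_smul, smul_smul, inv_mul_cancel₀ h2, inv_mul_cancel_left₀ h2, one_smul]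
        abel
      rw [Function.comp_apply, h1]
      refine Matrix.PosSemidef.add ?_ ((hpsd _).smul (hcpos _).le)
      exact ((hpsd _).transpose.mul_mul_conjTranspose_same _).smul (inv_nonneg.2 (hcpos _).le)
    have hker : ∀ x, M *ᵥ x = 0 → M *ᵥ (Aᴴ *ᵥ x) = 0 := by
      intro x hx
      have hx' : star x ᵥ* M = 0 := by
        rw [← hMH.eq, ← Matrix.star_mulVec, hx, star_zero]
      have h1 : -(A * M + M * Aᴴ) *ᵥ x = 0 := by
        refine (hLpsd.dotProduct_mulVec_zero_iff x).1 ?_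
        rw [Matrix.neg_mulVec, Matrix.add_mulVec, ← Matrix.mulVec_mulVec, hx, Matrix.mulVec_zero,
          zero_add, dotProduct_neg, ← Matrix.mulVec_mulVec, Matrix.dotProduct_mulVec, hx',
          zero_dotProduct, neg_zero]
      rw [Matrix.neg_mulVec, Matrix.add_mulVec, ← Matrix.mulVec_mulVec, hx, Matrix.mulVec_zero,
        zero_add, ← Matrix.mulVec_mulVec] at h1
      exact neg_eq_zero.1 h1
    let U : Submodule ℂ (Fin n → ℂ) :=
      { carrier := {v | ∀ x, M *ᵥ x = 0 → star x ⬝ᵥ v = 0}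
        add_mem' := fun {a b} ha hb x hx => by rw [dotProduct_add, ha x hx, hb x hx, add_zero]
        zero_mem' := fun x _ => dotProduct_zero _
        smul_mem' := fun r a ha x hx => by rw [dotProduct_smul, ha x hx, smul_zero] }
    have hU : U = ⊥ := by
      refine hobs U (fun v hv x hx => ?_) (fun v hv => ?_)
      · have h1 := hv _ (hker x hx)
        rwa [Matrix.star_mulVec, Matrix.conjTranspose_conjTranspose, ← Matrix.dotProduct_mulVec]
          at h1
      · refine dotProduct_star_self_eq_zero.1 ?_
        have h1 := hv (Rᵀ *ᵥ (Rᵀ *ᵥ v))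
          (by rw [Matrix.mulVec_mulVec, hMR, Matrix.zero_mulVec])
        rw [Matrix.star_mulVec, hR.transpose.1.eq, ← Matrix.dotProduct_mulVec] at h1
        exact h1
    have hM0 : M = 0 := by
      refine Matrix.ext_iff_mulVec.2 fun x => ?_
      have h1 : M *ᵥ x ∈ U := fun y hy => by
        rw [Matrix.dotProduct_mulVec, ← hMH.eq, ← Matrix.star_mulVec, hy, star_zero,
          zero_dotProduct]
      rw [hU, Submodule.mem_bot] at h1
      rw [h1, Matrix.zero_mulVec]
    rw [hM0, hd0, norm_zero, add_zero] at hMd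
    exact zero_ne_one hMd
  · have hdC0 : (d : ℂ) ≠ 0 := by exact_mod_cast hd0
    refine ⟨(d : ℂ)⁻¹ • M, ?_, ?_⟩
    · rw [Matrix.IsHermitian, Matrix.conjTranspose_smul, hMH.eq, star_inv₀, Complex.star_def,
        Complex.conj_ofReal]
    · have h1 := congrArg (fun X => ((d : ℂ)⁻¹ * (d : ℂ)⁻¹) • X) hlimit
      simp only [smul_zero] at h1
      rw [← h1]
      simp only [Matrix.smul_mul, Matrix.mul_smul, smul_add, smul_smul]
      have h2 : (d : ℂ)⁻¹ * (d : ℂ)⁻¹ * d = (d : ℂ)⁻¹ := by field_simp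
      have h3 : (d : ℂ)⁻¹ * (d : ℂ)⁻¹ * (d * d) = 1 := by field_simp
      rw [h2, h3, one_smul]
      abel

variable {ι : Type*} [Fintype ι] [DecidableEq ι]
  {A : Matrix (Fin n) (Fin n) ℂ} {B : Matrix (Fin n) ι ℂ} {C : Matrix ι (Fin n) ℂ}
  {D : Matrix ι ι ℂ}

lemma maxGenEigenspace_eq_bot {V : Type*} [AddCommGroup V] [Module ℂ V] {f : Module.End ℂ V} {a : ℂ}
    (h : ∀ v, f v = a • v → v = 0) : f.maxGenEigenspace a = ⊥ := by
  have hinj : Function.Injective (f - a • (1 : Module.End ℂ V)) := by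
    rw [← LinearMap.ker_eq_bot, Submodule.eq_bot_iff]
    exact fun v hv => h v (sub_eq_zero.1 hv)
  refine (Submodule.eq_bot_iff _).2 fun v hv => ?_
  obtain ⟨k, hk⟩ := (Module.End.mem_maxGenEigenspace f a v).1 hv
  rw [Module.End.coe_pow] at hk
  exact hinj.iterate k (hk.trans (by rw [← Module.End.coe_pow, map_zero]))

lemma hatA_smul (A : Matrix (Fin n) (Fin n) ℂ) (B : Matrix (Fin n) ι ℂ) (C : Matrix ι (Fin n) ℂ)
    (D : Matrix ι ι ℂ) (t : ℝ) :
    hatA A ((t : ℂ) • B) ((t : ℂ) • C) ((t : ℂ) ^ 2 • D)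
      = A + (t : ℂ) ^ 4 • (B * Dᴴ * (1 - (t : ℂ) ^ 4 • (D * Dᴴ))⁻¹ * C) := by
  simp only [hatA, Matrix.conjTranspose_smul, star_pow, Complex.star_def, Complex.conj_ofReal,
    Matrix.smul_mul, Matrix.mul_smul, smul_smul]
  ring_nf

lemma hatR_smul {t : ℝ} (h : IsStrictContraction ((t : ℂ) ^ 2 • D)) (B : Matrix (Fin n) ι ℂ) :
    hatR ((t : ℂ) • B) ((t : ℂ) ^ 2 • D)
      = (t : ℂ) ^ 2 • (B * (1 - (t : ℂ) ^ 4 • (Dᴴ * D))⁻¹ * Bᴴ) := by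
  rw [h.hatR_eq]
  simp only [Matrix.conjTranspose_smul, star_pow, Complex.star_def, Complex.conj_ofReal,
    Matrix.smul_mul, Matrix.mul_smul, smul_smul]
  ring_nf

/-- A contraction multiplied by a factor `r < 1` fixes no nonzero vector. -/
lemma eq_zero_of_smul_mulVec_eq {M : Matrix ι ι ℂ} (hM : (1 - M).PosSemidef) {r : ℝ}
    (hr0 : 0 ≤ r) (hr : r < 1) {z : ι → ℂ} (hz : ((r : ℂ) • M) *ᵥ z = z) : z = 0 := by
  have h1 := hM.dotProduct_mulVec_nonneg z
  rw [Matrix.sub_mulVec, Matrix.one_mulVec, dotProduct_sub] at h1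
  have h2 : star z ⬝ᵥ z = r * (star z ⬝ᵥ (M *ᵥ z)) := by
    rw [← smul_eq_mul, ← dotProduct_smul, ← Matrix.smul_mulVec, hz]
  have h3 := (Complex.le_def.1 h1).1
  have h4 := (Complex.le_def.1 (dotProduct_star_self_nonneg z))
  have h5 := congrArg Complex.re h2
  rw [Complex.re_ofReal_mul] at h5
  rw [Complex.sub_re, Complex.zero_re] at h3
  have h6 : (star z ⬝ᵥ z).re = 0 := by
    have h7 := h4.1
    rw [Complex.zero_re] at h7
    nlinarith
  rw [← dotProduct_star_self_eq_zero]
  exact Complex.ext h6 h4.2.symm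

open scoped Matrix.Norms.L2Operator in
/-- For the data scaled by `t < 1`, which realizes `t² S`, the Hamiltonian has no eigenvalue on the
imaginary axis, so the Riccati equation has a Hermitian solution. -/
lemma exists_riccati_smul {S : Matrix ι ι (RatFunc ℂ)} (hS : IsSchur S)
    (h : IsMinimalRealization S A B C D) (hA : A = Aᵀ) (hBC : Bᵀ = C) (hD : D = Dᵀ) (hn : ‖D‖ < 1)
    {t : ℝ} (ht0 : 0 < t) (ht1 : t < 1) :
    IsStrictContraction ((t : ℂ) ^ 2 • D) ∧ ∃ P : Matrix (Fin n) (Fin n) ℂ, P.IsHermitian ∧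
      P * (hatR ((t : ℂ) • B) ((t : ℂ) ^ 2 • D))ᵀ * P
        + hatA A ((t : ℂ) • B) ((t : ℂ) • C) ((t : ℂ) ^ 2 • D) * P
        + P * (hatA A ((t : ℂ) • B) ((t : ℂ) • C) ((t : ℂ) ^ 2 • D))ᴴ
        + hatR ((t : ℂ) • B) ((t : ℂ) ^ 2 • D) = 0 := by
  have ht : (t : ℂ) ≠ 0 := by exact_mod_cast ht0.ne'
  have hst : IsStrictContraction ((t : ℂ) ^ 2 • D) := by
    refine isStrictContraction_of_norm_lt ?_
    rw [norm_smul, norm_pow, Complex.norm_real, Real.norm_eq_abs, abs_of_pos ht0]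
    have : t ^ 2 ≤ 1 := pow_le_one₀ ht0.le ht1.le
    nlinarith [norm_nonneg D]
  refine ⟨hst, ?_⟩
  have hBC' : ((t : ℂ) • B)ᵀ = (t : ℂ) • C := by rw [Matrix.transpose_smul, hBC]
  have hD' : (t : ℂ) ^ 2 • D = ((t : ℂ) ^ 2 • D)ᵀ := by rw [Matrix.transpose_smul, ← hD]
  have hobs : Observable A ((t : ℂ) • C) := by
    have h1 := Controllable.feedback h.observable 0 (G := (t : ℂ) • 1) (G' := (t : ℂ)⁻¹ • 1)
      (by rw [Matrix.smul_mul, Matrix.one_mul, smul_smul, mul_inv_cancel₀ ht, one_smul])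
    rwa [Matrix.mul_zero, add_zero, Matrix.mul_smul, Matrix.mul_one] at h1
  refine exists_riccati_of_no_imaginary (hst.hatA_transpose hA hBC' hD') (posSemidef_hatR _ _)
    (noUnobservable_hat hst hBC' hD' hobs) fun s hs => maxGenEigenspace_eq_bot fun v hv => ?_
  refine hamOp_no_eigenvector hst hBC' hD' (s := s) (Complex.ext (by simp [hs]) (by simp))
    (isUnit_scalar_sub (hS.charpoly_eval_ne_zero h hs.ge)) (fun z hz => ?_) hv
  have h1 : (t : ℂ) • C * (Matrix.scalar (Fin n) s - A)⁻¹ * (t : ℂ) • B + (t : ℂ) ^ 2 • D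
      = (t : ℂ) ^ 2 • (C * (Matrix.scalar (Fin n) s - A)⁻¹ * B + D) := by
    rw [Matrix.smul_mul, Matrix.smul_mul, Matrix.mul_smul, smul_smul, smul_add, sq]
  rw [h1, Matrix.conjTranspose_smul, Matrix.smul_mul, Matrix.mul_smul, smul_smul, star_pow,
    Complex.star_def, Complex.conj_ofReal, ← Complex.ofReal_pow, ← Complex.ofReal_mul] at hz
  refine eq_zero_of_smul_mulVec_eq (hS.posSemidef_boundary h hs) (by positivity) ?_ hz
  have : t ^ 2 < 1 := pow_lt_one₀ ht0.le ht1 two_ne_zero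
  nlinarith [sq_nonneg t]

open scoped Matrix.Norms.L2Operator in
/-- The Riccati equation of a symmetric Schur function has a Hermitian solution. -/
lemma exists_hermitian_riccati {S : Matrix ι ι (RatFunc ℂ)} (hS : IsSchur S)
    (h : IsMinimalRealization S A B C D) (hA : A = Aᵀ) (hBC : Bᵀ = C) (hD : D = Dᵀ)
    (hn : ‖D‖ < 1) :
    ∃ P : Matrix (Fin n) (Fin n) ℂ, P.IsHermitian ∧
      P * (hatR B D)ᵀ * P + hatA A B C D * P + P * (hatA A B C D)ᴴ + hatR B D = 0 := by
  have hst := isStrictContraction_of_norm_lt hn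
  obtain ⟨t, -, ht, hlim⟩ := exists_seq_strictMono_tendsto' (zero_lt_one (α := ℝ))
  have hex := fun k => exists_riccati_smul hS h hA hBC hD hn (ht k).1 (ht k).2
  have hpow : ∀ m : ℕ, Tendsto (fun k => (t k : ℂ) ^ m) atTop (𝓝 1) := fun m => by
    have := ((Complex.continuous_ofReal.tendsto 1).comp hlim).pow m
    rwa [Complex.ofReal_one, one_pow] at this
  have hinv : ∀ M : Matrix ι ι ℂ, IsUnit (1 - M).det →
      Tendsto (fun k => (1 - (t k : ℂ) ^ 4 • M)⁻¹) atTop (𝓝 (1 - M)⁻¹) := fun M hM => by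
    refine tendsto_matrix_inv ?_ hM
    have := ((hpow 4).smul_const M).const_sub 1
    rwa [one_smul] at this
  refine exists_riccati_of_tendsto (posSemidef_hatR B D) (noUnobservable_hat hst hBC hD h.observable)
    (Ak := fun k => hatA A ((t k : ℂ) • B) ((t k : ℂ) • C) ((t k : ℂ) ^ 2 • D))
    (Rk := fun k => hatR ((t k : ℂ) • B) ((t k : ℂ) ^ 2 • D)) ?_ ?_
    (fun k => posSemidef_hatR _ _) fun k => (hex k).2
  · simp only [hatA_smul]
    have hc : Continuous fun M : Matrix ι ι ℂ => B * Dᴴ * M * C :=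
      (continuous_const.matrix_mul continuous_id).matrix_mul continuous_const
    have h1 := ((hpow 4).smul ((hc.tendsto _).comp (hinv _ hst.isUnit_left))).const_add A
    rwa [one_smul] at h1
  · have h0 : ∀ k, hatR ((t k : ℂ) • B) ((t k : ℂ) ^ 2 • D)
        = (t k : ℂ) ^ 2 • (B * (1 - (t k : ℂ) ^ 4 • (Dᴴ * D))⁻¹ * Bᴴ) := fun k =>
      hatR_smul (hex k).1 B
    simp only [h0]
    have hc : Continuous fun M : Matrix ι ι ℂ => B * M * Bᴴ :=
      (continuous_const.matrix_mul continuous_id).matrix_mul continuous_const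
    have h1 := (hpow 2).smul ((hc.tendsto _).comp (hinv _ hst.isUnit_right))
    rwa [one_smul, ← hst.hatR_eq] at h1

/-- The Riccati equation has a symmetric solution exactly when the characteristic polynomial of the
Hamiltonian is a square. -/
lemma exists_solution_iff_charpoly {S : Matrix ι ι (RatFunc ℂ)} (hS : IsSchur S)
    (h : IsMinimalSymmetricRealization S A B C D) (hn : StrictlyContractiveAtInfinity S) :
    (∃ P, IsHermitianRiccatiSolution A B C D P ∧ P * Pᵀ = 1) ↔
      ∃ q : Polynomial ℂ, (hamiltonian A B C D).charpoly = q ^ 2 := by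
  obtain ⟨hmin, hA, hBC, hD⟩ := h
  obtain ⟨D', hD', hn⟩ := hn
  obtain rfl : D = D' := (hmin.1 ▸ hasValueAtInfinity_transfer A B C D).unique hD'
  have hst := isStrictContraction_of_norm_lt hn
  have hAT := hst.hatA_transpose hA hBC hD
  simp only [isHermitianRiccatiSolution_iff hst hBC hD, hamiltonian_eq hst hBC hD]
  constructor
  · rintro ⟨P, ⟨hP, hr⟩, hPP⟩
    exact ⟨_, charpoly_hamBlock_eq_sq hAT (posSemidef_hatR B D) hP hr hPP⟩
  · rintro ⟨q, hq⟩
    obtain ⟨P₀, h₀, hr₀⟩ := exists_hermitian_riccati hS hmin hA hBC hD hn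
    obtain ⟨P, hP, hr, hPP⟩ := exists_symmetric_riccati hAT (posSemidef_hatR B D)
      (noUnobservable_hat hst hBC hD hmin.observable) h₀ hr₀ (even_finrank_of_charpoly_eq_sq hq)
    exact ⟨P, ⟨hP, hr⟩, hPP⟩

end Perturbation

/-! ### Lyapunov equations and lossless systems -/

section Lyapunov

open scoped ComplexOrder
open Filter Topology

variable {n : ℕ}

open scoped Matrix.Norms.L2Operator in
lemma tendsto_pow_zero_of_spectrum {F : Matrix (Fin n) (Fin n) ℂ}
    (h : ∀ μ ∈ spectrum ℂ F, ‖μ‖ < 1) : Tendsto (fun k => F ^ k) atTop (𝓝 0) := by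
  rcases subsingleton_or_nontrivial (Matrix (Fin n) (Fin n) ℂ) with hs | hs
  · exact tendsto_const_nhds.congr fun k => Subsingleton.elim _ _
  have hρ : spectralRadius ℂ F < ((1 : NNReal) : ENNReal) :=
    spectrum.spectralRadius_lt_of_forall_lt F (r := 1) fun μ hμ => h μ hμ
  obtain ⟨r, hr1, hr2⟩ := ENNReal.lt_iff_exists_nnreal_btwn.1 hρ
  have hr2' : r < 1 := by exact_mod_cast hr2
  have hev := (spectrum.pow_nnnorm_pow_one_div_tendsto_nhds_spectralRadius F).eventually_lt_const hr1
  rw [tendsto_zero_iff_norm_tendsto_zero]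
  refine squeeze_zero' (.of_forall fun k => norm_nonneg _) ?_
    (tendsto_pow_atTop_nhds_zero_of_lt_one r.2 (by exact_mod_cast hr2'))
  filter_upwards [hev, eventually_gt_atTop 0] with k hk hk0
  have hk0' : (0 : ℝ) < k := by exact_mod_cast hk0
  have h1 : ((‖F ^ k‖₊ : ENNReal) ^ (1 / k : ℝ)) ^ (k : ℝ) ≤ (r : ENNReal) ^ (k : ℝ) :=
    ENNReal.rpow_le_rpow hk.le hk0'.le
  rw [← ENNReal.rpow_mul, one_div, inv_mul_cancel₀ hk0'.ne', ENNReal.rpow_one,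
    ENNReal.rpow_natCast] at h1
  exact_mod_cast h1

/-- The Cayley transform `(1 - A)⁻¹ (1 + A)` of a stable matrix has spectrum in the open unit
disc. -/
lemma norm_lt_one_of_mem_spectrum_cayley {A : Matrix (Fin n) (Fin n) ℂ}
    (hA : ∀ s : ℂ, 0 ≤ s.re → A.charpoly.eval s ≠ 0) {μ : ℂ}
    (hμ : μ ∈ spectrum ℂ ((1 - A)⁻¹ * (1 + A))) : ‖μ‖ < 1 := by
  have h1 : IsUnit (1 - A).det := by
    have := isUnit_scalar_sub (hA 1 (by simp))
    rwa [map_one] at this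
  by_contra hlt
  rw [not_lt] at hlt
  refine hμ ?_
  have h2 : algebraMap ℂ (Matrix (Fin n) (Fin n) ℂ) μ - (1 - A)⁻¹ * (1 + A)
      = (1 - A)⁻¹ * ((μ - 1) • (1 : Matrix (Fin n) (Fin n) ℂ) - (μ + 1) • A) := by
    have h3 : (μ - 1) • (1 : Matrix (Fin n) (Fin n) ℂ) - (μ + 1) • A
        = μ • (1 - A) - (1 + A) := by
      rw [sub_smul, add_smul, smul_sub, one_smul, one_smul]; abel
    rw [h3, Matrix.mul_sub, Matrix.mul_smul, Matrix.nonsing_inv_mul _ h1,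
      Algebra.algebraMap_eq_smul_one]
  change IsUnit (algebraMap ℂ (Matrix (Fin n) (Fin n) ℂ) μ - (1 - A)⁻¹ * (1 + A))
  rw [h2, Matrix.isUnit_iff_isUnit_det, Matrix.det_mul]
  refine (Matrix.isUnit_nonsing_inv_det _ h1).mul ?_
  by_cases hμ1 : μ + 1 = 0
  · rw [hμ1, zero_smul, sub_zero, Matrix.det_smul, Matrix.det_one, mul_one]
    have h4 : μ - 1 ≠ 0 := by
      rw [eq_neg_of_add_eq_zero_left hμ1]; norm_num
    exact (IsUnit.mk0 _ h4).pow _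
  · have h5 : (μ - 1) • (1 : Matrix (Fin n) (Fin n) ℂ) - (μ + 1) • A
        = (μ + 1) • (Matrix.scalar (Fin n) ((μ - 1) / (μ + 1)) - A) := by
      rw [smul_sub, Matrix.scalar_apply, ← Matrix.smul_one_eq_diagonal, smul_smul,
        mul_div_cancel₀ _ hμ1]
    rw [h5, Matrix.det_smul]
    refine ((IsUnit.mk0 _ hμ1).pow _).mul (isUnit_scalar_sub (hA _ ?_))
    rw [Complex.div_re, ← add_div]
    refine div_nonneg ?_ (Complex.normSq_nonneg _)
    have h6 : 1 ≤ μ.re * μ.re + μ.im * μ.im := by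
      rw [← Complex.normSq_apply, Complex.normSq_eq_norm_sq]
      nlinarith
    simp
    nlinarith

/-- Lyapunov's theorem: for stable `A`, a Hermitian `P` with `A P + P A* ≤ 0` is positive
semidefinite. By the Cayley transform `F` the hypothesis reads `F P F* ≤ P`, and
`F ^ k P (F ^ k)* → 0`. -/
lemma posSemidef_of_lyapunov {A P Q : Matrix (Fin n) (Fin n) ℂ}
    (hA : ∀ s : ℂ, 0 ≤ s.re → A.charpoly.eval s ≠ 0) (hQ : Q.PosSemidef)
    (h : A * P + P * Aᴴ + Q = 0) : P.PosSemidef := by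
  set F := (1 - A)⁻¹ * (1 + A) with hF
  have h1 : IsUnit (1 - A).det := by
    have := isUnit_scalar_sub (hA 1 (by simp))
    rwa [map_one] at this
  have hstep : (P - F * P * Fᴴ).PosSemidef := by
    have h2 : (1 - A) * P * (1 - A)ᴴ - (1 + A) * P * (1 + A)ᴴ = Q + Q := by
      rw [Matrix.conjTranspose_sub, Matrix.conjTranspose_add, Matrix.conjTranspose_one]
      have : (1 - A) * P * (1 - Aᴴ) - (1 + A) * P * (1 + Aᴴ) - (Q + Q)
          = -(A * P + P * Aᴴ + Q) - (A * P + P * Aᴴ + Q) := by noncomm_ring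
      rw [h, neg_zero, sub_zero] at this
      exact sub_eq_zero.1 this
    have h3 : P - F * P * Fᴴ = (1 - A)⁻¹ * (Q + Q) * ((1 - A)⁻¹)ᴴ := by
      rw [← h2, hF, Matrix.conjTranspose_mul, Matrix.mul_sub, Matrix.sub_mul]
      congr 1
      · rw [Matrix.conjTranspose_nonsing_inv, Matrix.mul_assoc, Matrix.mul_assoc ((1 - A) * P),
          Matrix.mul_nonsing_inv, Matrix.mul_one, Matrix.nonsing_inv_mul_cancel_left _ _ h1]
        rw [Matrix.det_conjTranspose]
        exact h1.star
      · simp only [Matrix.mul_assoc]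
    rw [h3]
    exact (hQ.add hQ).mul_mul_conjTranspose_same _
  have hpow : ∀ k : ℕ, (P - F ^ k * P * (F ^ k)ᴴ).PosSemidef := fun k => by
    induction k with
    | zero => simpa using Matrix.PosSemidef.zero
    | succ k ih =>
      have h4 : P - F ^ (k + 1) * P * (F ^ (k + 1))ᴴ
          = (P - F ^ k * P * (F ^ k)ᴴ) + F ^ k * (P - F * P * Fᴴ) * (F ^ k)ᴴ := by
        rw [pow_succ, Matrix.conjTranspose_mul]
        noncomm_ring
      rw [h4]
      exact ih.add (hstep.mul_mul_conjTranspose_same _)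
  have hlim := tendsto_pow_zero_of_spectrum fun μ hμ => norm_lt_one_of_mem_spectrum_cayley hA hμ
  have hc : Continuous fun X : Matrix (Fin n) (Fin n) ℂ => P - X * P * Xᴴ :=
    continuous_const.sub ((continuous_id.matrix_mul continuous_const).matrix_mul
      continuous_id.matrix_conjTranspose)
  have h5 := (hc.tendsto 0).comp hlim
  rw [Matrix.zero_mul, Matrix.zero_mul, sub_zero] at h5
  exact posSemidef_of_tendsto h5 (.of_forall hpow)

variable {κ : Type*} [Fintype κ] [DecidableEq κ] {A P : Matrix (Fin n) (Fin n) ℂ}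
  {B : Matrix (Fin n) κ ℂ} {C : Matrix κ (Fin n) ℂ} {D : Matrix κ κ ℂ}

/-- The state space certificate of losslessness: `P` satisfies the Lyapunov equation, `D` is
unitary, and the two are coupled by `C P = -D B*`. -/
structure IsLosslessSystem (A : Matrix (Fin n) (Fin n) ℂ) (B : Matrix (Fin n) κ ℂ)
    (C : Matrix κ (Fin n) ℂ) (D : Matrix κ κ ℂ) (P : Matrix (Fin n) (Fin n) ℂ) : Prop where
  isHermitian : P.IsHermitian
  lyapunov : A * P + P * Aᴴ + B * Bᴴ = 0
  coupling : C * P = -(D * Bᴴ)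
  unitary : D * Dᴴ = 1

/-- The energy balance of a lossless system. -/
lemma IsLosslessSystem.one_sub_eq (h : IsLosslessSystem A B C D P) {s : ℂ}
    (hs : A.charpoly.eval s ≠ 0) :
    1 - (C * (Matrix.scalar (Fin n) s - A)⁻¹ * B + D)
        * (C * (Matrix.scalar (Fin n) s - A)⁻¹ * B + D)ᴴ
      = (2 * s.re : ℝ) • (C * (Matrix.scalar (Fin n) s - A)⁻¹ * P
        * (C * (Matrix.scalar (Fin n) s - A)⁻¹)ᴴ) := by
  have hu := isUnit_scalar_sub hs
  set M := Matrix.scalar (Fin n) s - A with hM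
  have hMH : Mᴴ = star s • 1 - Aᴴ := by
    rw [hM, Matrix.conjTranspose_sub, Matrix.scalar_apply, ← Matrix.smul_one_eq_diagonal,
      Matrix.conjTranspose_smul, Matrix.conjTranspose_one]
  have hMs : M = s • 1 - A := by
    rw [hM, Matrix.scalar_apply, ← Matrix.smul_one_eq_diagonal]
  obtain ⟨Φ, hΦ⟩ : ∃ Φ, Φ = M⁻¹ := ⟨_, rfl⟩
  have h1 : Φ * M = 1 := by rw [hΦ, Matrix.nonsing_inv_mul _ hu]
  have h2 : Mᴴ * Φᴴ = 1 := by rw [← Matrix.conjTranspose_mul, h1, Matrix.conjTranspose_one]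
  rw [← hΦ]
  have h3 : M * P + P * Mᴴ = (2 * s.re : ℝ) • P + B * Bᴴ := by
    have h4 : B * Bᴴ = -(A * P + P * Aᴴ) := by
      rw [← neg_eq_of_add_eq_zero_right h.lyapunov]
    have h5 : (2 * s.re : ℝ) • P = (s + star s) • P := by
      rw [Complex.star_def, Complex.add_conj, Complex.coe_smul]
    rw [h5, h4, hMH, hMs, Matrix.sub_mul, Matrix.mul_sub, Matrix.smul_mul, Matrix.mul_smul, Matrix.one_mul,
      Matrix.mul_one, add_smul]
    abel
  have h6 : Φ * P + P * Φᴴ = (2 * s.re : ℝ) • (Φ * P * Φᴴ) + Φ * B * (Bᴴ * Φᴴ) := by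
    have h7 : Φ * (M * P + P * Mᴴ) * Φᴴ = Φ * P + P * Φᴴ := by
      have : Φ * (M * P + P * Mᴴ) * Φᴴ = (Φ * M) * (P * Φᴴ) + Φ * P * (Mᴴ * Φᴴ) := by
        noncomm_ring
      rw [this, h1, h2, Matrix.one_mul, Matrix.mul_one, add_comm]
    rw [← h7, h3, Matrix.mul_add, Matrix.add_mul, Matrix.mul_smul, Matrix.smul_mul]
    simp only [Matrix.mul_assoc]
  have h8 : B * Dᴴ = -(P * Cᴴ) := by
    have := congrArg Matrix.conjTranspose h.coupling
    rw [Matrix.conjTranspose_mul, h.isHermitian.eq, Matrix.conjTranspose_neg,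
      Matrix.conjTranspose_mul, Matrix.conjTranspose_conjTranspose] at this
    rw [this, neg_neg]
  have h9 : D * Bᴴ = -(C * P) := by rw [h.coupling, neg_neg]
  have h10 : (C * Φ * B + D) * (C * Φ * B + D)ᴴ
      = C * (Φ * B * (Bᴴ * Φᴴ)) * Cᴴ + C * Φ * (B * Dᴴ) + (D * Bᴴ) * (Φᴴ * Cᴴ) + D * Dᴴ := by
    rw [Matrix.conjTranspose_add, Matrix.conjTranspose_mul, Matrix.conjTranspose_mul,
      Matrix.mul_add, Matrix.add_mul, Matrix.add_mul]
    simp only [Matrix.mul_assoc, add_assoc]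
    abel
  have h11 : Φ * B * (Bᴴ * Φᴴ) = Φ * P + P * Φᴴ - (2 * s.re : ℝ) • (Φ * P * Φᴴ) := by
    rw [h6, add_sub_cancel_left]
  rw [h10, h8, h9, h.unitary, h11, Matrix.conjTranspose_mul, Matrix.mul_sub, Matrix.sub_mul,
    Matrix.mul_add, Matrix.add_mul, Matrix.mul_smul, Matrix.smul_mul, Matrix.mul_neg,
    Matrix.neg_mul]
  simp only [Matrix.mul_assoc]
  abel

lemma IsLosslessSystem.isInner (h : IsLosslessSystem A B C D P)
    (hA : ∀ s : ℂ, 0 ≤ s.re → A.charpoly.eval s ≠ 0) : IsInner (transfer A B C D) := by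
  have hP := posSemidef_of_lyapunov hA (Matrix.posSemidef_self_mul_conjTranspose B) h.lyapunov
  refine ⟨fun s hs => ⟨finiteAt_transfer B C D (hA s hs.le), ?_⟩, fun ω => ?_⟩
  · rw [evalAt_transfer B C D (hA s hs.le), h.one_sub_eq (hA s hs.le)]
    exact (hP.mul_mul_conjTranspose_same _).smul (by linarith)
  · have hre : (Complex.I * ω).re = 0 := by simp
    have h1 := h.one_sub_eq (hA _ hre.ge)
    rw [hre, mul_zero, zero_smul] at h1
    rw [evalAt_transfer B C D (hA _ hre.ge)]
    exact (sub_eq_zero.1 h1).symm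

/-- Multiplication by constant unitary factors preserves losslessness. -/
lemma IsLosslessSystem.mul_unitary (h : IsLosslessSystem A B C D P) {V₁ V₂ : Matrix κ κ ℂ}
    (h₁ : V₁ * V₁ᴴ = 1) (h₂ : V₂ * V₂ᴴ = 1) :
    IsLosslessSystem A (B * V₁) (V₂ * C) (V₂ * D * V₁) P where
  isHermitian := h.isHermitian
  lyapunov := by
    rw [Matrix.conjTranspose_mul, Matrix.mul_assoc, ← Matrix.mul_assoc V₁, h₁, Matrix.one_mul]
    exact h.lyapunov
  coupling := by
    rw [Matrix.mul_assoc, h.coupling, Matrix.conjTranspose_mul, Matrix.mul_assoc (V₂ * D),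
      ← Matrix.mul_assoc V₁, h₁, Matrix.one_mul, Matrix.mul_neg, Matrix.mul_assoc]
  unitary := by
    rw [Matrix.conjTranspose_mul, Matrix.mul_assoc, ← Matrix.mul_assoc V₁, h₁, Matrix.one_mul,
      Matrix.conjTranspose_mul, Matrix.mul_assoc, ← Matrix.mul_assoc D, h.unitary, Matrix.one_mul,
      h₂]

end Lyapunov

/-! ### The extension attached to a solution of the Riccati equation -/

section Extension

variable {n : ℕ} {ι : Type*} [Fintype ι] [DecidableEq ι]
  {A P : Matrix (Fin n) (Fin n) ℂ} {B : Matrix (Fin n) ι ℂ} {C : Matrix ι (Fin n) ℂ}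
  {D : Matrix ι ι ℂ}

lemma conjTranspose_inB (hP : P.IsHermitian) :
    (inB B C D P)ᴴ = -((sqrtL D)⁻¹ * (C * P + D * Bᴴ)) := by
  rw [inB, Matrix.conjTranspose_neg, Matrix.conjTranspose_mul, Matrix.conjTranspose_nonsing_inv,
    conjTranspose_sqrtL, Matrix.conjTranspose_add, Matrix.conjTranspose_mul,
    Matrix.conjTranspose_mul, hP.eq, Matrix.conjTranspose_conjTranspose,
    Matrix.conjTranspose_conjTranspose]

/-- The Riccati expression for `P` is the Lyapunov expression of the extended system. -/
lemma IsStrictContraction.lyapunov_eq_riccati (h : IsStrictContraction D) (hP : P.IsHermitian) :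
    A * P + P * Aᴴ + (inB B C D P * (inB B C D P)ᴴ + B * Bᴴ)
      = P * ((hatC C D)ᴴ * hatC C D) * P + hatA A B C D * P + P * (hatA A B C D)ᴴ
        + hatB B D * (hatB B D)ᴴ := by
  have hR : hatB B D * (hatB B D)ᴴ = B * Bᴴ + B * Dᴴ * (1 - D * Dᴴ)⁻¹ * D * Bᴴ := by
    rw [show hatB B D * (hatB B D)ᴴ = hatR B D from rfl, h.hatR_eq, Matrix.mul_assoc B Dᴴ,
      h.conjTranspose_mul_inv_left]
    have h1 : (1 - Dᴴ * D)⁻¹ = 1 + (1 - Dᴴ * D)⁻¹ * (Dᴴ * D) := by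
      have := Matrix.nonsing_inv_mul _ h.isUnit_right
      rw [Matrix.mul_sub, Matrix.mul_one] at this
      exact sub_eq_iff_eq_add.1 this
    conv_lhs => rw [h1]
    rw [Matrix.mul_add, Matrix.mul_one, Matrix.add_mul]
    simp only [Matrix.mul_assoc]
  have hLH : ((1 - D * Dᴴ)⁻¹)ᴴ = (1 - D * Dᴴ)⁻¹ := by
    rw [Matrix.conjTranspose_nonsing_inv, h.left.1.eq]
  rw [conjTranspose_inB hP, inB, hR, h.hatC_mul, hatA, Matrix.neg_mul, Matrix.mul_neg, neg_neg, Matrix.mul_assoc _ (sqrtL D)⁻¹,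
    ← Matrix.mul_assoc (sqrtL D)⁻¹, h.sqrtL_inv_mul_self]
  simp only [Matrix.conjTranspose_add, Matrix.conjTranspose_mul, hLH,
    Matrix.conjTranspose_conjTranspose, Matrix.mul_add, Matrix.add_mul, Matrix.mul_assoc]
  abel

lemma IsStrictContraction.unitary_blocks (h : IsStrictContraction D) :
    (Matrix.fromBlocks (-Dᴴ) (sqrtR D) (sqrtL D) D)
      * (Matrix.fromBlocks (-Dᴴ) (sqrtR D) (sqrtL D) D)ᴴ = 1 := by
  rw [Matrix.fromBlocks_conjTranspose, Matrix.fromBlocks_multiply, conjTranspose_sqrtL,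
    conjTranspose_sqrtR, Matrix.conjTranspose_neg, Matrix.conjTranspose_conjTranspose,
    h.sqrtR_mul_self, h.sqrtL_mul_self, h.sqrtR_mul_conjTranspose, h.mul_sqrtR, Matrix.neg_mul,
    Matrix.neg_mul, Matrix.mul_neg, Matrix.mul_neg, neg_neg, add_sub_cancel, neg_add_cancel,
    neg_add_cancel, sub_add_cancel, Matrix.fromBlocks_one]

/-- A Hermitian invertible solution of the Riccati equation certifies losslessness of the extended
system. -/
lemma IsHermitianRiccatiSolution.isLosslessSystem (h : IsStrictContraction D)
    (hP : IsHermitianRiccatiSolution A B C D P) (hu : IsUnit P.det) :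
    IsLosslessSystem A (Matrix.fromCols (inB B C D P) B) (Matrix.fromRows (outC B C D P) C)
      (Matrix.fromBlocks (-Dᴴ) (sqrtR D) (sqrtL D) D) P where
  isHermitian := hP.1
  lyapunov := by
    rw [Matrix.conjTranspose_fromCols_eq_fromRows_conjTranspose, Matrix.fromCols_mul_fromRows,
      h.lyapunov_eq_riccati hP.1]
    exact hP.2
  coupling := by
    rw [Matrix.conjTranspose_fromCols_eq_fromRows_conjTranspose, Matrix.fromRows_mul,
      Matrix.fromBlocks_mul_fromRows, Matrix.fromRows_neg, conjTranspose_inB hP.1]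
    congr 1
    · rw [outC, Matrix.neg_mul, Matrix.mul_assoc, Matrix.add_mul, Matrix.mul_assoc,
        Matrix.nonsing_inv_mul _ hu, Matrix.neg_mul, Matrix.mul_neg, neg_neg, ← Matrix.mul_assoc Dᴴ (sqrtL D)⁻¹,
        h.conjTranspose_mul_sqrtL_inv]
      have h1 : sqrtR D = (sqrtR D)⁻¹ * (1 - Dᴴ * D) := by
        rw [← h.sqrtR_mul_self, Matrix.nonsing_inv_mul_cancel_left _ _ h.isUnit_sqrtR]
      conv_rhs => enter [1, 2, 1]; rw [h1]
      simp only [Matrix.mul_add, Matrix.mul_sub, Matrix.sub_mul, Matrix.mul_one, Matrix.mul_assoc]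
      abel
    · rw [Matrix.mul_neg, ← Matrix.mul_assoc, Matrix.mul_nonsing_inv _ h.isUnit_sqrtL,
        Matrix.one_mul]
      abel
  unitary := h.unitary_blocks

/-- For symmetric data and `P Pᵀ = 1` the extension is symmetric. -/
lemma IsStrictContraction.transpose_outC (h : IsStrictContraction D) (hBC : Bᵀ = C) (hD : D = Dᵀ)
    (hPP : P * Pᵀ = 1) : (outC B C D P)ᵀ = inB B C D P := by
  have h1 : (P⁻¹)ᵀ = P := by
    rw [Matrix.inv_eq_right_inv hPP, Matrix.transpose_transpose]
  have h2 : ((sqrtR D)⁻¹)ᵀ = (sqrtL D)⁻¹ := by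
    rw [← h.transpose_sqrtL hD, ← Matrix.transpose_nonsing_inv, Matrix.transpose_transpose]
  have h3 : Dᴴᵀ = Dᴴ := by rw [conjTranspose_transpose_comm, ← hD]
  have h4 : Cᵀ = B := by rw [← hBC, Matrix.transpose_transpose]
  rw [outC, inB, Matrix.transpose_neg, Matrix.transpose_mul, h2, Matrix.transpose_add,
    Matrix.transpose_mul, Matrix.transpose_mul, h1, h3, h4, conjTranspose_transpose_comm, hBC]

end Extension

/-! ### Inner functions come from lossless systems -/

section Converse

open Filter Topology Bornology

variable {n : ℕ} {κ : Type*} [Fintype κ] [DecidableEq κ] {A P : Matrix (Fin n) (Fin n) ℂ}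
  {B : Matrix (Fin n) κ ℂ} {C : Matrix κ (Fin n) ℂ} {D : Matrix κ κ ℂ}

lemma scalar_sub_neg_conjTranspose (A : Matrix (Fin n) (Fin n) ℂ) {s : ℂ} (hs : s.re = 0) :
    Matrix.scalar (Fin n) s - -Aᴴ = -(Matrix.scalar (Fin n) s - A)ᴴ := by
  have h : star s = -s := Complex.ext (by simp [hs]) (by simp)
  rw [Matrix.conjTranspose_sub, Matrix.scalar_apply, ← Matrix.smul_one_eq_diagonal,
    Matrix.conjTranspose_smul, Matrix.conjTranspose_one, h, neg_smul]
  abel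

lemma charpoly_neg_conjTranspose_eval {s : ℂ} (hs : s.re = 0) (h : A.charpoly.eval s ≠ 0) :
    (-Aᴴ).charpoly.eval s ≠ 0 := by
  rw [charpoly_eval] at h ⊢
  rw [scalar_sub_neg_conjTranspose A hs, Matrix.det_neg, Matrix.det_conjTranspose]
  exact mul_ne_zero (pow_ne_zero _ (neg_ne_zero.2 one_ne_zero)) (star_ne_zero.2 h)

/-- On the imaginary axis the para-Hermitian conjugate of the transfer function is its conjugate
transpose. -/
lemma evalAt_para {ι κ : Type*} {B : Matrix (Fin n) κ ℂ} {C : Matrix ι (Fin n) ℂ}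
    {D : Matrix ι κ ℂ} {s : ℂ} (hs : s.re = 0) (h : A.charpoly.eval s ≠ 0) :
    evalAt (transfer (-Aᴴ) Cᴴ (-Bᴴ) Dᴴ) s = (evalAt (transfer A B C D) s)ᴴ := by
  rw [evalAt_transfer _ _ _ h, evalAt_transfer _ _ _ (charpoly_neg_conjTranspose_eval hs h),
    scalar_sub_neg_conjTranspose A hs, Matrix.conjTranspose_add, Matrix.conjTranspose_mul,
    Matrix.conjTranspose_mul, Matrix.conjTranspose_nonsing_inv]
  have h1 : (-(Matrix.scalar (Fin n) s - A)ᴴ)⁻¹ = -((Matrix.scalar (Fin n) s - A)ᴴ)⁻¹ := by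
    refine Matrix.inv_eq_right_inv ?_
    rw [Matrix.neg_mul, Matrix.mul_neg, neg_neg, Matrix.mul_nonsing_inv]
    rw [Matrix.det_conjTranspose]
    exact (isUnit_scalar_sub h).star
  rw [h1, Matrix.neg_mul, Matrix.mul_neg, neg_neg, Matrix.mul_assoc]

lemma infinite_imaginary_axis : {s : ℂ | s.re = 0}.Infinite := by
  refine Set.infinite_of_injective_forall_mem (f := fun ω : ℝ => Complex.I * ω) (fun x y h => ?_)
    fun ω => by simp
  simpa using h

/-- A transfer function with unitary values on the imaginary axis is inverted by its
para-Hermitian conjugate. -/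
lemma transfer_mul_para (hA : ∀ s : ℂ, s.re = 0 → A.charpoly.eval s ≠ 0)
    (hU : ∀ ω : ℝ, evalAt (transfer A B C D) (Complex.I * ω)
      * (evalAt (transfer A B C D) (Complex.I * ω))ᴴ = 1) :
    transfer A B C D * transfer (-Aᴴ) Cᴴ (-Bᴴ) Dᴴ = 1 := by
  have hone : (1 : Matrix κ κ (RatFunc ℂ)) = (1 : Matrix κ κ ℂ).map RatFunc.C := by simp
  rw [hone]
  have hf : ∀ s : ℂ, s.re = 0 → FiniteAt (transfer (-Aᴴ) Cᴴ (-Bᴴ) Dᴴ) s := fun s hs =>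
    finiteAt_transfer _ _ _ (charpoly_neg_conjTranspose_eval hs (hA s hs))
  refine eq_of_evalAt_eq infinite_imaginary_axis
    (fun s hs => (finiteAt_transfer _ _ _ (hA s hs)).mul (hf s hs))
    (fun s _ => finiteAt_const _ s) fun s hs => ?_
  have hs' : s = Complex.I * (s.im : ℝ) := Complex.ext (by simpa using hs) (by simp)
  rw [evalAt_mul (finiteAt_transfer _ _ _ (hA s hs)) (hf s hs), evalAt_para hs (hA s hs),
    evalAt_const, hs']
  exact hU _

lemma HasValueAtInfinity.tendsto {ι κ : Type*} {S : Matrix ι κ (RatFunc ℂ)} {D : Matrix ι κ ℂ}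
    (h : HasValueAtInfinity S D) : Tendsto (fun s => evalAt S s) (cobounded ℂ) (𝓝 D) :=
  tendsto_pi_nhds.2 fun i => tendsto_pi_nhds.2 fun j => h i j

lemma mul_eq_one_at_infinity {m : ℕ} {A' : Matrix (Fin m) (Fin m) ℂ} {B' : Matrix (Fin m) κ ℂ}
    {C' : Matrix κ (Fin m) ℂ} {D' : Matrix κ κ ℂ}
    (h : transfer A B C D * transfer A' B' C' D' = 1) : D * D' = 1 := by
  have h1 := (hasValueAtInfinity_transfer A B C D).tendsto
  have h2 := (hasValueAtInfinity_transfer A' B' C' D').tendsto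
  have hc : Continuous fun X : Matrix κ κ ℂ × Matrix κ κ ℂ => X.1 * X.2 :=
    continuous_fst.matrix_mul continuous_snd
  have h3 := (hc.tendsto (D, D')).comp (h1.prodMk_nhds h2)
  refine tendsto_nhds_unique (h3.congr' ?_) tendsto_const_nhds
  filter_upwards [eventually_charpoly_ne_zero A, eventually_charpoly_ne_zero A'] with s hs hs'
  rw [Function.comp_apply, ← evalAt_mul (finiteAt_transfer _ _ _ hs) (finiteAt_transfer _ _ _ hs'),
    h]
  have hone : (1 : Matrix κ κ (RatFunc ℂ)) = (1 : Matrix κ κ ℂ).map RatFunc.C := by simp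
  rw [hone, evalAt_const]

/-- The inverse system. -/
lemma transfer_mul_inverse {D' : Matrix κ κ ℂ} (h : D * D' = 1) :
    transfer A B C D * transfer (A - B * D' * C) (B * D') (-(D' * C)) D' = 1 := by
  have hN : sMinus (A - B * D' * C) = sMinus A
      + B.map RatFunc.C * D'.map RatFunc.C * C.map RatFunc.C := by
    rw [← map_C_mul, ← map_C_mul]
    ext i j
    simp only [sMinus, Matrix.sub_apply, Matrix.add_apply, Matrix.map_apply, map_sub]
    ring
  have hD : D.map RatFunc.C * D'.map RatFunc.C = 1 := by
    rw [← map_C_mul, h]; simp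
  have hneg : (-(D' * C)).map RatFunc.C = -(D'.map RatFunc.C * C.map RatFunc.C) := by
    rw [← map_C_mul]; ext i j; simp only [Matrix.map_apply, Matrix.neg_apply, map_neg]
  rw [transfer_def, transfer_def, hneg, map_C_mul]
  generalize B.map RatFunc.C = b at *
  generalize C.map RatFunc.C = c at *
  generalize D.map RatFunc.C = d at *
  generalize D'.map RatFunc.C = d' at *
  have h1 : (sMinus A)⁻¹ - (sMinus (A - B * D' * C))⁻¹
      = (sMinus A)⁻¹ * (b * d' * c) * (sMinus (A - B * D' * C))⁻¹ := by
    have h2 : b * d' * c = sMinus (A - B * D' * C) - sMinus A := by rw [hN, add_sub_cancel_left]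
    rw [h2, Matrix.mul_sub, Matrix.sub_mul, inv_mul_sMinus, Matrix.mul_assoc _ (sMinus _),
      sMinus_mul_inv, Matrix.mul_one, Matrix.one_mul]
  generalize (sMinus A)⁻¹ = x at *
  generalize (sMinus (A - B * D' * C))⁻¹ = y at *
  have h3 : (c * x * b + d) * (-(d' * c) * y * (b * d') + d')
      = c * (x - y - x * (b * d' * c) * y) * (b * d') + (d * d') 
        + (c * y * (b * d') - d * d' * c * y * (b * d')) := by
    simp only [Matrix.mul_add, Matrix.add_mul, Matrix.mul_sub, Matrix.sub_mul, Matrix.neg_mul,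
      Matrix.mul_neg, Matrix.mul_assoc]
    abel
  rw [h3, h1, sub_self, Matrix.mul_zero, Matrix.zero_mul, hD, Matrix.one_mul, sub_self, zero_add,
    add_zero]

/-- A minimal system whose transfer function is unitary on the imaginary axis is lossless: the
isomorphism between the realizations of the inverse and of the para-Hermitian conjugate is the
certificate, up to sign. -/
lemma exists_isLosslessSystem (hc : Controllable A B) (ho : Observable A C)
    (hA : ∀ s : ℂ, s.re = 0 → A.charpoly.eval s ≠ 0)
    (hU : ∀ ω : ℝ, evalAt (transfer A B C D) (Complex.I * ω)
      * (evalAt (transfer A B C D) (Complex.I * ω))ᴴ = 1) :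
    ∃ P, IsLosslessSystem A B C D P ∧ IsUnit P.det := by
  have h1 := transfer_mul_para hA hU
  have hD := mul_eq_one_at_infinity h1
  have hD' : Dᴴ * D = 1 := mul_eq_one_comm.1 hD
  have h2 := transfer_mul_inverse (A := A) (B := B) (C := C) hD
  have heq : transfer (-Aᴴ) Cᴴ (-Bᴴ) Dᴴ
      = transfer (A - B * Dᴴ * C) (B * Dᴴ) (-(Dᴴ * C)) Dᴴ := by
    calc transfer (-Aᴴ) Cᴴ (-Bᴴ) Dᴴ
        = transfer (-Aᴴ) Cᴴ (-Bᴴ) Dᴴ * (transfer A B C D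
          * transfer (A - B * Dᴴ * C) (B * Dᴴ) (-(Dᴴ * C)) Dᴴ) := by rw [h2, Matrix.mul_one]
      _ = _ := by rw [← Matrix.mul_assoc, mul_eq_one_comm.1 h1, Matrix.one_mul]
  have hneg : (-1 : Matrix κ κ ℂ) * -1 = 1 := by rw [neg_mul_neg, one_mul]
  have hcP : Controllable (-Aᴴ) Cᴴ := ho.conj.neg_left
  have hoP : Observable (-Aᴴ) (-Bᴴ) := by
    have h3 := (hc.conj.neg_left).feedback 0 hneg
    rw [Matrix.mul_zero, add_zero, Matrix.mul_neg, Matrix.mul_one] at h3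
    exact h3
  have hcI : Controllable (A - B * Dᴴ * C) (B * Dᴴ) := by
    have h3 := hc.feedback (-(Dᴴ * C)) hD'
    rwa [Matrix.mul_neg, ← sub_eq_add_neg, ← Matrix.mul_assoc] at h3
  have hoI : Observable (A - B * Dᴴ * C) (-(Dᴴ * C)) := by
    have hG : -Dᴴᵀ * -Dᵀ = 1 := by
      rw [neg_mul_neg, ← Matrix.transpose_mul, hD, Matrix.transpose_one]
    have h3 := Controllable.feedback ho (-(Dᴴᵀ * Bᵀ)) hG
    rw [Observable, Matrix.transpose_sub, Matrix.transpose_neg, Matrix.transpose_mul,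
      Matrix.transpose_mul, Matrix.transpose_mul, ← Matrix.mul_neg, sub_eq_add_neg,
      ← Matrix.mul_neg]
    exact h3
  obtain ⟨X, Y, hXY, -, hXA, hXB, hXC⟩ := exists_isomorphism hcP hoP hcI hoI heq
  have hXC' : Bᴴ = Dᴴ * (C * X) := by
    rw [Matrix.neg_mul, Matrix.mul_assoc] at hXC
    exact (neg_injective hXC).symm
  have hcoup : C * X = D * Bᴴ := by
    rw [hXC', ← Matrix.mul_assoc, hD, Matrix.one_mul]
  have hlyap : A * -X + -X * Aᴴ + B * Bᴴ = 0 := by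
    rw [Matrix.neg_mul, ← Matrix.mul_neg X, hXA, Matrix.sub_mul, Matrix.mul_neg]
    have : B * Dᴴ * C * X = B * Bᴴ := by rw [hXC']; simp only [Matrix.mul_assoc]
    rw [this]; abel
  have hherm : (-X).IsHermitian := by
    suffices h : X - Xᴴ = 0 by
      rw [Matrix.IsHermitian, Matrix.conjTranspose_neg, ← sub_eq_zero.1 h]
    refine hcP.intertwiner_unique (A' := A) ?_ (by rw [Matrix.zero_mul, Matrix.mul_zero]) ?_
    · have h4 := congrArg Matrix.conjTranspose hlyap
      simp only [Matrix.conjTranspose_add, Matrix.conjTranspose_mul, Matrix.conjTranspose_neg,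
        Matrix.conjTranspose_conjTranspose, Matrix.conjTranspose_zero] at h4
      have h5 : (X - Xᴴ) * -Aᴴ - A * (X - Xᴴ)
          = (A * -X + -X * Aᴴ + B * Bᴴ) - (-Xᴴ * Aᴴ + A * -Xᴴ + B * Bᴴ) := by noncomm_ring
      rw [hlyap, h4, sub_zero] at h5
      exact sub_eq_zero.1 h5
    · have h4 := congrArg Matrix.conjTranspose hcoup
      rw [Matrix.conjTranspose_mul, Matrix.conjTranspose_mul,
        Matrix.conjTranspose_conjTranspose] at h4
      rw [Matrix.sub_mul, hXB, h4, sub_self, Matrix.zero_mul]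
  refine ⟨-X, ⟨hherm, hlyap, by rw [Matrix.mul_neg, hcoup], hD⟩, ?_⟩
  rw [← Matrix.isUnit_iff_isUnit_det]
  exact (IsUnit.of_mul_eq_one Y hXY).neg

/-- For a symmetric system the losslessness certificate satisfies `P Pᵀ = 1`: the inverse of `Pᵀ` is
a certificate as well, and certificates are unique. -/
lemma IsLosslessSystem.mul_transpose_eq_one (h : IsLosslessSystem A B C D P) (hu : IsUnit P.det)
    (ho : Observable A C) (hA : A = Aᵀ) (hBC : Bᵀ = C) (hD : D = Dᵀ) : P * Pᵀ = 1 := by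
  obtain ⟨Q, hQ⟩ : ∃ Q, Q = (Pᵀ)⁻¹ := ⟨_, rfl⟩
  have huT : IsUnit (Pᵀ).det := by rwa [Matrix.det_transpose]
  have hPQ : Pᵀ * Q = 1 := by rw [hQ, Matrix.mul_nonsing_inv _ huT]
  have hQP : Q * Pᵀ = 1 := by rw [hQ, Matrix.nonsing_inv_mul _ huT]
  have hQH : Qᴴ = Q := by
    rw [hQ, Matrix.conjTranspose_nonsing_inv, h.isHermitian.transpose.eq]
  have hAT : Aᴴᵀ = Aᴴ := conjTranspose_transpose_eq hA.symm
  have hBT : Bᴴᵀ = Cᴴ := by rw [conjTranspose_transpose_comm, hBC]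
  have hCT : Cᵀ = B := by rw [← hBC, Matrix.transpose_transpose]
  have hCT' : Cᴴᵀ = Bᴴ := by rw [conjTranspose_transpose_comm, hCT]
  have hDT : Dᴴᵀ = Dᴴ := by rw [conjTranspose_transpose_comm, ← hD]
  have hPC : P * Cᴴ = -(B * Dᴴ) := by
    have h1 := congrArg Matrix.conjTranspose h.coupling
    rwa [Matrix.conjTranspose_mul, h.isHermitian.eq, Matrix.conjTranspose_neg,
      Matrix.conjTranspose_mul, Matrix.conjTranspose_conjTranspose] at h1
  have hDC : Bᴴ = -(Dᴴ * (C * Q)) := by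
    have h1 := congrArg Matrix.transpose hPC
    rw [Matrix.transpose_mul, hCT', Matrix.transpose_neg, Matrix.transpose_mul, hBC, hDT] at h1
    calc Bᴴ = Bᴴ * Pᵀ * Q := by rw [Matrix.mul_assoc, hPQ, Matrix.mul_one]
      _ = _ := by rw [h1, Matrix.neg_mul, Matrix.mul_assoc]
  have hCQ : C * Q = -(D * Bᴴ) := by
    rw [hDC, Matrix.mul_neg, neg_neg, ← Matrix.mul_assoc, h.unitary, Matrix.one_mul]
  have hQC : Q * Cᴴ = -(B * Dᴴ) := by
    have h1 := congrArg Matrix.conjTranspose hCQ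
    rwa [Matrix.conjTranspose_mul, hQH, Matrix.conjTranspose_neg, Matrix.conjTranspose_mul,
      Matrix.conjTranspose_conjTranspose] at h1
  have hlyap : A * Q + Q * Aᴴ + B * Bᴴ = 0 := by
    have h1 := congrArg Matrix.transpose h.lyapunov
    rw [Matrix.transpose_add, Matrix.transpose_add, Matrix.transpose_mul, Matrix.transpose_mul,
      Matrix.transpose_mul, ← hA, hAT, hBT, hBC, Matrix.transpose_zero] at h1
    have h2 : B * Bᴴ = Q * (Cᴴ * C) * Q := by
      have : Q * (Cᴴ * C) * Q = (Q * Cᴴ) * (C * Q) := by simp only [Matrix.mul_assoc]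
      rw [this, hQC]
      nth_rewrite 1 [hDC]
      rw [Matrix.neg_mul, Matrix.mul_neg]
      simp only [Matrix.mul_assoc]
    have h3 : A * Q + Q * Aᴴ + Q * (Cᴴ * C) * Q = Q * (Pᵀ * A + Aᴴ * Pᵀ + Cᴴ * C) * Q := by
      have : Q * (Pᵀ * A + Aᴴ * Pᵀ + Cᴴ * C) * Q
          = (Q * Pᵀ) * (A * Q) + Q * Aᴴ * (Pᵀ * Q) + Q * (Cᴴ * C) * Q := by noncomm_ring
      rw [this, hQP, hPQ, Matrix.one_mul, Matrix.mul_one]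
    rw [h2, h3, h1, Matrix.mul_zero, Matrix.zero_mul]
  have hcP : Controllable (-Aᴴ) Cᴴ := ho.conj.neg_left
  have hPQ' : P = Q := by
    refine sub_eq_zero.1 (hcP.intertwiner_unique (A' := A) (X := P - Q) (Y := 0) ?_ (by simp) ?_)
    · have h5 : (P - Q) * -Aᴴ - A * (P - Q)
          = (A * Q + Q * Aᴴ + B * Bᴴ) - (A * P + P * Aᴴ + B * Bᴴ) := by noncomm_ring
      rw [hlyap, h.lyapunov, sub_zero] at h5
      exact sub_eq_zero.1 h5
    · rw [Matrix.sub_mul, hPC, hQC, sub_self, Matrix.zero_mul]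
  rw [← hPQ'] at hQP
  exact hQP

end Converse

/-! ### Symmetric inner extensions -/

section Parametrization

variable {n : ℕ} {ι κ : Type*}

lemma transfer_submatrix {ι' κ' : Type*} (A : Matrix (Fin n) (Fin n) ℂ) (B : Matrix (Fin n) κ ℂ)
    (C : Matrix ι (Fin n) ℂ) (D : Matrix ι κ ℂ) (f : ι' → ι) (g : κ' → κ) :
    (transfer A B C D).submatrix f g
      = transfer A (B.submatrix id g) (C.submatrix f id) (D.submatrix f g) := rfl

lemma transfer_toBlocks₂₂ (A : Matrix (Fin n) (Fin n) ℂ) (B₁ B : Matrix (Fin n) ι ℂ)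
    (C₁ C : Matrix ι (Fin n) ℂ) (D₁₁ D₁₂ D₂₁ D : Matrix ι ι ℂ) :
    (transfer A (Matrix.fromCols B₁ B) (Matrix.fromRows C₁ C)
      (Matrix.fromBlocks D₁₁ D₁₂ D₂₁ D)).toBlocks₂₂ = transfer A B C D := rfl

/-- An extension has at least the McMillan degree of the block it extends. -/
lemma HasMcMillanDegree.of_toBlocks₂₂ {S : Matrix ι ι (RatFunc ℂ)}
    {T : Matrix (ι ⊕ ι) (ι ⊕ ι) (RatFunc ℂ)} (hS : HasMcMillanDegree S n) (hT : T.toBlocks₂₂ = S)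
    (h : HasRealizationOfSize T n) : HasMcMillanDegree T n := by
  refine ⟨h, fun m hm => hS.2 ?_⟩
  obtain ⟨A, B, C, D, rfl⟩ := hm
  exact ⟨A, _, _, _, hT.symm.trans (transfer_submatrix A B C D Sum.inr Sum.inr)⟩

variable [Fintype ι] [DecidableEq ι]
  {A P : Matrix (Fin n) (Fin n) ℂ} {B : Matrix (Fin n) ι ℂ} {C : Matrix ι (Fin n) ℂ}
  {D : Matrix ι ι ℂ} {S : Matrix ι ι (RatFunc ℂ)}

lemma fromBlocks_unitary {U : Matrix ι ι ℂ} (hU : U * Uᴴ = 1) :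
    (Matrix.fromBlocks U 0 0 1 : Matrix (ι ⊕ ι) (ι ⊕ ι) ℂ)
      * (Matrix.fromBlocks U 0 0 1)ᴴ = 1 := by
  rw [Matrix.fromBlocks_conjTranspose, Matrix.fromBlocks_multiply]
  simp [hU]

lemma diagOne_mul_extensionOf_mul (A P : Matrix (Fin n) (Fin n) ℂ) (B : Matrix (Fin n) ι ℂ)
    (C : Matrix ι (Fin n) ℂ) (D U₁ U₂ : Matrix ι ι ℂ) :
    diagOne U₂ * extensionOf A B C D P * diagOne U₁
      = transfer A
        (Matrix.fromCols (inB B C D P) B * (Matrix.fromBlocks U₁ 0 0 1 : Matrix (ι ⊕ ι) (ι ⊕ ι) ℂ))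
        ((Matrix.fromBlocks U₂ 0 0 1 : Matrix (ι ⊕ ι) (ι ⊕ ι) ℂ)
          * Matrix.fromRows (outC B C D P) C)
        ((Matrix.fromBlocks U₂ 0 0 1 : Matrix (ι ⊕ ι) (ι ⊕ ι) ℂ)
          * Matrix.fromBlocks (-Dᴴ) (sqrtR D) (sqrtL D) D
          * (Matrix.fromBlocks U₁ 0 0 1 : Matrix (ι ⊕ ι) (ι ⊕ ι) ℂ)) := by
  rw [diagOne, diagOne, extensionOf, const_mul_transfer, transfer_mul_const]

lemma diagOne_mul_extensionOf_mul' (A P : Matrix (Fin n) (Fin n) ℂ) (B : Matrix (Fin n) ι ℂ)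
    (C : Matrix ι (Fin n) ℂ) (D U₁ U₂ : Matrix ι ι ℂ) :
    diagOne U₂ * extensionOf A B C D P * diagOne U₁
      = transfer A (Matrix.fromCols (inB B C D P * U₁) B)
        (Matrix.fromRows (U₂ * outC B C D P) C)
        (Matrix.fromBlocks (-(U₂ * Dᴴ * U₁)) (U₂ * sqrtR D) (sqrtL D * U₁) D) := by
  rw [diagOne_mul_extensionOf_mul, Matrix.fromCols_mul_fromBlocks, Matrix.fromBlocks_mul_fromRows,
    Matrix.fromBlocks_multiply, Matrix.fromBlocks_multiply]
  simp

/-- Every symmetric solution of the Riccati equation yields symmetric inner extensions. -/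
lemma isSymmetricInnerExtension_of_solution (hS : IsSchur S)
    (h : IsMinimalSymmetricRealization S A B C D) (hst : IsStrictContraction D)
    (hP : IsHermitianRiccatiSolution A B C D P) (hPP : P * Pᵀ = 1) {U₁ U₂ : Matrix ι ι ℂ}
    (h₁ : U₁ * U₁ᴴ = 1) (h₂ : U₂ * U₂ᴴ = 1) (h₁₂ : U₁ = U₂ᵀ) :
    IsSymmetricInnerExtension S (diagOne U₂ * extensionOf A B C D P * diagOne U₁) := by
  obtain ⟨hmin, hA, hBC, hD⟩ := h
  have h22 : (diagOne U₂ * extensionOf A B C D P * diagOne U₁).toBlocks₂₂ = S := by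
    rw [diagOne_mul_extensionOf_mul', transfer_toBlocks₂₂, hmin.1]
  refine ⟨h22, ?_, ?_, n, hmin.2.of_toBlocks₂₂ h22 ?_, hmin.2⟩
  · have hC := hst.transpose_outC hBC hD hPP
    have hB : (inB B C D P)ᵀ = outC B C D P := by rw [← hC, Matrix.transpose_transpose]
    have hL := hst.transpose_sqrtL hD
    have hR : (sqrtR D)ᵀ = sqrtL D := by rw [← hL, Matrix.transpose_transpose]
    have hCB : Cᵀ = B := by rw [← hBC, Matrix.transpose_transpose]
    have hDT : Dᴴᵀ = Dᴴ := by rw [conjTranspose_transpose_comm, ← hD]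
    have hU : U₂ᵀ = U₁ := h₁₂.symm
    have hU' : U₁ᵀ = U₂ := by rw [h₁₂, Matrix.transpose_transpose]
    rw [diagOne_mul_extensionOf_mul', transfer_transpose, ← hA, Matrix.transpose_fromRows,
      Matrix.transpose_fromCols, Matrix.fromBlocks_transpose]
    simp only [Matrix.transpose_mul, Matrix.transpose_neg, hB, hC, hL, hR, hBC, hCB, hU, hU', hDT,
      ← hD, Matrix.mul_assoc]
  · rw [diagOne_mul_extensionOf_mul]
    exact ((hP.isLosslessSystem hst (Matrix.isUnit_det_of_right_inverse hPP)).mul_unitary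
      (fromBlocks_unitary h₁) (fromBlocks_unitary h₂)).isInner
      fun s hs => hS.charpoly_eval_ne_zero hmin hs
  · rw [diagOne_mul_extensionOf_mul]
    exact ⟨_, _, _, _, rfl⟩

/-- A realization of minimal size of an extension can be chosen to restrict to a given minimal
realization of the extended block. -/
lemma exists_extended_realization {T : Matrix (ι ⊕ ι) (ι ⊕ ι) (RatFunc ℂ)}
    (h : IsMinimalRealization S A B C D) (h22 : T.toBlocks₂₂ = S)
    (hT : HasRealizationOfSize T n) :
    ∃ (B₁ : Matrix (Fin n) ι ℂ) (C₁ : Matrix ι (Fin n) ℂ) (D₁₁ D₁₂ D₂₁ : Matrix ι ι ℂ),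
      T = transfer A (Matrix.fromCols B₁ B) (Matrix.fromRows C₁ C)
        (Matrix.fromBlocks D₁₁ D₁₂ D₂₁ D) := by
  obtain ⟨A', B', C', D', rfl⟩ := hT
  have h1 : S = transfer A' B'.toCols₂ C'.toRows₂ D'.toBlocks₂₂ := h22.symm
  have hmin : IsMinimalRealization S A' B'.toCols₂ C'.toRows₂ D'.toBlocks₂₂ := ⟨h1, h.2⟩
  have heq := h.1.symm.trans h1
  obtain ⟨X, Y, hXY, hYX, hXA, hXB, hXC⟩ := exists_isomorphism h.controllable h.observable
    hmin.controllable hmin.observable heq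
  refine ⟨Y * B'.toCols₁, C'.toRows₁ * X, D'.toBlocks₁₁, D'.toBlocks₁₂, D'.toBlocks₂₁, ?_⟩
  rw [(markov_eq heq).1, Matrix.fromBlocks_toBlocks, ← hXC, ← Matrix.fromRows_mul,
    Matrix.fromRows_toRows]
  refine transfer_eq_of_intertwine _ _ hXA.symm ?_
  rw [Matrix.mul_fromCols, ← Matrix.mul_assoc, hXY, Matrix.one_mul, hXB, Matrix.fromCols_toCols]

/-- Every symmetric inner extension of the same McMillan degree comes from a symmetric solution of
the Riccati equation and a unitary matrix. -/
lemma exists_solution_of_isSymmetricInnerExtension (hS : IsSchur S)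
    (h : IsMinimalSymmetricRealization S A B C D) (hst : IsStrictContraction D)
    {T : Matrix (ι ⊕ ι) (ι ⊕ ι) (RatFunc ℂ)} (hT : IsSymmetricInnerExtension S T) :
    ∃ U : Matrix ι ι ℂ, U * Uᴴ = 1 ∧ ∃ P, IsHermitianRiccatiSolution A B C D P ∧ P * Pᵀ = 1 ∧
      T = diagOne Uᵀ * extensionOf A B C D P * diagOne U := by
  obtain ⟨hmin, hA, hBC, hD⟩ := h
  obtain ⟨h22, hsym, hinner, m, hTm, hSm⟩ := hT
  obtain rfl : m = n := hSm.unique hmin.2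
  obtain ⟨B₁, C₁, D₁₁, D₁₂, D₂₁, rfl⟩ := exists_extended_realization hmin h22 hTm.1
  have hTmin : IsMinimalRealization _ A (Matrix.fromCols B₁ B) (Matrix.fromRows C₁ C)
    (Matrix.fromBlocks D₁₁ D₁₂ D₂₁ D) := ⟨rfl, hTm⟩
  have hCB : Cᵀ = B := by rw [← hBC, Matrix.transpose_transpose]
  -- The symmetry of `T` gives an automorphism of the state space which fixes `B`, hence is trivial.
  rw [transfer_transpose, ← hA, Matrix.transpose_fromRows, Matrix.transpose_fromCols,
    Matrix.fromBlocks_transpose, ← hD, hBC, hCB] at hsym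
  have hTmin' : IsMinimalRealization _ A (Matrix.fromCols C₁ᵀ B) (Matrix.fromRows B₁ᵀ C)
    (Matrix.fromBlocks D₁₁ᵀ D₂₁ᵀ D₁₂ᵀ D) := ⟨rfl, hsym ▸ hTm⟩
  obtain ⟨X, Y, -, -, hXA, hXB, hXC⟩ := exists_isomorphism hTmin'.controllable hTmin'.observable
    hTmin.controllable hTmin.observable hsym
  rw [Matrix.mul_fromCols, Matrix.fromCols_ext_iff] at hXB
  obtain rfl : X = 1 := hmin.controllable.intertwiner_unique hXA
    (by rw [Matrix.one_mul, Matrix.mul_one]) (by rw [hXB.2, Matrix.one_mul])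
  obtain ⟨hC₁, -⟩ := hXB
  rw [Matrix.one_mul] at hC₁
  obtain ⟨-, h21, -, -⟩ := Matrix.fromBlocks_inj.1 (markov_eq hsym).1
  have hne : ∀ s : ℂ, s.re = 0 → A.charpoly.eval s ≠ 0 := fun s hs =>
    hS.charpoly_eval_ne_zero hmin hs.ge
  obtain ⟨P, hP, hu⟩ := exists_isLosslessSystem hTmin.controllable hTmin.observable hne hinner.2
  have hPP : P * Pᵀ = 1 := by
    refine hP.mul_transpose_eq_one hu hTmin.observable hA ?_ ?_
    · rw [Matrix.transpose_fromCols, hBC, ← hC₁, Matrix.transpose_transpose]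
    · rw [Matrix.fromBlocks_transpose]
      exact (markov_eq hsym).1.symm.trans (by rw [← hD])
  -- Unitarity of the value at infinity produces the unitary factor `U`.
  have hDu := hP.unitary
  rw [Matrix.fromBlocks_conjTranspose, Matrix.fromBlocks_multiply, ← Matrix.fromBlocks_one,
    Matrix.fromBlocks_inj] at hDu
  obtain ⟨-, hu12, -, hu22⟩ := hDu
  have hL := hst.isUnit_sqrtL
  have hD21 : D₂₁ * D₂₁ᴴ = sqrtL D * sqrtL D := by
    rw [hst.sqrtL_mul_self]; exact eq_sub_of_add_eq hu22
  have hinvH : ((sqrtL D)⁻¹)ᴴ = (sqrtL D)⁻¹ := by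
    rw [Matrix.conjTranspose_nonsing_inv, conjTranspose_sqrtL]
  obtain ⟨U, hUdef⟩ : ∃ U, U = (sqrtL D)⁻¹ * D₂₁ := ⟨_, rfl⟩
  have hLU : D₂₁ = sqrtL D * U := by
    rw [hUdef, Matrix.mul_nonsing_inv_cancel_left _ _ hL]
  have hUU : U * Uᴴ = 1 := by
    rw [hUdef, Matrix.conjTranspose_mul, hinvH, Matrix.mul_assoc, ← Matrix.mul_assoc D₂₁, hD21,
      Matrix.mul_assoc, Matrix.mul_nonsing_inv _ hL, Matrix.mul_one, Matrix.nonsing_inv_mul _ hL]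
  have hUU' : Uᴴ * U = 1 := mul_eq_one_comm.1 hUU
  have hD12 : D₁₂ = Uᵀ * sqrtR D := by
    rw [← h21, hLU, Matrix.transpose_mul, hst.transpose_sqrtL hD]
  have hD11 : D₁₁ = -(Uᵀ * Dᴴ * U) := by
    have h1 : D₁₁ * Uᴴ * sqrtL D = -(Uᵀ * Dᴴ) * sqrtL D := by
      rw [hLU, hD12, Matrix.conjTranspose_mul, conjTranspose_sqrtL, Matrix.mul_assoc Uᵀ,
        hst.sqrtR_mul_conjTranspose, ← Matrix.mul_assoc, ← Matrix.mul_assoc] at hu12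
      rw [Matrix.neg_mul]
      exact eq_neg_of_add_eq_zero_left hu12
    have h2 : D₁₁ * Uᴴ = -(Uᵀ * Dᴴ) := by
      have := congrArg (fun M => M * (sqrtL D)⁻¹) h1
      simpa only [Matrix.mul_assoc, Matrix.mul_nonsing_inv _ hL, Matrix.mul_one, Matrix.neg_mul]
        using this
    calc D₁₁ = D₁₁ * Uᴴ * U := by rw [Matrix.mul_assoc, hUU', Matrix.mul_one]
      _ = _ := by rw [h2, Matrix.neg_mul]
  have hcoup := hP.coupling
  rw [Matrix.conjTranspose_fromCols_eq_fromRows_conjTranspose, Matrix.fromRows_mul,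
    Matrix.fromBlocks_mul_fromRows, Matrix.fromRows_neg, Matrix.fromRows_ext_iff] at hcoup
  have hB₁' : U * B₁ᴴ = (inB B C D P)ᴴ := by
    have h1 : sqrtL D * (U * B₁ᴴ) = -(C * P + D * Bᴴ) := by
      rw [hcoup.2, ← Matrix.mul_assoc, ← hLU]; abel
    rw [conjTranspose_inB hP.isHermitian, ← Matrix.mul_neg, ← h1,
      Matrix.nonsing_inv_mul_cancel_left _ _ hL]
  have hB₁U : B₁ * Uᴴ = inB B C D P := by
    have := congrArg Matrix.conjTranspose hB₁'
    rwa [Matrix.conjTranspose_mul, Matrix.conjTranspose_conjTranspose,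
      Matrix.conjTranspose_conjTranspose] at this
  have hB₁ : B₁ = inB B C D P * U := by
    rw [← hB₁U, Matrix.mul_assoc, hUU', Matrix.mul_one]
  have hC₁' : C₁ = Uᵀ * outC B C D P := by
    rw [← Matrix.transpose_transpose C₁, hC₁, hB₁, Matrix.transpose_mul,
      ← hst.transpose_outC hBC hD hPP, Matrix.transpose_transpose]
  refine ⟨U, hUU, P, ⟨hP.isHermitian, ?_⟩, hPP, ?_⟩
  · rw [← hst.lyapunov_eq_riccati hP.isHermitian, ← hP.lyapunov,
      Matrix.conjTranspose_fromCols_eq_fromRows_conjTranspose, Matrix.fromCols_mul_fromRows,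
      ← hB₁', ← hB₁U, Matrix.mul_assoc B₁, ← Matrix.mul_assoc Uᴴ, hUU', Matrix.one_mul]
  · rw [diagOne_mul_extensionOf_mul', ← hB₁, ← hC₁', ← hD11, ← hD12, ← hLU]

end Parametrization

end SymDarlington

theorem corollary5p1 (p : ℕ) (S : Matrix (Fin p) (Fin p) (RatFunc ℂ))
    (hsymm : Sᵀ = S) (hschur : IsSchur S) (hinf : StrictlyContractiveAtInfinity S) :
    (∃ (n : ℕ) (A : Matrix (Fin n) (Fin n) ℂ) (B : Matrix (Fin n) (Fin p) ℂ)
      (C : Matrix (Fin p) (Fin n) ℂ) (D : Matrix (Fin p) (Fin p) ℂ),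
        IsMinimalSymmetricRealization S A B C D) ∧
    ∀ (n : ℕ) (A : Matrix (Fin n) (Fin n) ℂ) (B : Matrix (Fin n) (Fin p) ℂ)
      (C : Matrix (Fin p) (Fin n) ℂ) (D : Matrix (Fin p) (Fin p) ℂ),
      IsMinimalSymmetricRealization S A B C D →
        ((∃ T : Matrix (Fin p ⊕ Fin p) (Fin p ⊕ Fin p) (RatFunc ℂ),
            IsSymmetricInnerExtension S T) ↔
          (∃ P : Matrix (Fin n) (Fin n) ℂ,
            IsHermitianRiccatiSolution A B C D P ∧ P * Pᵀ = 1)) ∧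
        ((∃ P : Matrix (Fin n) (Fin n) ℂ,
            IsHermitianRiccatiSolution A B C D P ∧ P * Pᵀ = 1) ↔
          (∃ π : Polynomial ℂ, (hamiltonian A B C D).charpoly = π ^ 2)) ∧
        (∀ T : Matrix (Fin p ⊕ Fin p) (Fin p ⊕ Fin p) (RatFunc ℂ),
          IsSymmetricInnerExtension S T ↔
            ∃ U₁ ∈ Matrix.unitaryGroup (Fin p) ℂ, ∃ U₂ ∈ Matrix.unitaryGroup (Fin p) ℂ,
              ∃ P : Matrix (Fin n) (Fin n) ℂ,
                U₁ = U₂ᵀ ∧ IsHermitianRiccatiSolution A B C D P ∧ P * Pᵀ = 1 ∧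
                  T = diagOne U₂ * extensionOf A B C D P * diagOne U₁) := by
  obtain ⟨D₀, hD₀, hn₀⟩ := id hinf
  refine ⟨exists_minimal_symmetric_realization hsymm hD₀.realizable, fun n A B C D h => ?_⟩
  obtain rfl : D = D₀ := (h.1.1 ▸ hasValueAtInfinity_transfer A B C D).unique hD₀
  have hst := isStrictContraction_of_norm_lt hn₀
  refine ⟨⟨?_, ?_⟩, exists_solution_iff_charpoly hschur h hinf, fun T => ⟨fun hT => ?_, ?_⟩⟩
  · rintro ⟨T, hT⟩
    obtain ⟨-, -, P, hP, hPP, -⟩ := exists_solution_of_isSymmetricInnerExtension hschur h hst hT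
    exact ⟨P, hP, hPP⟩
  · rintro ⟨P, hP, hPP⟩
    exact ⟨_, isSymmetricInnerExtension_of_solution hschur h hst hP hPP (U₁ := 1) (U₂ := 1)
      (by simp) (by simp) (by simp)⟩
  · obtain ⟨U, hU, P, hP, hPP, hTP⟩ :=
      exists_solution_of_isSymmetricInnerExtension hschur h hst hT
    refine ⟨U, Matrix.mem_unitaryGroup_iff.2 hU, Uᵀ, Matrix.mem_unitaryGroup_iff.2 ?_, P,
      Uᵀᵀ.transpose_transpose ▸ rfl, hP, hPP, hTP⟩
    rw [Matrix.star_eq_conjTranspose, ← conjTranspose_transpose_comm, ← Matrix.transpose_mul,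
      mul_eq_one_comm.1 hU, Matrix.transpose_one]
  · rintro ⟨U₁, hU₁, U₂, hU₂, P, h₁₂, hP, hPP, rfl⟩
    exact isSymmetricInnerExtension_of_solution hschur h hst hP hPP
      (Matrix.mem_unitaryGroup_iff.1 hU₁) (Matrix.mem_unitaryGroup_iff.1 hU₂) h₁₂
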